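/- **Setting.** Fix a smooth $\varphi_0:\mathbb R\to[0,1]$ with $\varphi_0=1$ on $[-1,1]$ and $\varphi_0(\xi)=0$ for $|\xi|\ge 2$; put $\varphi_j(\xi)=\varphi_0(2^{-j}\xi)-\varphi_0(2^{-j+1}\xi)$ for $j\ge1$, $S_ju=\mathcal F^{-1}(\varphi_j\hat u)$ (Fourier transform in $x$) and $S_{<j}=\sum_{0\le k<j}S_k$. For each $l\ge0$ let $\mathcal Q_l$ be a partition of $\mathbb R$ into intervals of length $2^l$, and for each $j\ge 0$ let $1=\sum_{Q\in\mathcal Q_{2j}}\chi_Q^2$ be a smooth square partition of unity with $\operatorname{supp}\chi_Q\subset B(Q,\tfrac12)$ and $\chi_Q\ge c>0$ on $Q$, $c$ independent of $j$ and $Q$. All norms are over times $t\in[0,1]$. For a norm $U$ put $\|g\|_{l^2_{2j}U}^2=\sum_{Q\in\mathcal Q_{2j}}\|g\chi_Q\|_U^2$. Define $$\|g\|_X=\sup_{l\ge0}\sup_{Q\in\mathcal Q_l}2^{-l/2}\|g\|_{L^2([0,1]\times Q)},\qquad \|g\|_{X_j}=2^j\|g\|_X+\|g\|_{L^\infty_tL^2_x},\qquad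 \|u\|_{l^2X^s}^2=\sum_{j\ge0}2^{2js}\|S_ju\|_{l^2_{2j}X_j}^2 .$$ An atom is a function $a$ supported in $[0,1]\times Q$ with $\|a\|_{L^2}\le2^{-l/2}$ for some $l\ge0$, $Q\in\mathcal Q_l$; define $$\|f\|_Y=\inf\Big\{\sum_k|c_k|: f=\sum_kc_ka_k,\ a_k\text{ atoms}\Big\},\qquad \|f\|_{Y_j}=\inf_{f=f_1+f_2}\big(2^{-j}\|f_1\|_Y+\|f_2\|_{L^1_tL^2_x}\big),\qquad \|f\|_{l^2Y^s}^2=\sum_{j\ge0}2^{2js}\|S_jf\|_{l^2_{2j}Y_j}^2 .$$ The space $l^2X^s$ consists of the $u\in C([0,1],H^s(\mathbb R))$ (complex valued) with $\|u\|_{l^2X^s}<\infty$, and $l^2Y^s$ of the measurable time-dependent tempered distributions $f$ with $\|f\|_{l^2Y^s}<\infty$. **Proposition.** Let $s,\alpha,\beta,\gamma\in\mathbb R$ with $s\ge-\tfrac32$ and $\alpha+\beta+\gamma>s+1$. a) If $\alpha,\beta,\gamma\ge s-2$ and $\alpha+\beta,\ \beta+\gamma,\ \gamma+\alpha>s-\tfrac12$,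 then there is a constant $C$ (depending only on $s,\alpha,\beta,\gamma$ and the fixed choice of $\varphi_0$, $\mathcal Q_l$, $\chi_Q$) such that for all $u\in l^2X^\alpha$, $v\in l^2X^\beta$, $w\in l^2X^\gamma$ the product $$uvw=\lim_{N\to\infty}(S_{<N}u)(S_{<N}v)(S_{<N}w)$$ exists in $L^1([0,1];\mathcal S'(\mathbb R))$ (that is, after pairing with any Schwartz function of $x$, the convergence holds in $L^1([0,1])$), belongs to $l^2Y^s$, and $$\|uvw\|_{l^2Y^s}\le C\|u\|_{l^2X^\alpha}\|v\|_{l^2X^\beta}\|w\|_{l^2X^\gamma}.$$ b) If $\gamma\ge s-2$ and $\beta+\gamma>s-\tfrac12$, then there is a constant $C$ (with the same dependence, in particular independent of $j,k$) such that for all $0\le j\le k$, all $u\in l^2X^\alpha$ and all time-dependent tempered distributions $v,w$ with $S_jv\in l^2X^\beta$ and $S_kw\in l^2X^\gamma$, the pointwise product $S_{<j-4}u\,S_jv\,S_kw$ belongs to $l^2Y^s$ and $$\|S_{<j-4}u\,S_jv\,S_kw\|_{l^2Y^s}\le C\|u\|_{l^2X^\alpha}\|S_jv\|_{l^2X^\beta}\|S_kw\|_{l^2X^\gamma}.$$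 -/

import Mathlib

open MeasureTheory Set Filter Topology
open scoped ENNReal NNReal SchwartzMap FourierTransform ContDiff

namespace TrilinearEstimate

/-- The interval `[a + m 2^l, a + (m+1) 2^l)`. -/
def interval (a : ℝ) (l : ℕ) (m : ℤ) : Set ℝ :=
  Ico (a + (m : ℝ) * 2 ^ l) (a + ((m : ℝ) + 1) * 2 ^ l)

/-- The auxiliary choices behind the function spaces: the smooth cutoff `φ₀`, for every `l ≥ 0` a
partition `𝒬_l` of `ℝ` into the intervals `[off l + m 2^l, off l + (m+1) 2^l)`, `m ∈ ℤ`, and for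
every `j ≥ 0` a smooth square partition of unity `χ j m` subordinate to `𝒬_{2j}`. -/
structure Choices where
  /-- the cutoff `φ₀` -/
  φ₀ : ℝ → ℝ
  φ₀_smooth : ContDiff ℝ ∞ φ₀
  φ₀_mem : ∀ ξ, φ₀ ξ ∈ Icc (0 : ℝ) 1
  φ₀_one : ∀ ξ, |ξ| ≤ 1 → φ₀ ξ = 1
  φ₀_zero : ∀ ξ, 2 ≤ |ξ| → φ₀ ξ = 0
  /-- an end point of an interval of `𝒬_l` -/
  off : ℕ → ℝ
  /-- `χ j m` is the function `χ_Q` for the `m`-th interval `Q` of `𝒬_{2j}` -/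
  χ : ℕ → ℤ → ℝ → ℝ
  χ_smooth : ∀ j m, ContDiff ℝ ∞ (χ j m)
  χ_sq_sum : ∀ j x, HasSum (fun m => χ j m x ^ 2) 1
  χ_supp : ∀ j m, tsupport (χ j m) ⊆
    Metric.thickening (1 / 2) (interval (off (2 * j)) (2 * j) m)
  χ_lower : ∃ c : ℝ, 0 < c ∧ ∀ j m, ∀ x ∈ interval (off (2 * j)) (2 * j) m, c ≤ χ j m x

namespace Choices

variable (D : Choices)

/-- The `m`-th interval of `𝒬_l`. -/
def Q (l : ℕ) (m : ℤ) : Set ℝ := interval (D.off l) l m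

/-- The Littlewood-Paley symbols `φ_j`. -/
noncomputable def φ : ℕ → ℝ → ℝ
  | 0 => D.φ₀
  | j + 1 => fun ξ => D.φ₀ (ξ / 2 ^ (j + 1)) - D.φ₀ (ξ / 2 ^ j)

theorem φ_smooth (j : ℕ) : ContDiff ℝ ∞ (D.φ j) := by
  cases j with
  | zero => exact D.φ₀_smooth
  | succ j =>
    have h := D.φ₀_smooth
    exact (h.comp (contDiff_id.div_const _)).sub (h.comp (contDiff_id.div_const _))

theorem φ_zero_of_le (j : ℕ) (ξ : ℝ) (h : 2 ^ (j + 1) ≤ |ξ|) : D.φ j ξ = 0 := by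
  cases j with
  | zero => exact D.φ₀_zero ξ (by simpa using h)
  | succ j =>
    have h2 : (0 : ℝ) < 2 ^ j := by positivity
    have e1 : D.φ₀ (ξ / 2 ^ (j + 1)) = 0 := by
      apply D.φ₀_zero
      rw [abs_div, abs_of_pos (by positivity : (0 : ℝ) < 2 ^ (j + 1)), le_div_iff₀ (by positivity)]
      rw [pow_succ] at h; linarith
    have e2 : D.φ₀ (ξ / 2 ^ j) = 0 := by
      apply D.φ₀_zero
      rw [abs_div, abs_of_pos h2, le_div_iff₀ h2]
      rw [pow_succ, pow_succ] at h; linarith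
    simp [φ, e1, e2]

/-- The symbol `φ_j(ξ) e^{2πixξ}`. -/
noncomputable def modSymbol (j : ℕ) (x ξ : ℝ) : ℂ :=
  (D.φ j ξ : ℂ) * Complex.exp (2 * Real.pi * Complex.I * x * ξ)

theorem modSymbol_smooth (j : ℕ) (x : ℝ) : ContDiff ℝ ∞ (D.modSymbol j x) := by
  unfold modSymbol
  have h1 : ContDiff ℝ ∞ (fun ξ : ℝ => (D.φ j ξ : ℂ)) :=
    Complex.ofRealCLM.contDiff.comp (D.φ_smooth j)
  have h2 : ContDiff ℝ ∞ (fun ξ : ℝ => (ξ : ℂ)) := Complex.ofRealCLM.contDiff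
  exact h1.mul ((contDiff_const.mul h2).cexp)

theorem modSymbol_compact (j : ℕ) (x : ℝ) : HasCompactSupport (D.modSymbol j x) := by
  refine HasCompactSupport.intro (K := Icc (-(2 ^ (j + 1))) (2 ^ (j + 1))) isCompact_Icc ?_
  intro ξ hξ
  have : 2 ^ (j + 1) ≤ |ξ| := by
    by_contra hlt
    exact hξ (abs_le.mp (not_le.mp hlt).le)
  simp [modSymbol, D.φ_zero_of_le j ξ this]

/-- `S_j T = 𝓕⁻¹(φ_j 𝓕 T)` as a tempered distribution. -/
noncomputable def S (j : ℕ) (T : 𝓢'(ℝ, ℂ)) : 𝓢'(ℝ, ℂ) :=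
  TemperedDistribution.fourierMultiplierCLM ℂ (fun ξ => (D.φ j ξ : ℂ)) T

/-- `S_j T` as a function. Since `φ_j` has compact support, the distribution `𝓕⁻¹(φ_j 𝓕 T)` is the
smooth function `x ↦ ⟨𝓕 T, φ_j e^{2πix·}⟩` (Paley-Wiener-Schwartz). -/
noncomputable def SFun (j : ℕ) (T : 𝓢'(ℝ, ℂ)) (x : ℝ) : ℂ :=
  (𝓕 T) ((D.modSymbol_compact j x).toSchwartzMap (D.modSymbol_smooth j x))

/-- `S_{<n} T = ∑_{k<n} S_k T` as a function. It is `0` for `n = 0`, so that `S_{<j-4} T` is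
`SLowFun (j - 4) T` also for `j ≤ 4`, where the subtraction in `ℕ` gives `0`. -/
noncomputable def SLowFun (n : ℕ) (T : 𝓢'(ℝ, ℂ)) (x : ℝ) : ℂ :=
  ∑ k ∈ Finset.range n, D.SFun k T x

/-! Functions `g` of time and space are written `g t x`; only the times `t ∈ [0,1]` matter. -/

/-- `‖g‖_{L^∞_t L^2_x}` on `[0,1] × ℝ`. -/
noncomputable def normLinfL2 (g : ℝ → ℝ → ℂ) : ℝ≥0∞ :=
  essSup (fun t => eLpNorm (g t) 2 volume) (volume.restrict (Icc (0 : ℝ) 1))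

/-- `‖g‖_{L^1_t L^2_x}` on `[0,1] × ℝ`. -/
noncomputable def normL1L2 (g : ℝ → ℝ → ℂ) : ℝ≥0∞ :=
  ∫⁻ t in Icc (0 : ℝ) 1, eLpNorm (g t) 2 volume

/-- The local energy norm
`‖g‖_X = sup_l sup_{Q ∈ 𝒬_l} 2^{-l/2} ‖g‖_{L^2([0,1] × Q)}`. -/
noncomputable def normX (g : ℝ → ℝ → ℂ) : ℝ≥0∞ :=
  ⨆ (l : ℕ) (m : ℤ), (2 : ℝ≥0∞) ^ (-(l : ℝ) / 2) *
    eLpNorm (Function.uncurry g) 2 ((volume : Measure (ℝ × ℝ)).restrict (Icc 0 1 ×ˢ D.Q l m))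

/-- `‖g‖_{X_j} = 2^j ‖g‖_X + ‖g‖_{L^∞_t L^2_x}`. -/
noncomputable def normXj (j : ℕ) (g : ℝ → ℝ → ℂ) : ℝ≥0∞ :=
  2 ^ j * D.normX g + normLinfL2 g

/-- Atoms of `Y`: for some `Q ∈ 𝒬_l`, supported in `[0,1] × Q` with `L^2` norm at most
`2^{-l/2}`. -/
def IsAtom (a : ℝ → ℝ → ℂ) : Prop :=
  AEStronglyMeasurable (Function.uncurry a) (volume : Measure (ℝ × ℝ)) ∧
  ∃ (l : ℕ) (m : ℤ), (∀ t x, (t, x) ∉ Icc (0 : ℝ) 1 ×ˢ D.Q l m → a t x = 0) ∧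
    eLpNorm (Function.uncurry a) 2 (volume : Measure (ℝ × ℝ)) ≤ (2 : ℝ≥0∞) ^ (-(l : ℝ) / 2)

/-- `‖f‖_Y = inf {∑ |c_k| : f = ∑ c_k a_k, a_k atoms}`, which is `∞` if there is no such
representation. Atoms have `L^2` norm at most `1`, so for `∑ |c_k| < ⊤` the series converges
absolutely in `L^2` and almost everywhere, to the same sum. -/
noncomputable def normY (f : ℝ → ℝ → ℂ) : ℝ≥0∞ :=
  ⨅ (c : ℕ → ℂ) (a : ℕ → ℝ → ℝ → ℂ) (_ : ∀ k, D.IsAtom (a k))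
    (_ : ∀ᵐ z ∂((volume : Measure (ℝ × ℝ)).restrict (Icc 0 1 ×ˢ univ)),
      HasSum (fun k => c k * a k z.1 z.2) (f z.1 z.2)),
    ∑' k, ‖c k‖ₑ

/-- `‖f‖_{Y_j} = inf {2^{-j} ‖f₁‖_Y + ‖f₂‖_{L^1_t L^2_x} : f = f₁ + f₂}`. -/
noncomputable def normYj (j : ℕ) (f : ℝ → ℝ → ℂ) : ℝ≥0∞ :=
  ⨅ (f₁ : ℝ → ℝ → ℂ) (f₂ : ℝ → ℝ → ℂ)
    (_ : AEStronglyMeasurable (Function.uncurry f₂)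
      ((volume : Measure (ℝ × ℝ)).restrict (Icc 0 1 ×ˢ univ)))
    (_ : ∀ᵐ z ∂((volume : Measure (ℝ × ℝ)).restrict (Icc 0 1 ×ˢ univ)),
      f z.1 z.2 = f₁ z.1 z.2 + f₂ z.1 z.2),
    ((2 : ℝ≥0∞) ^ j)⁻¹ * D.normY f₁ + normL1L2 f₂

/-- `‖g‖_{l²_{2j} U} = (∑_{Q ∈ 𝒬_{2j}} ‖g χ_Q‖_U^2)^{1/2}` for a norm `N` of `U`. -/
noncomputable def l2Loc (j : ℕ) (N : (ℝ → ℝ → ℂ) → ℝ≥0∞) (g : ℝ → ℝ → ℂ) : ℝ≥0∞ :=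
  (∑' m : ℤ, N (fun t x => g t x * (D.χ j m x : ℂ)) ^ 2) ^ (1 / 2 : ℝ)

/-- `‖u‖_{l²X^s}` for a time-dependent tempered distribution `u`. -/
noncomputable def normL2X (s : ℝ) (u : ℝ → 𝓢'(ℝ, ℂ)) : ℝ≥0∞ :=
  (∑' j : ℕ, (2 : ℝ≥0∞) ^ (2 * j * s) *
    D.l2Loc j (D.normXj j) (fun t => D.SFun j (u t)) ^ 2) ^ (1 / 2 : ℝ)

/-- `‖f‖_{l²Y^s}` for a time-dependent tempered distribution `f`. -/
noncomputable def normL2Y (s : ℝ) (f : ℝ → 𝓢'(ℝ, ℂ)) : ℝ≥0∞ :=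
  (∑' j : ℕ, (2 : ℝ≥0∞) ^ (2 * j * s) *
    D.l2Loc j (D.normYj j) (fun t => D.SFun j (f t)) ^ 2) ^ (1 / 2 : ℝ)

/-- The space `l²X^s`. It is enough to ask for continuity of `t ↦ u(t)` on `[0,1]` in the sense of
tempered distributions: it holds for all `u ∈ C([0,1], H^s)`, and together with the finiteness of
the norm it implies `u ∈ C([0,1], H^s)`. -/
def MemL2X (s : ℝ) (u : ℝ → 𝓢'(ℝ, ℂ)) : Prop :=
  (∀ ψ : 𝓢(ℝ, ℂ), ContinuousOn (fun t => u t ψ) (Icc 0 1)) ∧ D.normL2X s u < ⊤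

/-- The space `l²Y^s`. -/
def MemL2Y (s : ℝ) (f : ℝ → 𝓢'(ℝ, ℂ)) : Prop :=
  (∀ ψ : 𝓢(ℝ, ℂ), AEMeasurable (fun t => f t ψ) (volume.restrict (Icc (0 : ℝ) 1))) ∧
    D.normL2Y s f < ⊤

/-- `f` is the product `u v w`: the limit in `L^1([0,1]; 𝓢'(ℝ))` of the pointwise products of the
smooth functions `S_{<N} u`, `S_{<N} v`, `S_{<N} w` as `N → ∞`. -/
def IsProduct (u v w f : ℝ → 𝓢'(ℝ, ℂ)) : Prop :=
  ∀ ψ : 𝓢(ℝ, ℂ), Tendsto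
    (fun N : ℕ => ∫⁻ t in Icc (0 : ℝ) 1,
      ‖(∫ x, D.SLowFun N (u t) x * D.SLowFun N (v t) x * D.SLowFun N (w t) x * ψ x) - f t ψ‖ₑ)
    atTop (𝓝 0)

end Choices

/-- The tempered distribution `T` is given by integration against the function `F`. -/
def IsGivenBy (T : 𝓢'(ℝ, ℂ)) (F : ℝ → ℂ) : Prop :=
  ∀ ψ : 𝓢(ℝ, ℂ), Integrable (fun x => F x * ψ x) ∧ T ψ = ∫ x, F x * ψ x

end TrilinearEstimate

/-! The proof decomposes u, v, w into Littlewood-Paley pieces u_i, v_j, w_k and measures their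
products on unit intervals Q. Of all the intervals in the definitions of X and Y, only the unit ones
are used. Write A_i for the dyadic norm of u_i. Two facts enter: the L² norm of u_i on [0,1] × Q is
at most 2^{-i} A_i (`cell2_le_dyadicX`), and the bounds for |u_i| on the Q are square summable in Q
with norm O(2^{3i/2}) A_i (`exists_cellBound`). In the latter, Bernstein costs 2^{i/2}, and passing
from intervals of length 4^i to unit intervals costs 2^i.

Let i ≤ j ≤ k and apply S_l to the product. If k is at least 6 above both i and j, then l is within
3 of k. The output is estimated in Y, with both low factors in the supremum norm and w_k in local
L², which gives 2^{-l+3i/2+3j/2-k}. Otherwise j and k are comparable and l ≤ k + O(1). The output is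
then estimated in L¹L², with u_i in the supremum norm and v_j, w_k in local L². Bernstein from L¹ to
L² costs 2^{l/2} and the change to intervals of length 4^l costs 2^l, so the factor is
2^{3l/2+3i/2-j-k}.

With the weights 2^{sl-αi-βj-γk} the exponent in the first case is, up to bounded terms, (s-2-γ)k +
(3/2-β)j + (3/2-α)i. Moving the coefficient of k to j and then to i uses γ ≥ s-2, β+γ > s-1/2 and
α+β+γ > s+1 in turn. In the second case s ≥ -3/2 allows l to be replaced by k, and the last two
conditions finish. The strict inequalities leave geometric decay in i, j and |l-k|, so
Cauchy-Schwarz in i, j and Schur's test in k sum everything (`l2Sum_gainKernel_le`). Part a) needs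
all six orders of the indices (`exists_sym_bound`). In part b) the order is fixed up to a bounded
error, hence the fewer conditions.

The limit exists because the pairings of the pieces with a Schwartz function ψ are summable in L¹ of
time. If one index dominates, the product sees only the high frequencies of ψ and any power of the
frequency is gained. Otherwise the L¹L² analysis and the spatial decay of ψ suffice
(`exists_pairing_bound`, `exists_lintegral_pairBound_le`). Since the limit is a sum of
distributions, S_l of it is dominated pointwise by the sum of convolutions over the interacting
triples (`IsSumOver.enorm_SFun_le`).

All this rests on the reproducing formula for S_i T (`SFun_eq_integral`), which for a general
tempered distribution follows from `commutesWithWaves`. -/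

namespace TrilinearEstimate

/-! ### `L²` norms of functions with values in `[0, ∞]` -/

/-- The Cauchy-Schwarz inequality for functions with values in `[0, ∞]`. -/
theorem lintegral_mul_sq_le {X : Type*} [MeasurableSpace X] (μ : Measure X) {f g : X → ℝ≥0∞}
    (hf : AEMeasurable f μ) (hg : AEMeasurable g μ) :
    (∫⁻ x, f x * g x ∂μ) ^ 2 ≤ (∫⁻ x, f x ^ 2 ∂μ) * ∫⁻ x, g x ^ 2 ∂μ := by
  have h := ENNReal.lintegral_mul_le_Lp_mul_Lq μ Real.HolderConjugate.two_two hf hg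
  simp only [Pi.mul_apply, ENNReal.rpow_two] at h
  calc (∫⁻ x, f x * g x ∂μ) ^ 2
      ≤ ((∫⁻ x, f x ^ 2 ∂μ) ^ (1 / 2 : ℝ) * (∫⁻ x, g x ^ 2 ∂μ) ^ (1 / 2 : ℝ)) ^ 2 := by gcongr
    _ = _ := by
      rw [mul_pow, ← ENNReal.rpow_two, ← ENNReal.rpow_two, ← ENNReal.rpow_mul, ← ENNReal.rpow_mul]
      norm_num

/-- The Cauchy-Schwarz inequality with a weight. -/
theorem lintegral_mul_sq_le_weight {X : Type*} [MeasurableSpace X] (μ : Measure X)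
    {w f : X → ℝ≥0∞} (hw : AEMeasurable w μ) (hf : AEMeasurable f μ) :
    (∫⁻ x, w x * f x ∂μ) ^ 2 ≤ (∫⁻ x, w x ∂μ) * ∫⁻ x, w x * f x ^ 2 ∂μ := by
  have e : ∀ a : ℝ≥0∞, (a ^ (1 / 2 : ℝ)) ^ 2 = a := fun a => by
    rw [← ENNReal.rpow_two, ← ENNReal.rpow_mul]; norm_num
  have h := lintegral_mul_sq_le μ (hw.pow_const (1 / 2 : ℝ))
    ((hw.pow_const (1 / 2 : ℝ)).mul hf)
  simp only [mul_pow, e, Pi.mul_apply] at h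
  refine le_trans (le_of_eq ?_) h
  congr 1
  refine lintegral_congr fun x => ?_
  rw [← mul_assoc, ← sq, e]

theorem tsum_mul_sq_le_weight {ι : Type*} [Countable ι] (w f : ι → ℝ≥0∞) :
    (∑' i, w i * f i) ^ 2 ≤ (∑' i, w i) * ∑' i, w i * f i ^ 2 := by
  let _ : MeasurableSpace ι := ⊤
  simpa [lintegral_count] using lintegral_mul_sq_le_weight (Measure.count : Measure ι)
    (w := w) (f := f) (measurable_of_countable _).aemeasurable
    (measurable_of_countable _).aemeasurable

theorem tsum_mul_sq_le {ι : Type*} [Countable ι] (f g : ι → ℝ≥0∞) :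
    (∑' i, f i * g i) ^ 2 ≤ (∑' i, f i ^ 2) * ∑' i, g i ^ 2 := by
  let _ : MeasurableSpace ι := ⊤
  simpa [lintegral_count] using lintegral_mul_sq_le (Measure.count : Measure ι)
    (f := f) (g := g) (measurable_of_countable _).aemeasurable
    (measurable_of_countable _).aemeasurable

/-- The `L²` norm of a function with values in `[0, ∞]`. -/
noncomputable def l2Norm {X : Type*} [MeasurableSpace X] (μ : Measure X) (f : X → ℝ≥0∞) : ℝ≥0∞ :=
  (∫⁻ x, f x ^ 2 ∂μ) ^ (1 / 2 : ℝ)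

/-- The `ℓ²` norm of a family in `[0, ∞]`. -/
noncomputable def l2Sum {ι : Type*} (a : ι → ℝ≥0∞) : ℝ≥0∞ := (∑' i, a i ^ 2) ^ (1 / 2 : ℝ)

theorem rpow_half_sq (a : ℝ≥0∞) : (a ^ (1 / 2 : ℝ)) ^ 2 = a := by
  rw [← ENNReal.rpow_two, ← ENNReal.rpow_mul]; norm_num

theorem sq_rpow_half (a : ℝ≥0∞) : (a ^ 2) ^ (1 / 2 : ℝ) = a := by
  rw [← ENNReal.rpow_two, ← ENNReal.rpow_mul]; norm_num

theorem le_of_sq_le_sq {a b : ℝ≥0∞} (h : a ^ 2 ≤ b ^ 2) : a ≤ b := by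
  have := ENNReal.rpow_le_rpow h (z := (1 / 2 : ℝ)) (by norm_num)
  rwa [sq_rpow_half, sq_rpow_half] at this

theorem l2Norm_sq {X : Type*} [MeasurableSpace X] (μ : Measure X) (f : X → ℝ≥0∞) :
    l2Norm μ f ^ 2 = ∫⁻ x, f x ^ 2 ∂μ := rpow_half_sq _

theorem l2Sum_sq {ι : Type*} (a : ι → ℝ≥0∞) : l2Sum a ^ 2 = ∑' i, a i ^ 2 := rpow_half_sq _

theorem l2Norm_mono {X : Type*} [MeasurableSpace X] {μ : Measure X} {f g : X → ℝ≥0∞}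
    (h : ∀ᵐ x ∂μ, f x ≤ g x) : l2Norm μ f ≤ l2Norm μ g := by
  apply le_of_sq_le_sq
  rw [l2Norm_sq, l2Norm_sq]
  refine lintegral_mono_ae ?_
  filter_upwards [h] with x hx
  gcongr

theorem l2Norm_mono_measure {X : Type*} [MeasurableSpace X] {μ ν : Measure X} (f : X → ℝ≥0∞)
    (h : μ ≤ ν) : l2Norm μ f ≤ l2Norm ν f := by
  apply le_of_sq_le_sq
  rw [l2Norm_sq, l2Norm_sq]
  exact lintegral_mono' h le_rfl

theorem l2Sum_mono {ι : Type*} {a b : ι → ℝ≥0∞} (h : ∀ i, a i ≤ b i) : l2Sum a ≤ l2Sum b := by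
  apply le_of_sq_le_sq
  rw [l2Sum_sq, l2Sum_sq]
  exact ENNReal.tsum_le_tsum fun i => by gcongr; exact h i

theorem l2Norm_const_mul {X : Type*} [MeasurableSpace X] (μ : Measure X) (c : ℝ≥0∞)
    {f : X → ℝ≥0∞} (hf : AEMeasurable f μ) : l2Norm μ (fun x => c * f x) = c * l2Norm μ f := by
  unfold l2Norm
  simp only [mul_pow]
  rw [lintegral_const_mul'' _ (hf.pow_const 2), ENNReal.mul_rpow_of_nonneg _ _ (by norm_num),
    sq_rpow_half]

theorem l2Sum_const_mul {ι : Type*} (c : ℝ≥0∞) (a : ι → ℝ≥0∞) :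
    l2Sum (fun i => c * a i) = c * l2Sum a := by
  unfold l2Sum
  simp only [mul_pow]
  rw [ENNReal.tsum_mul_left, ENNReal.mul_rpow_of_nonneg _ _ (by norm_num), sq_rpow_half]

theorem le_l2Sum {ι : Type*} (a : ι → ℝ≥0∞) (i : ι) : a i ≤ l2Sum a := by
  apply le_of_sq_le_sq
  rw [l2Sum_sq]
  exact ENNReal.le_tsum (f := fun i => a i ^ 2) i

theorem lintegral_mul_le_l2Norm {X : Type*} [MeasurableSpace X] (μ : Measure X)
    {f g : X → ℝ≥0∞} (hf : AEMeasurable f μ) (hg : AEMeasurable g μ) :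
    ∫⁻ x, f x * g x ∂μ ≤ l2Norm μ f * l2Norm μ g := by
  apply le_of_sq_le_sq
  rw [mul_pow, l2Norm_sq, l2Norm_sq]
  exact lintegral_mul_sq_le μ hf hg

theorem tsum_mul_le_l2Sum {ι : Type*} [Countable ι] (f g : ι → ℝ≥0∞) :
    ∑' i, f i * g i ≤ l2Sum f * l2Sum g := by
  apply le_of_sq_le_sq
  rw [mul_pow, l2Sum_sq, l2Sum_sq]
  exact tsum_mul_sq_le f g

/-- Minkowski's inequality for countable sums. -/
theorem l2Norm_tsum_le {X ι : Type*} [MeasurableSpace X] [Countable ι] (μ : Measure X)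
    {f : ι → X → ℝ≥0∞} (hf : ∀ i, AEMeasurable (f i) μ) :
    l2Norm μ (fun x => ∑' i, f i x) ≤ ∑' i, l2Norm μ (f i) := by
  apply le_of_sq_le_sq
  rw [l2Norm_sq]
  calc ∫⁻ x, (∑' i, f i x) ^ 2 ∂μ = ∫⁻ x, ∑' i, ∑' j, f i x * f j x ∂μ := by
        refine lintegral_congr fun x => ?_
        rw [sq, ← ENNReal.tsum_mul_right]
        simp_rw [← ENNReal.tsum_mul_left]
    _ = ∑' i, ∑' j, ∫⁻ x, f i x * f j x ∂μ := by
        have hm : ∀ i j, AEMeasurable (fun x => f i x * f j x) μ := fun i j => (hf i).mul (hf j)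
        rw [lintegral_tsum fun i => AEMeasurable.tsum fun j => hm i j]
        exact tsum_congr fun i => lintegral_tsum fun j => hm i j
    _ ≤ ∑' i, ∑' j, l2Norm μ (f i) * l2Norm μ (f j) :=
        ENNReal.tsum_le_tsum fun i => ENNReal.tsum_le_tsum fun j =>
          lintegral_mul_le_l2Norm μ (hf i) (hf j)
    _ = _ := by
        rw [sq, ← ENNReal.tsum_mul_right]
        simp_rw [← ENNReal.tsum_mul_left]

theorem l2Sum_eq_l2Norm {ι : Type*} [MeasurableSpace ι] [MeasurableSingletonClass ι]
    (a : ι → ℝ≥0∞) : l2Sum a = l2Norm Measure.count a := by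
  simp [l2Sum, l2Norm, lintegral_count]

theorem l2Sum_tsum_le {ι κ : Type*} [Countable ι] [Countable κ] (f : κ → ι → ℝ≥0∞) :
    l2Sum (fun i => ∑' j, f j i) ≤ ∑' j, l2Sum (f j) := by
  let _ : MeasurableSpace ι := ⊤
  simp only [l2Sum_eq_l2Norm]
  exact l2Norm_tsum_le _ fun j => (measurable_of_countable _).aemeasurable

theorem l2Sum_add_le {ι : Type*} [Countable ι] (f g : ι → ℝ≥0∞) :
    l2Sum (fun i => f i + g i) ≤ l2Sum f + l2Sum g := by
  have h := l2Sum_tsum_le (fun (b : Bool) i => if b then f i else g i)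
  simp only [tsum_bool] at h
  simpa [add_comm] using h

theorem l2Sum_le_tsum {ι : Type*} (a : ι → ℝ≥0∞) : l2Sum a ≤ ∑' i, a i := by
  apply le_of_sq_le_sq
  rw [l2Sum_sq, sq (∑' i, a i), ← ENNReal.tsum_mul_right]
  refine ENNReal.tsum_le_tsum fun i => ?_
  rw [sq]
  gcongr
  exact ENNReal.le_tsum i

/-- Schur's test. -/
theorem schur_test {ι κ : Type*} [Countable ι] [Countable κ] (K : ι → κ → ℝ≥0∞) (a : κ → ℝ≥0∞)
    {A B : ℝ≥0∞} (hA : ∀ i, ∑' j, K i j ≤ A) (hB : ∀ j, ∑' i, K i j ≤ B) :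
    l2Sum (fun i => ∑' j, K i j * a j) ^ 2 ≤ A * B * l2Sum a ^ 2 := by
  rw [l2Sum_sq, l2Sum_sq]
  calc ∑' i, (∑' j, K i j * a j) ^ 2 ≤ ∑' i, A * ∑' j, K i j * a j ^ 2 :=
        ENNReal.tsum_le_tsum fun i => (tsum_mul_sq_le_weight _ _).trans (by gcongr; exact hA i)
    _ = A * ∑' j, (∑' i, K i j) * a j ^ 2 := by
        rw [ENNReal.tsum_mul_left, ENNReal.tsum_comm]
        simp_rw [ENNReal.tsum_mul_right]
    _ ≤ A * ∑' j, B * a j ^ 2 := by gcongr with j; exact hB j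
    _ = _ := by rw [ENNReal.tsum_mul_left, mul_assoc]

/-- An open interval of length `L` contains at most `L + 1` integers. -/
theorem tsum_indicator_int_le (A L : ℝ) (hL : 0 ≤ L) :
    (∑' n : ℤ, if A < n ∧ (n : ℝ) < A + L then (1 : ℝ≥0∞) else 0) ≤ ENNReal.ofReal (L + 1) := by
  have hsub : ∀ n : ℤ, n ∉ Finset.Ico (⌊A⌋ + 1) ⌈A + L⌉ →
      (if A < n ∧ (n : ℝ) < A + L then (1 : ℝ≥0∞) else 0) = 0 := by
    intro n hn
    rw [if_neg]
    rintro ⟨h1, h2⟩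
    exact hn (Finset.mem_Ico.2 ⟨Int.floor_lt.2 h1, Int.lt_ceil.2 h2⟩)
  rw [tsum_eq_sum hsub]
  calc _ ≤ ∑ n ∈ Finset.Ico (⌊A⌋ + 1) ⌈A + L⌉, (1 : ℝ≥0∞) := by
        gcongr; split_ifs <;> simp
    _ = ENNReal.ofReal ((⌈A + L⌉ - (⌊A⌋ + 1)).toNat : ℝ) := by
        simp
    _ ≤ _ := by
        apply ENNReal.ofReal_le_ofReal
        have h1 := Int.ceil_lt_add_one (A + L)
        have h2 := Int.lt_floor_add_one A
        have : ((⌈A + L⌉ - (⌊A⌋ + 1)).toNat : ℝ) = ((max (⌈A + L⌉ - (⌊A⌋ + 1)) 0 : ℤ) : ℝ) := by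
          rw [← Int.toNat_eq_max]; rfl
        rw [this]
        push_cast
        apply max_le <;> linarith

/-! ### Pairing a tempered distribution with a family of modulated Schwartz functions -/

/-- The function `ξ ↦ e^{2πixξ}`. -/
noncomputable def wave (x ξ : ℝ) : ℂ := Complex.exp (2 * Real.pi * Complex.I * x * ξ)

theorem norm_wave (x ξ : ℝ) : ‖wave x ξ‖ = 1 := by
  unfold wave
  rw [show (2 * Real.pi * Complex.I * x * ξ : ℂ) = ((2 * Real.pi * x * ξ : ℝ) : ℂ) * Complex.I by
    push_cast; ring]
  exact Complex.norm_exp_ofReal_mul_I _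

theorem wave_symm (x ξ : ℝ) : wave x ξ = wave ξ x := by
  unfold wave; congr 1; ring

theorem wave_add (x y ξ : ℝ) : wave (x + y) ξ = wave x ξ * wave y ξ := by
  unfold wave; rw [← Complex.exp_add]; congr 1; push_cast; ring

theorem wave_continuous_right (x : ℝ) : Continuous (wave x) := by
  unfold wave; fun_prop

theorem hasDerivAt_wave (x ξ : ℝ) :
    HasDerivAt (wave x) (2 * Real.pi * Complex.I * x * wave x ξ) ξ := by
  have h : HasDerivAt (fun ξ : ℝ => (2 * Real.pi * Complex.I * x * ξ : ℂ))
      (2 * Real.pi * Complex.I * x) ξ := by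
    simpa using (Complex.ofRealCLM.hasDerivAt (x := ξ)).const_mul (2 * Real.pi * Complex.I * x)
  have := h.cexp
  unfold wave
  rw [mul_comm (Complex.exp _)] at this
  exact this

theorem norm_wave_sub_le (x y ξ : ℝ) : ‖wave x ξ - wave y ξ‖ ≤ 2 * Real.pi * |ξ| * |x - y| := by
  have hd : ∀ z ∈ (univ : Set ℝ), HasDerivWithinAt (fun z => wave z ξ)
      (2 * Real.pi * Complex.I * ξ * wave ξ z) univ z := fun z _ => by
    have := (hasDerivAt_wave ξ z).hasDerivWithinAt (s := univ)
    exact this.congr (fun a _ => wave_symm a ξ) (wave_symm z ξ)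
  have hb : ∀ z ∈ (univ : Set ℝ), ‖2 * Real.pi * Complex.I * ξ * wave ξ z‖ ≤ 2 * Real.pi * |ξ| := by
    intro z _
    rw [norm_mul, norm_wave]
    simp [abs_of_pos Real.pi_pos]
  have := convex_univ.norm_image_sub_le_of_norm_hasDerivWithin_le hd hb (mem_univ y) (mem_univ x)
  simpa [Real.norm_eq_abs] using this

theorem wave_hasTemperateGrowth (x : ℝ) : (wave x).HasTemperateGrowth := by
  set c : ℂ := 2 * Real.pi * Complex.I * x
  have hd : ∀ n : ℕ, iteratedDeriv n (wave x) = fun ξ => c ^ n * wave x ξ := by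
    intro n
    induction n with
    | zero => ext ξ; simp
    | succ n ih =>
      rw [iteratedDeriv_succ, ih]
      ext ξ
      rw [deriv_const_mul _ (hasDerivAt_wave x ξ).differentiableAt, (hasDerivAt_wave x ξ).deriv]
      rw [pow_succ]; ring
  refine ⟨?_, fun n => ⟨0, ‖c‖ ^ n, fun ξ => ?_⟩⟩
  · unfold wave
    have h2 : ContDiff ℝ ∞ (fun ξ : ℝ => (ξ : ℂ)) := Complex.ofRealCLM.contDiff
    exact (contDiff_const.mul h2).cexp
  · rw [norm_iteratedFDeriv_eq_norm_iteratedDeriv, hd]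
    simp [norm_wave]

/-- The Schwartz function `φ(ξ) e^{2πixξ}`. -/
noncomputable def modulate (x : ℝ) (φ : 𝓢(ℝ, ℂ)) : 𝓢(ℝ, ℂ) := SchwartzMap.smulLeftCLM ℂ (wave x) φ

theorem modulate_apply (x : ℝ) (φ : 𝓢(ℝ, ℂ)) (ξ : ℝ) : modulate x φ ξ = wave x ξ * φ ξ := by
  simp [modulate, SchwartzMap.smulLeftCLM_apply_apply (wave_hasTemperateGrowth x)]

/-- The product of two Schwartz functions. -/
noncomputable def mulS (φ ψ : 𝓢(ℝ, ℂ)) : 𝓢(ℝ, ℂ) := SchwartzMap.smulLeftCLM ℂ φ ψ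

theorem mulS_apply (φ ψ : 𝓢(ℝ, ℂ)) (ξ : ℝ) : mulS φ ψ ξ = φ ξ * ψ ξ := by
  simp [mulS, SchwartzMap.smulLeftCLM_apply_apply φ.hasTemperateGrowth]

theorem fourierInv_apply_eq_wave (ψ : 𝓢(ℝ, ℂ)) (ξ : ℝ) : 𝓕⁻ ψ ξ = ∫ y, wave ξ y * ψ y := by
  rw [SchwartzMap.fourierInv_coe, Real.fourierInv_eq']
  refine integral_congr_ae (Eventually.of_forall fun y => ?_)
  simp only [wave, smul_eq_mul, RCLike.inner_apply, conj_trivial]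
  congr 2; push_cast; ring

theorem fourier_apply_eq_wave (ψ : 𝓢(ℝ, ℂ)) (ξ : ℝ) : 𝓕 ψ ξ = ∫ y, wave (-ξ) y * ψ y := by
  rw [SchwartzMap.fourier_coe, Real.fourier_eq']
  refine integral_congr_ae (Eventually.of_forall fun y => ?_)
  simp only [wave, smul_eq_mul, RCLike.inner_apply, conj_trivial]
  congr 2; push_cast; ring

/-- Multiplication by the coordinate on Schwartz functions. -/
noncomputable def coordMul : 𝓢(ℝ, ℂ) →L[ℂ] 𝓢(ℝ, ℂ) :=
  SchwartzMap.smulLeftCLM ℂ (fun x : ℝ => (x : ℂ))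

theorem coordMul_apply (ψ : 𝓢(ℝ, ℂ)) (x : ℝ) : coordMul ψ x = x * ψ x := by
  simp [coordMul, SchwartzMap.smulLeftCLM_apply_apply Function.Complex.hasTemperateGrowth_ofReal]

theorem deriv_fourierInv_schwartz (η : 𝓢(ℝ, ℂ)) :
    SchwartzMap.derivCLM ℂ ℂ (𝓕⁻ η) = 𝓕⁻ ((2 * Real.pi * Complex.I) • coordMul η) := by
  have h := SchwartzMap.lineDerivOp_fourierInv_eq η (1 : ℝ)
  have e : SchwartzMap.smulLeftCLM ℂ (inner ℝ · (1 : ℝ)) η = coordMul η := by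
    ext x
    rw [coordMul_apply, SchwartzMap.smulLeftCLM_apply_apply (by fun_prop)]
    simp
  rw [e] at h
  rw [← h]
  ext x
  simp [SchwartzMap.lineDerivOp_apply_eq_fderiv]

/-- The functional `L` commutes with the integral `∫ φ e^{2πiy·} η(y) dy = φ 𝓕⁻¹η`. -/
def CommutesWithWaves (L : 𝓢(ℝ, ℂ) →L[ℂ] ℂ) : Prop :=
  ∀ φ η : 𝓢(ℝ, ℂ), Continuous (fun y => L (modulate y φ)) ∧
    Integrable (fun y => L (modulate y φ) * η y) ∧
    ∫ y, L (modulate y φ) * η y = L (mulS φ (𝓕⁻ η))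

theorem CommutesWithWaves.comp_coordMul {L : 𝓢(ℝ, ℂ) →L[ℂ] ℂ} (h : CommutesWithWaves L) :
    CommutesWithWaves (L ∘L coordMul) := by
  intro φ η
  have e : ∀ y, coordMul (modulate y φ) = modulate y (coordMul φ) := fun y => by
    ext ξ; simp only [coordMul_apply, modulate_apply]; ring
  have e' : coordMul (mulS φ (𝓕⁻ η)) = mulS (coordMul φ) (𝓕⁻ η) := by
    ext ξ; simp only [coordMul_apply, mulS_apply]; ring
  simpa [e, e'] using h (coordMul φ) η

theorem CommutesWithWaves.comp_deriv {L : 𝓢(ℝ, ℂ) →L[ℂ] ℂ} (h : CommutesWithWaves L) :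
    CommutesWithWaves (L ∘L SchwartzMap.derivCLM ℂ ℂ) := by
  intro φ η
  set c : ℂ := 2 * Real.pi * Complex.I
  have e : ∀ y, SchwartzMap.derivCLM ℂ ℂ (modulate y φ) =
      (c * y) • modulate y φ + modulate y (SchwartzMap.derivCLM ℂ ℂ φ) := fun y => by
    ext ξ
    have h1 : (modulate y φ : ℝ → ℂ) = fun ξ => wave y ξ * φ ξ := funext (modulate_apply y φ)
    have h2 := (hasDerivAt_wave y ξ).mul (φ.hasDerivAt ξ)
    rw [SchwartzMap.derivCLM_apply, h1]
    refine h2.deriv.trans ?_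
    simp only [_root_.add_apply, _root_.smul_apply, modulate_apply,
      SchwartzMap.derivCLM_apply, smul_eq_mul, c]
    ring
  have e' : SchwartzMap.derivCLM ℂ ℂ (mulS φ (𝓕⁻ η)) =
      mulS φ (𝓕⁻ (c • coordMul η)) + mulS (SchwartzMap.derivCLM ℂ ℂ φ) (𝓕⁻ η) := by
    ext ξ
    have h1 : (mulS φ (𝓕⁻ η) : ℝ → ℂ) = fun ξ => φ ξ * (𝓕⁻ η) ξ := funext (mulS_apply φ _)
    have h2 := (φ.hasDerivAt ξ).mul ((𝓕⁻ η).hasDerivAt ξ)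
    rw [SchwartzMap.derivCLM_apply, h1]
    refine h2.deriv.trans ?_
    rw [← SchwartzMap.derivCLM_apply (𝕜 := ℂ) (𝓕⁻ η), deriv_fourierInv_schwartz]
    simp only [_root_.add_apply, mulS_apply, SchwartzMap.derivCLM_apply, c]
    ring
  -- Differentiating the wave produces the factor c y. It is absorbed into η, so the hypothesis is
  -- needed for two different test functions.
  obtain ⟨c1, i1, h1⟩ := h φ (c • coordMul η)
  obtain ⟨c2, i2, h2⟩ := h (SchwartzMap.derivCLM ℂ ℂ φ) η
  have e3 : (fun y => (L ∘L SchwartzMap.derivCLM ℂ ℂ) (modulate y φ) * η y) = fun y =>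
      L (modulate y φ) * (c • coordMul η) y + L (modulate y (SchwartzMap.derivCLM ℂ ℂ φ)) * η y := by
    ext y
    simp only [ContinuousLinearMap.comp_apply, e, map_add, map_smul, _root_.smul_apply,
      coordMul_apply, smul_eq_mul]
    ring
  rw [e3]
  have e4 : (fun y => (L ∘L SchwartzMap.derivCLM ℂ ℂ) (modulate y φ)) = fun y : ℝ =>
      (c * y) * L (modulate y φ) + L (modulate y (SchwartzMap.derivCLM ℂ ℂ φ)) := by
    ext y
    simp only [ContinuousLinearMap.comp_apply, e, map_add, map_smul, smul_eq_mul]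
  rw [e4]
  refine ⟨Continuous.add (Continuous.mul (by fun_prop) c1) c2, i1.add i2, ?_⟩
  rw [integral_add i1 i2, h1, h2, ContinuousLinearMap.comp_apply, e', map_add]

theorem CommutesWithWaves.comp_coordMul_pow {L : 𝓢(ℝ, ℂ) →L[ℂ] ℂ} (h : CommutesWithWaves L)
    (n : ℕ) : CommutesWithWaves (L ∘L coordMul ^ n) := by
  induction n with
  | zero => exact h
  | succ n ih => rw [pow_succ]; exact ih.comp_coordMul

theorem CommutesWithWaves.comp_deriv_pow {L : 𝓢(ℝ, ℂ) →L[ℂ] ℂ} (h : CommutesWithWaves L)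
    (n : ℕ) : CommutesWithWaves (L ∘L (SchwartzMap.derivCLM ℂ ℂ) ^ n) := by
  induction n with
  | zero => exact h
  | succ n ih => rw [pow_succ]; exact ih.comp_deriv

theorem CommutesWithWaves.sum {ι : Type*} {s : Finset ι} {L : ι → 𝓢(ℝ, ℂ) →L[ℂ] ℂ}
    (h : ∀ i ∈ s, CommutesWithWaves (L i)) : CommutesWithWaves (∑ i ∈ s, L i) := by
  intro φ η
  simp only [_root_.sum_apply, Finset.sum_mul]
  refine ⟨continuous_finsetSum _ fun i hi => (h i hi φ η).1,
    integrable_finsetSum _ fun i hi => (h i hi φ η).2.1, ?_⟩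
  rw [integral_finsetSum _ fun i hi => (h i hi φ η).2.1]
  exact Finset.sum_congr rfl fun i hi => (h i hi φ η).2.2

/-- Two waves differ by at most 2π|ξ||x - y|, and the decay of φ absorbs |ξ|. This makes the
integrand in `commutesWithWaves_of_dual` strongly measurable. -/
theorem modulate_lipschitz (φ : 𝓢(ℝ, ℂ)) :
    Continuous (fun y => (modulate y φ).toBoundedContinuousFunction) := by
  obtain ⟨C, hC0, hC⟩ := (coordMul φ).decay 0 0
  have hC' : ∀ ξ : ℝ, |ξ| * ‖φ ξ‖ ≤ C := fun ξ => by
    have := hC ξ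
    simpa [coordMul_apply] using this
  have : LipschitzWith (Real.toNNReal (2 * Real.pi * C))
      (fun y => (modulate y φ).toBoundedContinuousFunction) := by
    refine LipschitzWith.of_dist_le_mul fun x y => ?_
    rw [BoundedContinuousFunction.dist_le (by positivity)]
    intro ξ
    simp only [SchwartzMap.toBoundedContinuousFunction_apply, modulate_apply, dist_eq_norm]
    rw [← sub_mul, norm_mul, Real.coe_toNNReal _ (by positivity), Real.norm_eq_abs]
    calc _ ≤ 2 * Real.pi * |ξ| * |x - y| * ‖φ ξ‖ := by gcongr; exact norm_wave_sub_le x y ξ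
      _ = 2 * Real.pi * (|ξ| * ‖φ ξ‖) * |x - y| := by ring
      _ ≤ _ := by gcongr; exact hC' ξ
  exact this.continuous

/-- The integral of η(y) φ e^{2πiy·} converges as a Bochner integral of bounded continuous
functions, with which ℓ commutes. Evaluating at each ξ identifies its value as φ 𝓕⁻¹η. -/
theorem commutesWithWaves_of_dual (ℓ : StrongDual ℂ (BoundedContinuousFunction ℝ ℂ)) :
    CommutesWithWaves (ℓ ∘L SchwartzMap.toBoundedContinuousFunctionCLM ℂ ℝ ℂ) := by
  intro φ η
  set J : ℝ → BoundedContinuousFunction ℝ ℂ :=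
    fun y => η y • (modulate y φ).toBoundedContinuousFunction
  have hbd : ∀ y, ‖(modulate y φ).toBoundedContinuousFunction‖ ≤
      ‖φ.toBoundedContinuousFunction‖ := fun y => by
    rw [BoundedContinuousFunction.norm_le (norm_nonneg _)]
    intro ξ
    simp only [SchwartzMap.toBoundedContinuousFunction_apply, modulate_apply, norm_mul, norm_wave,
      one_mul]
    exact φ.toBoundedContinuousFunction.norm_coe_le_norm ξ
  have hJ : Integrable J := by
    have hm : AEStronglyMeasurable J volume :=
      (η.continuous.smul (modulate_lipschitz φ)).aestronglyMeasurable
    refine (η.integrable.norm.mul_const ‖φ.toBoundedContinuousFunction‖).mono' hm ?_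
    refine Eventually.of_forall fun y => ?_
    rw [norm_smul]
    gcongr
    exact hbd y
  have e : (fun y => (ℓ ∘L SchwartzMap.toBoundedContinuousFunctionCLM ℂ ℝ ℂ) (modulate y φ) * η y)
      = fun y => ℓ (J y) := by
    ext y
    simp only [J, map_smul, smul_eq_mul, ContinuousLinearMap.comp_apply, mul_comm]
    rfl
  rw [e]
  refine ⟨ℓ.continuous.comp (modulate_lipschitz φ), ℓ.integrable_comp hJ, ?_⟩
  rw [ℓ.integral_comp_comm hJ, ContinuousLinearMap.comp_apply]
  congr 1
  ext ξ
  have h1 := (BoundedContinuousFunction.evalCLM ℂ ξ).integral_comp_comm hJ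
  simp only [BoundedContinuousFunction.evalCLM_apply] at h1
  rw [← h1]
  simp only [J, BoundedContinuousFunction.coe_smul, SchwartzMap.toBoundedContinuousFunction_apply,
    SchwartzMap.toBoundedContinuousFunctionCLM_apply, mulS_apply, modulate_apply,
    fourierInv_apply_eq_wave, smul_eq_mul, ← integral_const_mul]
  refine integral_congr_ae (Eventually.of_forall fun y => ?_)
  simp only [wave_symm y ξ]
  ring

/-- The bound makes L vanish on the kernel of J, so L descends to a bounded functional on the range
of J, which Hahn-Banach extends to B. -/
theorem exists_dual_factor {V B : Type*} [AddCommGroup V] [Module ℂ V] [NormedAddCommGroup B]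
    [NormedSpace ℂ B] (L : V →ₗ[ℂ] ℂ) (J : V →ₗ[ℂ] B) (C : ℝ) (h : ∀ v, ‖L v‖ ≤ C * ‖J v‖) :
    ∃ ℓ : StrongDual ℂ B, ∀ v, L v = ℓ (J v) := by
  have hker : LinearMap.ker J ≤ LinearMap.ker L := fun v hv => by
    have := h v
    rw [LinearMap.mem_ker.1 hv, norm_zero, mul_zero] at this
    exact LinearMap.mem_ker.2 (norm_le_zero_iff.1 this)
  let f : LinearMap.range J →ₗ[ℂ] ℂ :=
    (LinearMap.ker J).liftQ L hker ∘ₗ (J.quotKerEquivRange.symm : _ →ₗ[ℂ] _)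
  have hf : ∀ v, f ⟨J v, v, rfl⟩ = L v := fun v => by
    have : J.quotKerEquivRange.symm ⟨J v, v, rfl⟩ = (LinearMap.ker J).mkQ v := by
      rw [LinearEquiv.symm_apply_eq]; rfl
    simp only [f, LinearMap.comp_apply, LinearEquiv.coe_coe]
    rw [this]; simp
  let F : StrongDual ℂ (LinearMap.range J) := f.mkContinuous C (by
    rintro ⟨_, v, rfl⟩
    rw [hf]; exact h v)
  obtain ⟨ℓ, hℓ, -⟩ := exists_extension_norm_eq (LinearMap.range J) F
  refine ⟨ℓ, fun v => ?_⟩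
  have := hℓ ⟨J v, v, rfl⟩
  rw [this, ← hf v]; rfl

theorem coordMul_pow_apply (k : ℕ) (ψ : 𝓢(ℝ, ℂ)) (x : ℝ) :
    (coordMul ^ k) ψ x = (x : ℂ) ^ k * ψ x := by
  induction k generalizing ψ with
  | zero => simp
  | succ k ih =>
    rw [pow_succ, mul_apply_eq_comp, ih, coordMul_apply]; ring

theorem derivCLM_pow_apply (n : ℕ) (ψ : 𝓢(ℝ, ℂ)) (x : ℝ) :
    ((SchwartzMap.derivCLM ℂ ℂ) ^ n) ψ x = iteratedDeriv n ψ x := by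
  induction n generalizing ψ with
  | zero => simp
  | succ n ih =>
    rw [pow_succ, mul_apply_eq_comp, ih, iteratedDeriv_succ']
    congr 1

/-- Every continuous functional on the Schwartz space commutes with the integral
`∫ φ e^{2πiy·} η(y) dy`. -/
theorem commutesWithWaves (L : 𝓢(ℝ, ℂ) →L[ℂ] ℂ) : CommutesWithWaves L := by
  -- Continuity bounds L by finitely many seminorms sup |x^k ψ^(n)|. These are sup norms of the
  -- functions `T p ψ`, so L factors through a finite product of spaces of bounded continuous
  -- functions and is a finite sum of functionals ℓ ∘ x^k ∘ ∂^n.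
  obtain ⟨s, C, -, hC⟩ := Seminorm.bound_of_continuous (schwartz_withSeminorms ℂ ℝ ℂ)
    ((normSeminorm ℂ ℂ).comp L.toLinearMap) (by exact continuous_norm.comp L.continuous)
  let T : ℕ × ℕ → 𝓢(ℝ, ℂ) →L[ℂ] 𝓢(ℝ, ℂ) :=
    fun p => (coordMul ^ p.1) ∘L ((SchwartzMap.derivCLM ℂ ℂ) ^ p.2)
  let E := SchwartzMap.toBoundedContinuousFunctionCLM ℂ ℝ ℂ
  let J : 𝓢(ℝ, ℂ) →ₗ[ℂ] (s → BoundedContinuousFunction ℝ ℂ) :=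
    LinearMap.pi fun p => (E ∘L T p).toLinearMap
  have hT : ∀ p : s, ∀ ψ x, ‖(T p ψ) x‖ ≤ ‖J ψ‖ := fun p ψ x => by
    refine le_trans ?_ (norm_le_pi_norm (J ψ) p)
    exact BoundedContinuousFunction.norm_coe_le_norm (E (T p ψ)) x
  obtain ⟨ℓ, hℓ⟩ := exists_dual_factor L.toLinearMap J C (fun ψ => by
    refine (hC ψ).trans ?_
    change (C : ℝ) * _ ≤ _
    gcongr
    refine Seminorm.finset_sup_apply_le (norm_nonneg _) fun p hp => ?_
    refine SchwartzMap.seminorm_le_bound' ℂ p.1 p.2 ψ (norm_nonneg _) fun x => ?_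
    have := hT ⟨p, hp⟩ ψ x
    have e : T p ψ x = (x : ℂ) ^ p.1 * iteratedDeriv p.2 ψ x := by
      simp only [T, ContinuousLinearMap.comp_apply, coordMul_pow_apply, derivCLM_pow_apply]
    rw [e, norm_mul, norm_pow, Complex.norm_real, Real.norm_eq_abs] at this
    exact this)
  have hL : L = ∑ p ∈ s.attach, ((ℓ ∘L ContinuousLinearMap.single ℂ
      (fun _ : s => BoundedContinuousFunction ℝ ℂ) p) ∘L E) ∘L T p := by
    ext ψ
    refine (hℓ ψ).trans ?_
    rw [_root_.sum_apply]
    have : J ψ = ∑ p ∈ s.attach, Pi.single p (E (T p ψ)) := by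
      rw [Finset.attach_eq_univ, Finset.univ_sum_single (fun p : s => E (T p ψ))]
      rfl
    rw [this, map_sum]
    refine Finset.sum_congr rfl fun p _ => ?_
    generalize T p = R
    rw [ContinuousLinearMap.comp_apply _ R, ContinuousLinearMap.comp_apply _ E,
      ContinuousLinearMap.comp_apply, ContinuousLinearMap.single_apply]
  rw [hL]
  refine CommutesWithWaves.sum fun p _ => ?_
  have h := ((commutesWithWaves_of_dual (ℓ ∘L ContinuousLinearMap.single ℂ
    (fun _ : s => BoundedContinuousFunction ℝ ℂ) p)).comp_coordMul_pow p.1.1).comp_deriv_pow p.1.2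
  rwa [ContinuousLinearMap.comp_assoc] at h

/-! ### Band-limited functions -/

/-- The convolution kernel of the Fourier multiplier with symbol `ρ`. -/
noncomputable def kern (ρ : 𝓢(ℝ, ℂ)) : 𝓢(ℝ, ℂ) := 𝓕⁻ ρ

theorem kern_apply (ρ : 𝓢(ℝ, ℂ)) (x : ℝ) : kern ρ x = ∫ y, wave x y * ρ y :=
  fourierInv_apply_eq_wave ρ x

/-- The function `u` is continuous, square integrable and reproduced by the kernel `𝓕⁻ρ`. -/
structure IsReproduced (u : ℝ → ℂ) (ρ : 𝓢(ℝ, ℂ)) : Prop where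
  continuous : Continuous u
  memLp : l2Norm volume (fun x => ‖u x‖ₑ) < ⊤
  eq_integral : ∀ x, u x = ∫ y, kern ρ (x - y) * u y

theorem l2Norm_schwartz_lt_top (ρ : 𝓢(ℝ, ℂ)) : l2Norm volume (fun x => ‖ρ x‖ₑ) < ⊤ := by
  have := ρ.eLpNorm_lt_top 2 volume
  rw [eLpNorm_eq_lintegral_rpow_enorm_toReal (by norm_num) (by norm_num)] at this
  simpa [l2Norm] using this

theorem l2Norm_comp_sub_left (f : ℝ → ℝ≥0∞) (x : ℝ) :
    l2Norm volume (fun y => f (x - y)) = l2Norm volume f := by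
  unfold l2Norm
  rw [lintegral_sub_left_eq_self (fun y => f y ^ 2) x]

theorem IsReproduced.lintegral_le {u : ℝ → ℂ} {ρ : 𝓢(ℝ, ℂ)} (h : IsReproduced u ρ) (x : ℝ) :
    ∫⁻ y, ‖kern ρ (x - y) * u y‖ₑ ≤
      l2Norm volume (fun x => ‖kern ρ x‖ₑ) * l2Norm volume (fun x => ‖u x‖ₑ) := by
  simp only [enorm_mul]
  rw [← l2Norm_comp_sub_left (fun y => ‖kern ρ y‖ₑ) x]
  have hc := h.continuous
  exact lintegral_mul_le_l2Norm volume (by fun_prop) (by fun_prop)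

theorem IsReproduced.enorm_le {u : ℝ → ℂ} {ρ : 𝓢(ℝ, ℂ)} (h : IsReproduced u ρ) (x : ℝ) :
    ‖u x‖ₑ ≤ l2Norm volume (fun x => ‖kern ρ x‖ₑ) * l2Norm volume (fun x => ‖u x‖ₑ) := by
  refine le_trans ?_ (h.lintegral_le x)
  conv_lhs => rw [h.eq_integral x]
  exact enorm_integral_le_lintegral_enorm _

theorem IsReproduced.exists_bound {u : ℝ → ℂ} {ρ : 𝓢(ℝ, ℂ)} (h : IsReproduced u ρ) :
    ∃ C : ℝ, 0 ≤ C ∧ ∀ x, ‖u x‖ ≤ C := by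
  set B := l2Norm volume (fun x => ‖kern ρ x‖ₑ) * l2Norm volume (fun x => ‖u x‖ₑ)
  have hB : B ≠ ⊤ := (ENNReal.mul_lt_top (l2Norm_schwartz_lt_top _) h.memLp).ne
  refine ⟨B.toReal, ENNReal.toReal_nonneg, fun x => ?_⟩
  rw [← toReal_enorm]
  exact ENNReal.toReal_mono hB (h.enorm_le x)

theorem IsReproduced.integrable_mul {u G : ℝ → ℂ} {ρ : 𝓢(ℝ, ℂ)} (h : IsReproduced u ρ)
    (hG : Integrable G) : Integrable (fun x => u x * G x) := by
  obtain ⟨C, -, hC⟩ := h.exists_bound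
  exact hG.bdd_mul h.continuous.aestronglyMeasurable (Eventually.of_forall hC)

theorem integrable_wave_mul {G : ℝ → ℂ} (hG : Integrable G) (b : ℝ) :
    Integrable (fun y => wave b y * G y) :=
  hG.bdd_mul (c := 1) (wave_continuous_right b).aestronglyMeasurable
    (Eventually.of_forall fun y => (norm_wave b y).le)

/-- If `∫ e^{2πi(a+b)y} G(y) dy` vanishes for `a` in the support of `ρ`, then so does
`∫ e^{2πiby} (𝓕⁻ρ)(y - z) G(y) dy`. -/
theorem integral_wave_kernel_eq_zero {G : ℝ → ℂ} {ρ : 𝓢(ℝ, ℂ)} (hG : Integrable G) {b : ℝ}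
    (hb : ∀ a, ρ a ≠ 0 → ∫ y, wave (a + b) y * G y = 0) (z : ℝ) :
    ∫ y, kern ρ (y - z) * (wave b y * G y) = 0 := by
  have hint : Integrable (Function.uncurry fun y a : ℝ =>
      (wave (y - z) a * ρ a) * (wave b y * G y)) (volume.prod volume) := by
    have h1 : Integrable (fun p : ℝ × ℝ => (wave b p.1 * G p.1) * ρ p.2) (volume.prod volume) :=
      (integrable_wave_mul hG b).mul_prod ρ.integrable
    have h2 : Continuous (fun p : ℝ × ℝ => wave (p.1 - z) p.2) := by unfold wave; fun_prop
    refine (h1.bdd_mul (c := 1) h2.aestronglyMeasurable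
      (Eventually.of_forall fun p => (norm_wave _ _).le)).congr
      (Eventually.of_forall fun p => ?_)
    simp only [Function.uncurry]; ring
  calc ∫ y, kern ρ (y - z) * (wave b y * G y)
      = ∫ y, ∫ a, (wave (y - z) a * ρ a) * (wave b y * G y) := by
        simp_rw [kern_apply, integral_mul_const]
    _ = ∫ a, ∫ y, (wave (y - z) a * ρ a) * (wave b y * G y) := integral_integral_swap hint
    _ = ∫ a, (wave (-z) a * ρ a) * ∫ y, wave (a + b) y * G y := by
        refine integral_congr_ae (Eventually.of_forall fun a => ?_)
        simp only
        rw [← integral_const_mul]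
        refine integral_congr_ae (Eventually.of_forall fun y => ?_)
        simp only [sub_eq_add_neg, wave_add, wave_symm y a]
        ring
    _ = 0 := by
        rw [← integral_zero ℝ ℂ]
        refine integral_congr_ae (Eventually.of_forall fun a => ?_)
        simp only
        by_cases ha : ρ a = 0
        · simp [ha]
        · simp [hb a ha]

/-- Multiplication by a band-limited function enlarges the frequency support of an integrable
function at most by the frequency band. -/
theorem IsReproduced.integral_wave_mul_eq_zero {u G : ℝ → ℂ} {ρ : 𝓢(ℝ, ℂ)}
    (h : IsReproduced u ρ) (hG : Integrable G) {b : ℝ}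
    (hb : ∀ a, ρ a ≠ 0 → ∫ y, wave (a + b) y * G y = 0) :
    ∫ y, wave b y * (u y * G y) = 0 := by
  have hc := h.continuous
  set B := l2Norm volume (fun x => ‖kern ρ x‖ₑ) * l2Norm volume (fun x => ‖u x‖ₑ)
  have hB : B < ⊤ := ENNReal.mul_lt_top (l2Norm_schwartz_lt_top _) h.memLp
  -- Fubini is allowed because Cauchy-Schwarz bounds the z-integral of the kernel against u by B,
  -- uniformly in y, and G is integrable.
  have hint : Integrable (Function.uncurry fun y z : ℝ =>
      (wave b y * G y) * (kern ρ (y - z) * u z)) (volume.prod volume) := by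
    refine ⟨?_, ?_⟩
    · have h1 : AEStronglyMeasurable (fun p : ℝ × ℝ => wave b p.1 * G p.1)
          (volume.prod volume) := (integrable_wave_mul hG b).aestronglyMeasurable.comp_fst
      have h2 : Continuous (fun p : ℝ × ℝ => kern ρ (p.1 - p.2) * u p.2) := by fun_prop
      exact h1.mul h2.aestronglyMeasurable
    · rw [hasFiniteIntegral_iff_enorm]
      refine (lintegral_prod_le _).trans_lt ?_
      calc ∫⁻ y, ∫⁻ z, ‖(wave b y * G y) * (kern ρ (y - z) * u z)‖ₑ
          ≤ ∫⁻ y, ‖wave b y * G y‖ₑ * B := by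
            refine lintegral_mono fun y => ?_
            simp only [enorm_mul (wave b y * G y)]
            rw [lintegral_const_mul' _ _ enorm_ne_top]
            gcongr
            exact h.lintegral_le y
        _ = (∫⁻ y, ‖wave b y * G y‖ₑ) * B := lintegral_mul_const' _ _ hB.ne
        _ < ⊤ := ENNReal.mul_lt_top (integrable_wave_mul hG b).2 hB
  calc ∫ y, wave b y * (u y * G y)
      = ∫ y, ∫ z, (wave b y * G y) * (kern ρ (y - z) * u z) := by
        refine integral_congr_ae (Eventually.of_forall fun y => ?_)
        simp only
        rw [integral_const_mul, ← h.eq_integral y]; ring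
    _ = ∫ z, ∫ y, (wave b y * G y) * (kern ρ (y - z) * u z) := integral_integral_swap hint
    _ = ∫ z, u z * ∫ y, kern ρ (y - z) * (wave b y * G y) := by
        refine integral_congr_ae (Eventually.of_forall fun z => ?_)
        simp only
        rw [← integral_const_mul]
        refine integral_congr_ae (Eventually.of_forall fun y => ?_)
        simp only; ring
    _ = 0 := by simp [integral_wave_kernel_eq_zero hG hb]

/-- The product of three band-limited functions is orthogonal to a Schwartz function whose
frequencies are not in the sum of the three bands. -/
theorem integral_mul_mul_mul_eq_zero {u v w : ℝ → ℂ} {ρ σ τ : 𝓢(ℝ, ℂ)} (hu : IsReproduced u ρ)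
    (hv : IsReproduced v σ) (hw : IsReproduced w τ) (ψ : 𝓢(ℝ, ℂ))
    (h : ∀ a b c, ρ a ≠ 0 → σ b ≠ 0 → τ c ≠ 0 → kern ψ (a + b + c) = 0) :
    ∫ x, u x * v x * w x * ψ x = 0 := by
  have h1 := hw.integrable_mul ψ.integrable
  have h2 := hv.integrable_mul h1
  -- The factors are peeled off one at a time, each adding a frequency of its band to the wave. What
  -- remains is ∫ e^{2πi(a+b+c)y} ψ(y) dy, which is `kern ψ (a + b + c)`.
  have := hu.integral_wave_mul_eq_zero h2 (b := 0) fun a ha =>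
    hv.integral_wave_mul_eq_zero h1 fun b hb =>
      hw.integral_wave_mul_eq_zero ψ.integrable fun c hc => by
        rw [← kern_apply, ← h a b c ha hb hc]
        congr 1; ring
  rw [← this]
  refine integral_congr_ae (Eventually.of_forall fun y => ?_)
  have : wave 0 y = 1 := by simp [wave]
  simp only [this]; ring

namespace Choices

/-! ### Littlewood-Paley symbols as Schwartz functions and their kernels -/

theorem dilated_smooth (D : Choices) (n : ℕ) :
    ContDiff ℝ ∞ (fun ξ => (D.φ₀ (ξ / 2 ^ n) : ℂ)) :=
  Complex.ofRealCLM.contDiff.comp (D.φ₀_smooth.comp (contDiff_id.div_const _))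

theorem dilated_zero (D : Choices) (n : ℕ) {ξ : ℝ} (h : 2 ^ (n + 1) ≤ |ξ|) :
    D.φ₀ (ξ / 2 ^ n) = 0 := by
  apply D.φ₀_zero
  rw [abs_div, abs_of_pos (by positivity : (0 : ℝ) < 2 ^ n), le_div_iff₀ (by positivity)]
  rw [pow_succ] at h; linarith

theorem dilated_one (D : Choices) (n : ℕ) {ξ : ℝ} (h : |ξ| ≤ 2 ^ n) :
    D.φ₀ (ξ / 2 ^ n) = 1 := by
  apply D.φ₀_one
  rw [abs_div, abs_of_pos (by positivity : (0 : ℝ) < 2 ^ n), div_le_iff₀ (by positivity)]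
  linarith

theorem dilated_compact (D : Choices) (n : ℕ) :
    HasCompactSupport (fun ξ => (D.φ₀ (ξ / 2 ^ n) : ℂ)) := by
  refine HasCompactSupport.intro (K := Icc (-(2 ^ (n + 1))) (2 ^ (n + 1))) isCompact_Icc ?_
  intro ξ hξ
  have : 2 ^ (n + 1) ≤ |ξ| := by
    by_contra hlt
    exact hξ (abs_le.mp (not_le.mp hlt).le)
  simp [D.dilated_zero n this]

/-- The symbol `φ₀(2^{-n}ξ)` as a Schwartz function. -/
noncomputable def lowSymbol (D : Choices) (n : ℕ) : 𝓢(ℝ, ℂ) :=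
  (D.dilated_compact n).toSchwartzMap (D.dilated_smooth n)

theorem lowSymbol_apply (D : Choices) (n : ℕ) (ξ : ℝ) :
    D.lowSymbol n ξ = (D.φ₀ (ξ / 2 ^ n) : ℂ) := rfl

/-- The symbol `φ_j` as a Schwartz function. -/
noncomputable def symbol (D : Choices) : ℕ → 𝓢(ℝ, ℂ)
  | 0 => D.lowSymbol 0
  | j + 1 => D.lowSymbol (j + 1) - D.lowSymbol j

theorem symbol_apply (D : Choices) (j : ℕ) (ξ : ℝ) : D.symbol j ξ = (D.φ j ξ : ℂ) := by
  cases j with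
  | zero => simp [symbol, lowSymbol_apply, φ]
  | succ j => simp [symbol, lowSymbol_apply, φ]

/-- A symbol that is `1` on the support of `φ_i`. -/
noncomputable def wideSymbol (D : Choices) (i : ℕ) : 𝓢(ℝ, ℂ) :=
  if 2 ≤ i then D.lowSymbol (i + 1) - D.lowSymbol (i - 2) else D.lowSymbol (i + 1)

theorem wideSymbol_upper (D : Choices) (i : ℕ) {ξ : ℝ} (h : D.wideSymbol i ξ ≠ 0) :
    |ξ| < 2 ^ (i + 2) := by
  by_contra hlt
  push Not at hlt
  apply h
  unfold wideSymbol
  split_ifs with h2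
  · have : (2 : ℝ) ^ (i - 2 + 1) ≤ |ξ| :=
      le_trans (pow_le_pow_right₀ (by norm_num) (by omega)) hlt
    simp [lowSymbol_apply, D.dilated_zero (i + 1) hlt, D.dilated_zero (i - 2) this]
  · simp [lowSymbol_apply, D.dilated_zero (i + 1) hlt]

theorem wideSymbol_lower (D : Choices) (i : ℕ) (hi : 2 ≤ i) {ξ : ℝ} (h : D.wideSymbol i ξ ≠ 0) :
    2 ^ (i - 2) < |ξ| := by
  by_contra hlt
  push Not at hlt
  apply h
  have : |ξ| ≤ (2 : ℝ) ^ (i + 1) :=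
    le_trans hlt (pow_le_pow_right₀ (by norm_num) (by omega))
  simp [wideSymbol, hi, lowSymbol_apply, D.dilated_one _ hlt, D.dilated_one _ this]

theorem φ_zero_of_small (D : Choices) (j : ℕ) {ξ : ℝ} (h : |ξ| ≤ 2 ^ j) : D.φ (j + 1) ξ = 0 := by
  have : |ξ| ≤ (2 : ℝ) ^ (j + 1) :=
    le_trans h (pow_le_pow_right₀ (by norm_num) (by omega))
  simp [φ, D.dilated_one _ h, D.dilated_one _ this]

theorem symbol_mul_wideSymbol (D : Choices) (i : ℕ) (ξ : ℝ) :
    D.symbol i ξ * D.wideSymbol i ξ = D.symbol i ξ := by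
  by_cases h0 : D.φ i ξ = 0
  · simp [symbol_apply, h0]
  · have h1 : |ξ| ≤ 2 ^ (i + 1) := by
      by_contra h; exact h0 (D.φ_zero_of_le i ξ (not_le.1 h).le)
    have h2 : D.wideSymbol i ξ = 1 := by
      unfold wideSymbol
      split_ifs with hi
      · have : 2 ^ (i - 2 + 1) ≤ |ξ| := by
          by_contra h
          obtain ⟨j, rfl⟩ : ∃ j, i = j + 1 := ⟨i - 1, by omega⟩
          apply h0
          apply D.φ_zero_of_small
          rw [show j + 1 - 2 + 1 = j by omega] at h
          exact (not_le.1 h).le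
        simp [lowSymbol_apply, D.dilated_one _ h1, D.dilated_zero _ this]
      · simp [lowSymbol_apply, D.dilated_one _ h1]
    rw [h2, mul_one]

theorem modSymbol_toSchwartzMap (D : Choices) (j : ℕ) (x : ℝ) :
    (D.modSymbol_compact j x).toSchwartzMap (D.modSymbol_smooth j x) =
      modulate x (D.symbol j) := by
  ext ξ
  rw [modulate_apply, symbol_apply, mul_comm]
  rfl

theorem SFun_eq (D : Choices) (j : ℕ) (T : 𝓢'(ℝ, ℂ)) (x : ℝ) :
    D.SFun j T x = (𝓕 T) (modulate x (D.symbol j)) := by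
  rw [SFun, modSymbol_toSchwartzMap]

theorem fourier_modulate (x : ℝ) (ρ : 𝓢(ℝ, ℂ)) (y : ℝ) :
    𝓕 (modulate x ρ) y = kern ρ (x - y) := by
  rw [fourier_apply_eq_wave, kern_apply]
  refine integral_congr_ae (Eventually.of_forall fun ξ => ?_)
  simp only [modulate_apply, sub_eq_add_neg, wave_add]; ring

theorem SFun_eq_apply (D : Choices) (j : ℕ) (T : 𝓢'(ℝ, ℂ)) (x : ℝ) :
    D.SFun j T x = T (𝓕 (modulate x (D.symbol j))) := by
  rw [SFun_eq]; rfl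

theorem SFun_continuous (D : Choices) (j : ℕ) (T : 𝓢'(ℝ, ℂ)) : Continuous (D.SFun j T) := by
  have h := (commutesWithWaves (𝓕 T : 𝓢'(ℝ, ℂ)) (D.symbol j) 0).1
  exact h.congr fun x => (D.SFun_eq j T x).symm

/-- The wide symbol is 1 on the support of φ_i, so multiplying by it changes nothing. On the
physical side this is a convolution, by `commutesWithWaves` for 𝓕T with η = 𝓕(e^{2πix·} wideSymbol),
which is y ↦ kern(x - y). No integrability of T is assumed. -/
theorem SFun_eq_integral (D : Choices) (i : ℕ) (T : 𝓢'(ℝ, ℂ)) (x : ℝ) :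
    D.SFun i T x = ∫ y, kern (D.wideSymbol i) (x - y) * D.SFun i T y := by
  have h := (commutesWithWaves (𝓕 T : 𝓢'(ℝ, ℂ)) (D.symbol i)
    (𝓕 (modulate x (D.wideSymbol i)))).2.2
  have e : mulS (D.symbol i) (𝓕⁻ (𝓕 (modulate x (D.wideSymbol i)))) =
      modulate x (D.symbol i) := by
    rw [FourierTransform.fourierInv_fourier_eq]
    ext ξ
    rw [mulS_apply, modulate_apply, modulate_apply]
    rw [mul_left_comm, symbol_mul_wideSymbol]
  rw [e] at h
  refine (D.SFun_eq i T x).trans (h.symm.trans ?_)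
  refine integral_congr_ae (Eventually.of_forall fun y => ?_)
  simp only [fourier_modulate]
  rw [mul_comm, D.SFun_eq i T y]
  rfl

theorem isReproduced_SFun (D : Choices) (i : ℕ) (T : 𝓢'(ℝ, ℂ))
    (h : l2Norm volume (fun x => ‖D.SFun i T x‖ₑ) < ⊤) :
    IsReproduced (D.SFun i T) (D.wideSymbol i) :=
  ⟨D.SFun_continuous i T, h, D.SFun_eq_integral i T⟩

/-! ### Pointwise decay of the Littlewood-Paley kernels. -/

/-- The bump function `2^l / (1 + 2^l |x|)^2`. -/
noncomputable def bump (l : ℕ) (x : ℝ) : ℝ := 2 ^ l / (1 + 2 ^ l * |x|) ^ 2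

theorem kern_lowSymbol (D : Choices) (n : ℕ) (x : ℝ) :
    kern (D.lowSymbol n) x = 2 ^ n * kern (D.lowSymbol 0) (2 ^ n * x) := by
  rw [kern_apply, kern_apply]
  have h := Measure.integral_comp_div (fun ξ : ℝ => wave (2 ^ n * x) ξ * D.lowSymbol 0 ξ) (2 ^ n : ℝ)
  rw [abs_of_pos (by positivity), Complex.real_smul] at h
  push_cast at h
  rw [← h]
  refine integral_congr_ae (Eventually.of_forall fun ξ => ?_)
  have e : wave (2 ^ n * x) (ξ / 2 ^ n) = wave x ξ := by
    unfold wave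
    congr 1
    push_cast
    field_simp
  simp only [lowSymbol_apply, e, pow_zero, div_one]

theorem kern_lowSymbol_le (D : Choices) : ∃ C : ℝ, 0 ≤ C ∧ ∀ n l : ℕ, n ≤ l + 2 → l ≤ n + 2 →
    ∀ x, ‖kern (D.lowSymbol n) x‖ ≤ C * (bump l x * ((1 + |x|) ^ 2)⁻¹) := by
  -- Fourth-order decay: two powers go into the bump at scale 2^{-l}, the other two into the decay
  -- (1+|x|)^{-2} between unit intervals.
  have hd := fun x => SchwartzMap.one_add_le_sup_seminorm_apply (𝕜 := ℂ) (m := (4, 0)) (k := 4)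
    (n := 0) le_rfl le_rfl (kern (D.lowSymbol 0)) x
  set B := 2 ^ 4 * ((Finset.Iic (4, 0)).sup fun m => SchwartzMap.seminorm ℂ m.1 m.2)
    (kern (D.lowSymbol 0))
  have hB : 0 ≤ B := by positivity
  -- Since |n - l| ≤ 2, the scales 2^n and 2^l differ by a factor of at most 4. It enters once from
  -- the height 2^n and four times from the denominator.
  refine ⟨4 ^ 5 * B, by positivity, fun n l h1 h2 x => ?_⟩
  have hk : ‖kern (D.lowSymbol n) x‖ ≤ 2 ^ n * (B / (1 + 2 ^ n * |x|) ^ 4) := by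
    rw [kern_lowSymbol, norm_mul]
    have := hd (2 ^ n * x)
    simp only [norm_iteratedFDeriv_zero, Real.norm_eq_abs, abs_mul, abs_pow, abs_two] at this
    have e : ‖(2 ^ n : ℂ)‖ = 2 ^ n := by simp
    rw [e]
    gcongr
    rw [le_div_iff₀ (by positivity), mul_comm]
    exact this
  refine hk.trans ?_
  have hn : (2 : ℝ) ^ n ≤ 4 * 2 ^ l := by
    calc (2 : ℝ) ^ n ≤ 2 ^ (l + 2) := pow_le_pow_right₀ (by norm_num) h1
      _ = _ := by ring
  have hl : (2 : ℝ) ^ l ≤ 4 * 2 ^ n := by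
    calc (2 : ℝ) ^ l ≤ 2 ^ (n + 2) := pow_le_pow_right₀ (by norm_num) h2
      _ = _ := by ring
  have ha := abs_nonneg x
  have hl1 : (1 : ℝ) ≤ 2 ^ l := one_le_pow₀ (by norm_num)
  have h3 : 1 + 2 ^ l * |x| ≤ 4 * (1 + 2 ^ n * |x|) := by nlinarith
  have h4 : 1 + |x| ≤ 1 + 2 ^ l * |x| := by nlinarith
  have h5 : (1 + 2 ^ l * |x|) ^ 2 * (1 + |x|) ^ 2 ≤ 4 ^ 4 * (1 + 2 ^ n * |x|) ^ 4 := by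
    calc (1 + 2 ^ l * |x|) ^ 2 * (1 + |x|) ^ 2
        ≤ (4 * (1 + 2 ^ n * |x|)) ^ 2 * (4 * (1 + 2 ^ n * |x|)) ^ 2 := by
          gcongr; exact h4.trans h3
      _ = _ := by ring
  unfold bump
  rw [show 2 ^ n * (B / (1 + 2 ^ n * |x|) ^ 4) = 2 ^ n * B / (1 + 2 ^ n * |x|) ^ 4 by ring,
    show 4 ^ 5 * B * (2 ^ l / (1 + 2 ^ l * |x|) ^ 2 * ((1 + |x|) ^ 2)⁻¹) =
      4 ^ 5 * B * 2 ^ l / ((1 + 2 ^ l * |x|) ^ 2 * (1 + |x|) ^ 2) by field_simp,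
    div_le_div_iff₀ (by positivity) (by positivity)]
  calc 2 ^ n * B * ((1 + 2 ^ l * |x|) ^ 2 * (1 + |x|) ^ 2)
      ≤ (4 * 2 ^ l) * B * (4 ^ 4 * (1 + 2 ^ n * |x|) ^ 4) := by gcongr
    _ = _ := by ring

theorem kern_sub (ρ σ : 𝓢(ℝ, ℂ)) (x : ℝ) : kern (ρ - σ) x = kern ρ x - kern σ x := by
  simp only [kern_apply, _root_.sub_apply, mul_sub]
  exact integral_sub (integrable_wave_mul ρ.integrable x) (integrable_wave_mul σ.integrable x)

/-- The kernels of the multipliers `φ_l` and of the wider ones are bounded by a multiple of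
`2^l (1 + 2^l|x|)^{-2} (1 + |x|)^{-2}`. -/
theorem kern_symbol_le (D : Choices) : ∃ C : ℝ, 0 ≤ C ∧ ∀ l x,
    ‖kern (D.symbol l) x‖ ≤ C * (bump l x * ((1 + |x|) ^ 2)⁻¹) ∧
    ‖kern (D.wideSymbol l) x‖ ≤ C * (bump l x * ((1 + |x|) ^ 2)⁻¹) := by
  obtain ⟨C, hC0, hC⟩ := D.kern_lowSymbol_le
  have hb : ∀ l x, 0 ≤ bump l x * ((1 + |x|) ^ 2)⁻¹ := fun l x => by unfold bump; positivity
  have h2 : ∀ m n l : ℕ, m ≤ l + 2 → l ≤ m + 2 → n ≤ l + 2 → l ≤ n + 2 → ∀ x,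
      ‖kern (D.lowSymbol m - D.lowSymbol n) x‖ ≤ 2 * C * (bump l x * ((1 + |x|) ^ 2)⁻¹) := by
    intro m n l h1 h2 h3 h4 x
    rw [kern_sub]
    refine (norm_sub_le _ _).trans ?_
    linarith [hC m l h1 h2 x, hC n l h3 h4 x]
  have h1 : ∀ m l : ℕ, m ≤ l + 2 → l ≤ m + 2 → ∀ x,
      ‖kern (D.lowSymbol m) x‖ ≤ 2 * C * (bump l x * ((1 + |x|) ^ 2)⁻¹) := by
    intro m l h1 h2 x
    have := mul_nonneg hC0 (hb l x)
    linarith [hC m l h1 h2 x]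
  refine ⟨2 * C, by positivity, fun l x => ⟨?_, ?_⟩⟩
  · cases l with
    | zero => exact h1 0 0 (by omega) (by omega) x
    | succ l => exact h2 (l + 1) l (l + 1) (by omega) (by omega) (by omega) (by omega) x
  · unfold wideSymbol
    split_ifs with hl
    · exact h2 (l + 1) (l - 2) l (by omega) (by omega) (by omega) (by omega) x
    · exact h1 (l + 1) l (by omega) (by omega) x

/-! ### Frequency supports of triple products -/

/-- The index `k` is much larger than `i` and `j`. -/
def Dominates (i j k : ℕ) : Prop := i + 6 ≤ k ∧ j + 6 ≤ k

/-- The output frequency `2^l` is possible for a product of functions at the frequencies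
`2^i, 2^j, 2^k`. -/
def Interacts (i j k l : ℕ) : Prop :=
  l ≤ max i (max j k) + 4 ∧ (Dominates i j k → l ≤ k + 3 ∧ k ≤ l + 3) ∧
    (Dominates i k j → l ≤ j + 3 ∧ j ≤ l + 3) ∧ (Dominates j k i → l ≤ i + 3 ∧ i ≤ l + 3)

theorem kern_fourier (ψ : 𝓢(ℝ, ℂ)) : kern (𝓕 ψ) = ψ := by
  rw [kern, FourierTransform.fourierInv_fourier_eq]

/-- With k = n + 6 one has |a|, |b| < 4·2^n and 16·2^n < |c| < 256·2^n, so the two small frequencies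
cannot cancel the large one. -/
theorem sum_low {D : Choices} {i j k : ℕ} (h : Dominates i j k) {a b c : ℝ}
    (ha : D.wideSymbol i a ≠ 0) (hb : D.wideSymbol j b ≠ 0) (hc : D.wideSymbol k c ≠ 0) :
    2 ^ (k - 3) < |a + b + c| ∧ |a + b + c| < 2 ^ (k + 3) := by
  obtain ⟨n, rfl⟩ : ∃ n, k = n + 6 := ⟨k - 6, by have := h.1; omega⟩
  have h1 : (2 : ℝ) ^ (i + 2) ≤ 2 ^ (n + 2) :=
    pow_le_pow_right₀ (by norm_num) (by have := h.1; omega)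
  have h2 : (2 : ℝ) ^ (j + 2) ≤ 2 ^ (n + 2) :=
    pow_le_pow_right₀ (by norm_num) (by have := h.2; omega)
  have ha' := D.wideSymbol_upper i ha
  have hb' := D.wideSymbol_upper j hb
  have hc' := D.wideSymbol_upper _ hc
  have hc2 := D.wideSymbol_lower _ (by omega) hc
  rw [show n + 6 - 2 = n + 4 by omega] at hc2
  rw [show n + 6 - 3 = n + 3 by omega]
  have hn : (0 : ℝ) < 2 ^ n := by positivity
  simp only [pow_add] at *
  norm_num at *
  have t1 := abs_add_three a b c
  have t2 : |c| ≤ |a + b + c| + |a| + |b| := by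
    have := abs_add_three (a + b + c) (-a) (-b)
    rwa [abs_neg, abs_neg, show a + b + c + -a + -b = c by ring] at this
  constructor <;> linarith

theorem φ_eq_zero_of_not_interacts {D : Choices} {i j k l : ℕ} (h : ¬ Interacts i j k l)
    {a b c : ℝ} (ha : D.wideSymbol i a ≠ 0) (hb : D.wideSymbol j b ≠ 0)
    (hc : D.wideSymbol k c ≠ 0) : D.φ l (a + b + c) = 0 := by
  have key : ∀ m, (2 : ℝ) ^ (m - 3) < |a + b + c| → |a + b + c| < 2 ^ (m + 3) →
      ¬ (l ≤ m + 3 ∧ m ≤ l + 3) → D.φ l (a + b + c) = 0 := by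
    intro m h1 h2 h3
    by_cases hl : l ≤ m + 3
    · apply D.φ_zero_of_le
      refine le_trans (pow_le_pow_right₀ (by norm_num) ?_) h1.le
      omega
    · obtain ⟨n, rfl⟩ : ∃ n, l = n + 1 := ⟨l - 1, by omega⟩
      apply D.φ_zero_of_small
      refine le_trans h2.le (pow_le_pow_right₀ (by norm_num) ?_)
      omega
  by_cases h0 : l ≤ max i (max j k) + 4
  · by_cases h1 : Dominates i j k → l ≤ k + 3 ∧ k ≤ l + 3
    · by_cases h2 : Dominates i k j → l ≤ j + 3 ∧ j ≤ l + 3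
      · have h3 : ¬ (Dominates j k i → l ≤ i + 3 ∧ i ≤ l + 3) := fun h3 => h ⟨h0, h1, h2, h3⟩
        push Not at h3
        have := sum_low h3.1 hb hc ha
        rw [show b + c + a = a + b + c by ring] at this
        exact key i this.1 this.2 (by have := h3.2; omega)
      · push Not at h2
        have := sum_low h2.1 ha hc hb
        rw [show a + c + b = a + b + c by ring] at this
        exact key j this.1 this.2 (by have := h2.2; omega)
    · push Not at h1
      have := sum_low h1.1 ha hb hc
      exact key k this.1 this.2 (by have := h1.2; omega)
  -- Here no lower bound is available, but |a + b + c| < 3·2^{m+2} < 2^{m+4}, and φ_{n+1} vanishes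
  -- up to 2^n with n ≥ m + 4.
  · set m := max i (max j k) with hm
    obtain ⟨n, rfl⟩ : ∃ n, l = n + 1 := ⟨l - 1, by omega⟩
    apply D.φ_zero_of_small
    have hp : ∀ r, r ≤ m → (2 : ℝ) ^ (r + 2) ≤ 2 ^ (m + 2) := fun r hr =>
      pow_le_pow_right₀ (by norm_num) (by omega)
    have ha' := (D.wideSymbol_upper i ha).trans_le (hp i (by omega))
    have hb' := (D.wideSymbol_upper j hb).trans_le (hp j (by omega))
    have hc' := (D.wideSymbol_upper k hc).trans_le (hp k (by omega))
    have hn : (2 : ℝ) ^ (m + 4) ≤ 2 ^ n := pow_le_pow_right₀ (by norm_num) (by omega)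
    have e : (2 : ℝ) ^ (m + 4) = 4 * 2 ^ (m + 2) := by ring
    have t1 := abs_add_three a b c
    linarith [abs_nonneg a]

theorem integral_eq_zero_of_not_interacts {D : Choices} {i j k l : ℕ} (h : ¬ Interacts i j k l)
    {u v w : ℝ → ℂ} (hu : IsReproduced u (D.wideSymbol i)) (hv : IsReproduced v (D.wideSymbol j))
    (hw : IsReproduced w (D.wideSymbol k)) (x : ℝ) :
    ∫ y, u y * v y * w y * 𝓕 (modulate x (D.symbol l)) y = 0 := by
  refine integral_mul_mul_mul_eq_zero hu hv hw _ fun a b c ha hb hc => ?_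
  rw [kern_fourier, modulate_apply, symbol_apply, φ_eq_zero_of_not_interacts h ha hb hc]
  simp

/-! ### Triple products against a fixed Schwartz function. -/

/-- A product of functions at the frequencies `2^i, 2^j, 2^k` with `i, j` much smaller than `k`
pairs weakly with a fixed Schwartz function. -/
theorem enorm_integral_le_of_dominates {D : Choices} {i j k : ℕ} (h : Dominates i j k)
    {u v w : ℝ → ℂ} (hu : IsReproduced u (D.wideSymbol i)) (hv : IsReproduced v (D.wideSymbol j))
    (hw : IsReproduced w (D.wideSymbol k)) (N : ℕ) (ψ : 𝓢(ℝ, ℂ)) :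
    ‖∫ y, u y * v y * w y * ψ y‖ₑ ≤
      ENNReal.ofReal ((∫ ξ, |ξ| ^ N * ‖kern ψ ξ‖) / (2 ^ (k - 4)) ^ N) *
        ∫⁻ y, ‖u y * v y * w y‖ₑ := by
  set m := k - 4
  -- The frequencies of ψ₁ stay below 2^{m+1} = 2^{k-3}, whereas those of the product exceed
  -- 2^{k-3}. So ψ may be replaced by ψ - ψ₁, whose sup norm is at most the integral of |kern ψ|
  -- over |ξ| > 2^m.
  set ψ₁ : 𝓢(ℝ, ℂ) := 𝓕 (mulS (D.lowSymbol m) (kern ψ))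
  set A := (∫ ξ, |ξ| ^ N * ‖kern ψ ξ‖) / (2 ^ m) ^ N
  have h0 : ∫ y, u y * v y * w y * ψ₁ y = 0 := by
    refine integral_mul_mul_mul_eq_zero hu hv hw _ fun a b c ha hb hc => ?_
    have h1 := (sum_low h ha hb hc).1
    rw [kern_fourier, mulS_apply, lowSymbol_apply, D.dilated_zero m, Complex.ofReal_zero, zero_mul]
    rw [show m + 1 = k - 3 by have := h.1; omega]
    exact h1.le
  have hψ : ψ = 𝓕 (kern ψ) := by rw [kern, FourierTransform.fourier_fourierInv_eq]
  have hbd : ∀ y, ‖ψ y - ψ₁ y‖ ≤ A := fun y => by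
    conv_lhs => rw [hψ]
    rw [fourier_apply_eq_wave, fourier_apply_eq_wave,
      ← integral_sub (integrable_wave_mul (kern ψ).integrable _)
        (integrable_wave_mul (SchwartzMap.integrable _) _)]
    refine (norm_integral_le_integral_norm _).trans ?_
    have : A = ∫ ξ, |ξ| ^ N * ‖kern ψ ξ‖ / (2 ^ m) ^ N := by rw [integral_div]
    rw [this]
    refine integral_mono_of_nonneg (Eventually.of_forall fun _ => norm_nonneg _) ?_ ?_
    · refine Integrable.div_const ?_ _
      simpa using (kern ψ).integrable_pow_mul volume N
    · refine Eventually.of_forall fun ξ => ?_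
      simp only [mulS_apply, ← mul_sub]
      rw [norm_mul, norm_wave, one_mul, le_div_iff₀ (by positivity)]
      have e : kern ψ ξ - D.lowSymbol m ξ * kern ψ ξ =
          ((1 - D.φ₀ (ξ / 2 ^ m) : ℝ) : ℂ) * kern ψ ξ := by
        rw [lowSymbol_apply]; push_cast; ring
      rw [e, norm_mul, Complex.norm_real, Real.norm_eq_abs]
      have hm := D.φ₀_mem (ξ / 2 ^ m)
      by_cases hξ : |ξ| ≤ 2 ^ m
      · rw [D.dilated_one m hξ]
        simp
        positivity
      · have h1 : |1 - D.φ₀ (ξ / 2 ^ m)| ≤ 1 := by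
          rw [abs_le]; constructor <;> linarith [hm.1, hm.2]
        calc |1 - D.φ₀ (ξ / 2 ^ m)| * ‖kern ψ ξ‖ * (2 ^ m) ^ N
            ≤ 1 * ‖kern ψ ξ‖ * |ξ| ^ N := by gcongr; exact (not_le.1 hξ).le
          _ = _ := by ring
  have hi : ∀ θ : 𝓢(ℝ, ℂ), Integrable (fun y => u y * v y * w y * θ y) := fun θ => by
    have := hu.integrable_mul (hv.integrable_mul (hw.integrable_mul θ.integrable))
    refine this.congr (Eventually.of_forall fun y => ?_)
    simp only; ring
  have e1 : ∫ y, u y * v y * w y * ψ y = ∫ y, u y * v y * w y * (ψ y - ψ₁ y) := by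
    rw [← sub_zero (∫ y, u y * v y * w y * ψ y), ← h0, ← integral_sub (hi ψ) (hi ψ₁)]
    simp only [mul_sub]
  rw [e1]
  refine (enorm_integral_le_lintegral_enorm _).trans ?_
  have hA : 0 ≤ A := by positivity
  calc ∫⁻ y, ‖u y * v y * w y * (ψ y - ψ₁ y)‖ₑ
      ≤ ∫⁻ y, ENNReal.ofReal A * ‖u y * v y * w y‖ₑ := by
        refine lintegral_mono fun y => ?_
        rw [enorm_mul, mul_comm]
        gcongr
        rw [← ofReal_norm]
        exact ENNReal.ofReal_le_ofReal (hbd y)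
    _ = _ := lintegral_const_mul' _ _ ENNReal.ofReal_ne_top

/-- A seminorm on the Schwartz space that controls the two quantities in which the pairing of a
triple product with a Schwartz function is estimated. -/
theorem exists_schwartz_seminorm (N : ℕ) : ∃ (s : Finset (ℕ × ℕ)) (C : ℝ), 0 ≤ C ∧
    ∀ ψ : 𝓢(ℝ, ℂ), (∫ ξ, |ξ| ^ N * ‖kern ψ ξ‖ ≤ C * s.sup (schwartzSeminormFamily ℂ ℝ ℂ) ψ) ∧
      ∀ x, (1 + x ^ 2) * ‖ψ x‖ ≤ C * s.sup (schwartzSeminormFamily ℂ ℝ ℂ) ψ := by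
  have hw := schwartz_withSeminorms ℂ ℝ ℂ
  obtain ⟨l, K, hK⟩ : ∃ (l : ℕ) (K : ℝ), ∀ f : 𝓢(ℝ, ℂ), ∫ ξ, |ξ| ^ N * ‖f ξ‖ ≤
      K * (SchwartzMap.seminorm ℂ 0 0 f + SchwartzMap.seminorm ℂ (N + l) 0 f) := by
    refine ⟨(volume : Measure ℝ).integrablePower, 2 ^ (volume : Measure ℝ).integrablePower *
      ∫ x : ℝ, (1 + ‖x‖) ^ (-((volume : Measure ℝ).integrablePower : ℝ)), fun f => ?_⟩
    have := SchwartzMap.integral_pow_mul_iteratedFDeriv_le ℂ (volume : Measure ℝ) f N 0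
    simpa using this
  let p : Seminorm ℂ 𝓢(ℝ, ℂ) := (SchwartzMap.seminorm ℂ 0 0 + SchwartzMap.seminorm ℂ (N + l) 0).comp
    (FourierTransform.fourierInvCLM ℂ 𝓢(ℝ, ℂ)).toLinearMap
  have hp : Continuous p := by
    have h1 : Continuous (SchwartzMap.seminorm ℂ 0 0 : Seminorm ℂ 𝓢(ℝ, ℂ)) :=
      hw.continuous_seminorm (0, 0)
    have h2 : Continuous (SchwartzMap.seminorm ℂ (N + l) 0 : Seminorm ℂ 𝓢(ℝ, ℂ)) :=
      hw.continuous_seminorm (N + l, 0)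
    exact (h1.add h2).comp (FourierTransform.fourierInvCLM ℂ 𝓢(ℝ, ℂ)).continuous
  let q : Seminorm ℂ 𝓢(ℝ, ℂ) := SchwartzMap.seminorm ℂ 0 0 + SchwartzMap.seminorm ℂ 2 0
  have hq : Continuous q := by
    have h1 : Continuous (SchwartzMap.seminorm ℂ 0 0 : Seminorm ℂ 𝓢(ℝ, ℂ)) :=
      hw.continuous_seminorm (0, 0)
    have h2 : Continuous (SchwartzMap.seminorm ℂ 2 0 : Seminorm ℂ 𝓢(ℝ, ℂ)) :=
      hw.continuous_seminorm (2, 0)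
    exact h1.add h2
  have hr : Continuous (⇑(p + q)) := hp.add hq
  obtain ⟨s, C, -, hC⟩ := Seminorm.bound_of_continuous hw (p + q) hr
  refine ⟨s, (max K 0 + 1) * C, by positivity, fun ψ => ?_⟩
  have h0 : p ψ + q ψ ≤ C * s.sup (schwartzSeminormFamily ℂ ℝ ℂ) ψ := hC ψ
  have hp0 := apply_nonneg p ψ
  have hq0 := apply_nonneg q ψ
  have hM : 0 ≤ max K 0 := le_max_right _ _
  constructor
  · calc ∫ ξ, |ξ| ^ N * ‖kern ψ ξ‖ ≤ K * p ψ := hK (kern ψ)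
      _ ≤ max K 0 * p ψ := by gcongr; exact le_max_left _ _
      _ ≤ (max K 0 + 1) * (p ψ + q ψ) := by nlinarith
      _ ≤ (max K 0 + 1) * (C * s.sup (schwartzSeminormFamily ℂ ℝ ℂ) ψ) := by gcongr
      _ = _ := by ring
  · intro x
    have h1 := SchwartzMap.norm_le_seminorm ℂ ψ x
    have h2 := SchwartzMap.norm_pow_mul_le_seminorm ℂ ψ 2 x
    rw [Real.norm_eq_abs, sq_abs] at h2
    have h3 : q ψ = SchwartzMap.seminorm ℂ 0 0 ψ + SchwartzMap.seminorm ℂ 2 0 ψ := rfl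
    calc (1 + x ^ 2) * ‖ψ x‖ ≤ q ψ := by rw [h3]; linarith
      _ ≤ (max K 0 + 1) * (p ψ + q ψ) := by nlinarith
      _ ≤ (max K 0 + 1) * (C * s.sup (schwartzSeminormFamily ℂ ℝ ℂ) ψ) := by gcongr
      _ = _ := by ring

end Choices

/-! ### Young's inequality for nonnegative kernels -/

theorem measurable_lintegral_conv {f b : ℝ → ℝ≥0∞} (hf : Measurable f) (hb : Measurable b)
    (ν : Measure ℝ) [SFinite ν] : Measurable (fun x => ∫⁻ y, b (x - y) * f y ∂ν) := by
  apply Measurable.lintegral_prod_right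
  fun_prop

theorem l2Norm_conv_le {f b : ℝ → ℝ≥0∞} (hf : Measurable f) (hb : Measurable b)
    (ν : Measure ℝ) (hν : ν ≤ volume) [SFinite ν] :
    l2Norm volume (fun x => ∫⁻ y, b (x - y) * f y ∂ν) ≤ (∫⁻ x, b x) * l2Norm ν f := by
  apply le_of_sq_le_sq
  rw [mul_pow, l2Norm_sq, l2Norm_sq]
  calc ∫⁻ x, (∫⁻ y, b (x - y) * f y ∂ν) ^ 2
      ≤ ∫⁻ x, (∫⁻ z, b z) * ∫⁻ y, b (x - y) * f y ^ 2 ∂ν := by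
        refine lintegral_mono fun x => ?_
        refine (lintegral_mul_sq_le_weight ν (by fun_prop) (by fun_prop)).trans ?_
        refine mul_le_mul_left (?_ : ∫⁻ y, b (x - y) ∂ν ≤ ∫⁻ z, b z) _
        refine (lintegral_mono' hν le_rfl).trans ?_
        rw [lintegral_sub_left_eq_self b x]
    _ = (∫⁻ z, b z) * ∫⁻ y, (∫⁻ x, b (x - y) * f y ^ 2) ∂ν := by
        rw [lintegral_const_mul _ (measurable_lintegral_conv (hf.pow_const 2) hb ν)]
        congr 1
        exact lintegral_lintegral_swap (f := fun x y => b (x - y) * f y ^ 2)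
          (by unfold Function.uncurry; fun_prop)
    _ = (∫⁻ x, b x) ^ 2 * ∫⁻ y, f y ^ 2 ∂ν := by
        rw [sq, mul_assoc]
        congr 1
        rw [← lintegral_const_mul _ (hf.pow_const 2)]
        refine lintegral_congr (μ := ν) fun y => ?_
        rw [lintegral_mul_const _ (by fun_prop), lintegral_sub_right_eq_self b y]

/-- Here f serves as the weight in Cauchy-Schwarz, where `l2Norm_conv_le` uses the kernel. This is
the Bernstein step from L¹ to L². -/
theorem l2Norm_conv_le' {f b : ℝ → ℝ≥0∞} (hf : Measurable f) (hb : Measurable b)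
    (ν : Measure ℝ) [SFinite ν] :
    l2Norm volume (fun x => ∫⁻ y, b (x - y) * f y ∂ν) ≤ l2Norm volume b * ∫⁻ y, f y ∂ν := by
  apply le_of_sq_le_sq
  rw [mul_pow, l2Norm_sq, l2Norm_sq]
  calc ∫⁻ x, (∫⁻ y, b (x - y) * f y ∂ν) ^ 2
      ≤ ∫⁻ x, (∫⁻ y, f y ∂ν) * ∫⁻ y, b (x - y) ^ 2 * f y ∂ν := by
        refine lintegral_mono fun x => ?_
        simp only [mul_comm (b _), mul_comm (b _ ^ 2)]
        exact lintegral_mul_sq_le_weight ν (by fun_prop) (by fun_prop)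
    _ = (∫⁻ y, f y ∂ν) * ∫⁻ y, (∫⁻ x, b (x - y) ^ 2 * f y) ∂ν := by
        rw [lintegral_const_mul _ (measurable_lintegral_conv (b := fun x => b x ^ 2) hf
          (hb.pow_const 2) ν)]
        congr 1
        exact lintegral_lintegral_swap (f := fun x y => b (x - y) ^ 2 * f y)
          (by unfold Function.uncurry; fun_prop)
    _ = (∫⁻ x, b x ^ 2) * (∫⁻ y, f y ∂ν) ^ 2 := by
        rw [sq (∫⁻ y, f y ∂ν), ← mul_assoc, mul_comm (∫⁻ x, b x ^ 2), mul_assoc]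
        congr 1
        rw [← lintegral_const_mul _ hf]
        refine lintegral_congr (μ := ν) fun y => ?_
        rw [lintegral_mul_const _ (by fun_prop), lintegral_sub_right_eq_self (fun x => b x ^ 2) y]

/-! ### Decay constants -/

/-- The function `2^l (1 + 2^l|x|)^{-2}` with values in `[0, ∞]`. -/
noncomputable def ebump (l : ℕ) (x : ℝ) : ℝ≥0∞ := ENNReal.ofReal (Choices.bump l x)

theorem bump_continuous (l : ℕ) : Continuous (Choices.bump l) := by
  unfold Choices.bump
  refine Continuous.div (by fun_prop) (by fun_prop) fun x => ?_
  positivity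

theorem ebump_measurable (l : ℕ) : Measurable (ebump l) :=
  ENNReal.measurable_ofReal.comp (bump_continuous l).measurable

theorem lintegral_ebump_lt_top : ∫⁻ x, ebump 0 x < ⊤ := by
  have h := integrable_one_add_norm (E := ℝ) (μ := volume) (r := 2) (by simp)
  have := h.lintegral_lt_top
  refine lt_of_eq_of_lt (lintegral_congr fun x => ?_) this
  unfold ebump Choices.bump
  congr 1
  rw [Real.rpow_neg (by positivity), pow_zero, one_mul, one_div]
  norm_num

theorem lintegral_ebump (l : ℕ) : ∫⁻ x, ebump l x = ∫⁻ x, ebump 0 x := by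
  have h1 : Integrable (Choices.bump 0) := by
    refine ⟨(bump_continuous 0).aestronglyMeasurable, ?_⟩
    rw [hasFiniteIntegral_iff_ofReal (Eventually.of_forall fun x => by
      unfold Choices.bump; simp only [Pi.zero_apply]; positivity)]
    exact lintegral_ebump_lt_top
  have e : Choices.bump l = fun x => 2 ^ l * Choices.bump 0 (2 ^ l * x) := by
    ext x; unfold Choices.bump
    rw [abs_mul, abs_of_pos (by positivity : (0 : ℝ) < 2 ^ l)]
    ring
  have h2 : Integrable (Choices.bump l) := by
    rw [e]; exact (h1.comp_mul_left' (by positivity)).const_mul _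
  have nn : ∀ l, 0 ≤ᵐ[volume] Choices.bump l := fun l => Eventually.of_forall fun x => by
    unfold Choices.bump; simp only [Pi.zero_apply]; positivity
  unfold ebump
  rw [← ofReal_integral_eq_lintegral_ofReal h1 (nn 0),
    ← ofReal_integral_eq_lintegral_ofReal h2 (nn l)]
  congr 1
  rw [e, integral_const_mul, Measure.integral_comp_mul_left (Choices.bump 0) (2 ^ l),
    abs_of_pos (by positivity), smul_eq_mul, ← mul_assoc, mul_inv_cancel₀ (by positivity), one_mul]

/-- The bump is at most 2^l, so its square is at most 2^l times itself. The L² norm O(2^{l/2}) is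
the Bernstein factor. -/
theorem l2Norm_ebump_sq_le (l : ℕ) :
    l2Norm volume (ebump l) ^ 2 ≤ 2 ^ l * ∫⁻ x, ebump 0 x := by
  rw [l2Norm_sq, ← lintegral_ebump l, ← lintegral_const_mul _ (ebump_measurable l)]
  refine lintegral_mono fun x => ?_
  rw [sq]
  gcongr
  unfold ebump Choices.bump
  rw [show (2 : ℝ≥0∞) ^ l = ENNReal.ofReal (2 ^ l) by
    rw [ENNReal.ofReal_pow (by norm_num)]; norm_num]
  apply ENNReal.ofReal_le_ofReal
  apply div_le_self (by positivity)
  have : 0 ≤ 2 ^ l * |x| := by positivity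
  nlinarith

/-- The weight `(1 + |n|)^{-2}`. -/
noncomputable def decay (n : ℤ) : ℝ≥0∞ := ENNReal.ofReal ((1 + |(n : ℝ)|) ^ 2)⁻¹

/-- The sum of the weights `(1 + |n|)^{-2}`. -/
noncomputable def decaySum : ℝ≥0∞ := ∑' n : ℤ, decay n

theorem decaySum_lt_top : decaySum < ⊤ := by
  have h1 : Summable (fun n : ℤ => 1 / (n : ℝ) ^ 2 + if n = 0 then (1 : ℝ) else 0) := by
    refine (Real.summable_one_div_int_pow.2 (by norm_num)).add ?_
    exact summable_of_hasFiniteSupport ((Set.finite_singleton (0 : ℤ)).subset fun n hn => by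
      by_contra h
      simp at h
      simp [h] at hn)
  have h2 : Summable (fun n : ℤ => ((1 + |(n : ℝ)|) ^ 2)⁻¹) := by
    refine Summable.of_nonneg_of_le (fun n => by positivity) (fun n => ?_) h1
    by_cases hn : n = 0
    · simp [hn]
    · simp only [hn, if_false, add_zero, one_div]
      have : 0 < |(n : ℝ)| := by simpa using hn
      rw [← sq_abs (n : ℝ)]
      gcongr
      linarith
  unfold decaySum decay
  rw [← ENNReal.ofReal_tsum_of_nonneg (fun n => by positivity) h2]
  exact ENNReal.ofReal_lt_top

theorem tsum_decay_sub (m : ℤ) : ∑' n, decay (m - n) = decaySum :=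
  (Equiv.subLeft m).tsum_eq decay

theorem tsum_decay_sub' (n : ℤ) : ∑' m, decay (m - n) = decaySum :=
  (Equiv.subRight n).tsum_eq decay

/-! ### Unit intervals -/

namespace Choices

theorem mem_Q_zero (D : Choices) (n : ℤ) (x : ℝ) :
    x ∈ D.Q 0 n ↔ D.off 0 + n ≤ x ∧ x < D.off 0 + n + 1 := by
  simp [Q, interval, add_assoc]

theorem measurableSet_Q (D : Choices) (l : ℕ) (n : ℤ) : MeasurableSet (D.Q l n) :=
  measurableSet_Ico

theorem iUnion_Q_zero (D : Choices) : ⋃ n, D.Q 0 n = univ := by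
  refine eq_univ_of_forall fun x => mem_iUnion.2 ⟨⌊x - D.off 0⌋, ?_⟩
  rw [mem_Q_zero]
  constructor
  · linarith [Int.floor_le (x - D.off 0)]
  · linarith [Int.lt_floor_add_one (x - D.off 0)]

theorem Q_zero_unique (D : Choices) {m n : ℤ} {x : ℝ} (hm : x ∈ D.Q 0 m) (hn : x ∈ D.Q 0 n) :
    m = n := by
  rw [mem_Q_zero] at hm hn
  have h1 : (m : ℝ) < n + 1 := by linarith
  have h2 : (n : ℝ) < m + 1 := by linarith
  have h1' : m < n + 1 := by exact_mod_cast h1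
  have h2' : n < m + 1 := by exact_mod_cast h2
  omega

theorem pairwise_disjoint_Q (D : Choices) : Pairwise (Function.onFun Disjoint (D.Q 0)) :=
  fun _ _ h => Set.disjoint_left.2 fun _ h1 h2 => h (D.Q_zero_unique h1 h2)

theorem lintegral_eq_tsum_Q (D : Choices) (f : ℝ → ℝ≥0∞) :
    ∫⁻ x, f x = ∑' n, ∫⁻ x in D.Q 0 n, f x := by
  rw [← lintegral_iUnion (D.measurableSet_Q 0) D.pairwise_disjoint_Q, D.iUnion_Q_zero,
    Measure.restrict_univ]

theorem abs_sub_ge (D : Choices) {m n : ℤ} {x y : ℝ} (hx : x ∈ D.Q 0 m) (hy : y ∈ D.Q 0 n) :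
    1 + |((m - n : ℤ) : ℝ)| ≤ 2 * (1 + |x - y|) := by
  rw [mem_Q_zero] at hx hy
  have h0 : |((m - n : ℤ) : ℝ)| ≤ |x - y| + 1 := by
    push_cast
    rw [abs_le]
    constructor <;> linarith [le_abs_self (x - y), neg_abs_le (x - y)]
  linarith [abs_nonneg (x - y)]

/-- A kernel that is concentrated at the scale `2^{-l}`. -/
def IsConcentrated (l : ℕ) (C : ℝ) (k : ℝ → ℝ≥0∞) : Prop :=
  Measurable k ∧ ∀ x, k x ≤ ENNReal.ofReal (C * (bump l x * ((1 + |x|) ^ 2)⁻¹))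

/-- Points of the m-th and n-th unit intervals have distance at least |m - n| - 1. The kernel thus
splits into a weight summable over the intervals and a bump at scale 2^{-l}. -/
theorem IsConcentrated.le {l : ℕ} {C : ℝ} (hC : 0 ≤ C) {k : ℝ → ℝ≥0∞} (D : Choices)
    (h : IsConcentrated l C k) {m n : ℤ} {x y : ℝ} (hx : x ∈ D.Q 0 m) (hy : y ∈ D.Q 0 n) :
    k (x - y) ≤ ENNReal.ofReal (4 * C) * decay (m - n) * ebump l (x - y) := by
  refine (h.2 _).trans ?_
  have hb : 0 ≤ bump l (x - y) := by unfold bump; positivity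
  unfold decay ebump
  rw [← ENNReal.ofReal_mul (by positivity), ← ENNReal.ofReal_mul (by positivity)]
  apply ENNReal.ofReal_le_ofReal
  have h1 := D.abs_sub_ge hx hy
  have h2 : ((1 + |x - y|) ^ 2)⁻¹ ≤ 4 * ((1 + |((m - n : ℤ) : ℝ)|) ^ 2)⁻¹ := by
    rw [← div_eq_mul_inv, ← one_div, div_le_div_iff₀ (by positivity) (by positivity)]
    have := abs_nonneg ((m - n : ℤ) : ℝ)
    nlinarith
  calc C * (bump l (x - y) * ((1 + |x - y|) ^ 2)⁻¹)
      ≤ C * (bump l (x - y) * (4 * ((1 + |((m - n : ℤ) : ℝ)|) ^ 2)⁻¹)) := by gcongr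
    _ = _ := by ring

theorem IsConcentrated.lintegral_le {l : ℕ} {C : ℝ} (hC : 0 ≤ C) {k f : ℝ → ℝ≥0∞} (D : Choices)
    (h : IsConcentrated l C k) (hf : Measurable f) {m : ℤ} {x : ℝ} (hx : x ∈ D.Q 0 m) :
    ∫⁻ y, k (x - y) * f y ≤ ∑' n, ENNReal.ofReal (4 * C) * decay (m - n) *
      ∫⁻ y in D.Q 0 n, ebump l (x - y) * f y := by
  rw [D.lintegral_eq_tsum_Q]
  refine ENNReal.tsum_le_tsum fun n => ?_
  have hb := ebump_measurable l
  rw [← lintegral_const_mul _ (by fun_prop)]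
  refine setLIntegral_mono (by fun_prop) fun y hy => ?_
  rw [← mul_assoc]
  gcongr
  exact h.le hC D hx hy

/-! ### Norms on unit intervals and convolution -/

/-- Lebesgue measure on the time interval `[0, 1]`. -/
noncomputable abbrev unitTime : Measure ℝ := volume.restrict (Icc (0 : ℝ) 1)

/-- The `L²` norm on `[0, 1] × Q` for the `n`-th unit interval `Q`. -/
noncomputable def cell2 (D : Choices) (G : ℝ → ℝ → ℝ≥0∞) (n : ℤ) : ℝ≥0∞ :=
  l2Norm unitTime (fun t => l2Norm (volume.restrict (D.Q 0 n)) (G t))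

/-- The `L¹` norm on `[0, 1] × Q` for the `n`-th unit interval `Q`. -/
noncomputable def cell1 (D : Choices) (G : ℝ → ℝ → ℝ≥0∞) (n : ℤ) : ℝ≥0∞ :=
  ∫⁻ t, (∫⁻ x in D.Q 0 n, G t x) ∂unitTime

/-- The `L¹_t L²_x` norm on `[0, 1] × Q` for the `n`-th unit interval `Q`. -/
noncomputable def cell12 (D : Choices) (G : ℝ → ℝ → ℝ≥0∞) (n : ℤ) : ℝ≥0∞ :=
  ∫⁻ t, l2Norm (volume.restrict (D.Q 0 n)) (G t) ∂unitTime

theorem measurable_l2Norm {G : ℝ → ℝ → ℝ≥0∞} (hG : Measurable (Function.uncurry G))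
    (ν : Measure ℝ) [SFinite ν] : Measurable (fun t => l2Norm ν (G t)) := by
  unfold l2Norm
  refine Measurable.pow_const ?_ _
  exact Measurable.lintegral_prod_right' (f := fun p : ℝ × ℝ => G p.1 p.2 ^ 2) (hG.pow_const 2)

theorem measurable_lintegral {G : ℝ → ℝ → ℝ≥0∞} (hG : Measurable (Function.uncurry G))
    (ν : Measure ℝ) [SFinite ν] : Measurable (fun t => ∫⁻ x, G t x ∂ν) :=
  Measurable.lintegral_prod_right' (f := fun p : ℝ × ℝ => G p.1 p.2) hG

/-- Convolution in space with a nonnegative kernel. -/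
noncomputable def conv (k : ℝ → ℝ≥0∞) (F : ℝ → ℝ → ℝ≥0∞) (t x : ℝ) : ℝ≥0∞ :=
  ∫⁻ y, k (x - y) * F t y

theorem measurable_conv {k : ℝ → ℝ≥0∞} (hk : Measurable k) {F : ℝ → ℝ → ℝ≥0∞}
    (hF : Measurable (Function.uncurry F)) : Measurable (Function.uncurry (conv k F)) := by
  unfold conv Function.uncurry
  refine Measurable.lintegral_prod_right'
    (f := fun p : (ℝ × ℝ) × ℝ => k (p.1.2 - p.2) * F p.1.1 p.2) ?_
  refine (hk.comp (by fun_prop)).mul ?_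
  exact hF.comp (f := fun p : (ℝ × ℝ) × ℝ => (p.1.1, p.2)) (by fun_prop)

theorem measurable_slice {F : ℝ → ℝ → ℝ≥0∞} (hF : Measurable (Function.uncurry F)) (t : ℝ) :
    Measurable (F t) := hF.comp measurable_prodMk_left

theorem IsConcentrated.l2Norm_cell_le {l : ℕ} {C : ℝ} (hC : 0 ≤ C) {k f : ℝ → ℝ≥0∞}
    (D : Choices) (h : IsConcentrated l C k) (hf : Measurable f) (m : ℤ) :
    l2Norm (volume.restrict (D.Q 0 m)) (fun x => ∫⁻ y, k (x - y) * f y) ≤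
      ∑' n, ENNReal.ofReal (4 * C) * decay (m - n) *
        l2Norm volume (fun x => ∫⁻ y in D.Q 0 n, ebump l (x - y) * f y) := by
  have hm := fun n => measurable_lintegral_conv hf (ebump_measurable l)
    (volume.restrict (D.Q 0 n))
  refine (l2Norm_mono (g := fun x => ∑' n, ENNReal.ofReal (4 * C) * decay (m - n) *
    ∫⁻ y in D.Q 0 n, ebump l (x - y) * f y) ?_).trans ?_
  · exact (ae_restrict_mem (D.measurableSet_Q 0 m)).mono fun x hx => h.lintegral_le hC D hf hx
  · refine (l2Norm_tsum_le _ fun n => ((hm n).const_mul _).aemeasurable).trans ?_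
    refine ENNReal.tsum_le_tsum fun n => ?_
    rw [l2Norm_const_mul _ _ (hm n).aemeasurable]
    gcongr
    exact l2Norm_mono_measure _ Measure.restrict_le_self

/-- Young's inequality with the L¹ norm of the bump, which does not depend on l: no power of the
frequency is lost. -/
theorem IsConcentrated.cell2_le {l : ℕ} {C : ℝ} (hC : 0 ≤ C) {k : ℝ → ℝ≥0∞}
    {F : ℝ → ℝ → ℝ≥0∞} (D : Choices) (h : IsConcentrated l C k)
    (hF : Measurable (Function.uncurry F)) (m : ℤ) :
    D.cell2 (conv k F) m ≤ ∑' n, ENNReal.ofReal (4 * C) * decay (m - n) *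
      ((∫⁻ x, ebump 0 x) * D.cell2 F n) := by
  have hm := fun n => measurable_l2Norm hF (volume.restrict (D.Q 0 n))
  refine (l2Norm_mono (g := fun t => ∑' n, (ENNReal.ofReal (4 * C) * decay (m - n) *
    (∫⁻ x, ebump 0 x)) * l2Norm (volume.restrict (D.Q 0 n)) (F t)) ?_).trans ?_
  · refine Eventually.of_forall fun t => ?_
    refine (h.l2Norm_cell_le hC D (measurable_slice hF t) m).trans ?_
    refine ENNReal.tsum_le_tsum fun n => ?_
    rw [mul_assoc _ (∫⁻ x, ebump 0 x)]
    gcongr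
    rw [← lintegral_ebump l]
    exact l2Norm_conv_le (measurable_slice hF t) (ebump_measurable l) _ Measure.restrict_le_self
  · refine (l2Norm_tsum_le _ fun n => ((hm n).const_mul _).aemeasurable).trans ?_
    refine ENNReal.tsum_le_tsum fun n => ?_
    rw [l2Norm_const_mul _ _ (hm n).aemeasurable, mul_assoc _ (∫⁻ x, ebump 0 x)]
    rfl

theorem IsConcentrated.tsum_cell2_le {l : ℕ} {C : ℝ} (hC : 0 ≤ C) {k : ℝ → ℝ≥0∞}
    {F : ℝ → ℝ → ℝ≥0∞} (D : Choices) (h : IsConcentrated l C k)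
    (hF : Measurable (Function.uncurry F)) :
    ∑' m, D.cell2 (conv k F) m ≤
      ENNReal.ofReal (4 * C) * decaySum * (∫⁻ x, ebump 0 x) * ∑' n, D.cell2 F n := by
  refine (ENNReal.tsum_le_tsum (h.cell2_le hC D hF)).trans ?_
  rw [ENNReal.tsum_comm]
  simp_rw [ENNReal.tsum_mul_right, ENNReal.tsum_mul_left, tsum_decay_sub']
  rw [ENNReal.tsum_mul_left, ENNReal.tsum_mul_left]
  exact le_of_eq (by ring)

/-- Starting from L¹ in space, Young's inequality uses the L² norm of the bump, at a cost of
2^{l/2}. -/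
theorem IsConcentrated.cell12_le {l : ℕ} {C : ℝ} (hC : 0 ≤ C) {k : ℝ → ℝ≥0∞}
    {F : ℝ → ℝ → ℝ≥0∞} (D : Choices) (h : IsConcentrated l C k)
    (hF : Measurable (Function.uncurry F)) (m : ℤ) :
    D.cell12 (conv k F) m ≤ ∑' n, decay (m - n) *
      (ENNReal.ofReal (4 * C) * l2Norm volume (ebump l) * D.cell1 F n) := by
  have hm := fun n => measurable_lintegral hF (volume.restrict (D.Q 0 n))
  unfold cell12
  refine (lintegral_mono (g := fun t => ∑' n, (decay (m - n) * (ENNReal.ofReal (4 * C) *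
    l2Norm volume (ebump l))) * ∫⁻ x in D.Q 0 n, F t x) fun t => ?_).trans ?_
  · refine (h.l2Norm_cell_le hC D (measurable_slice hF t) m).trans ?_
    refine ENNReal.tsum_le_tsum fun n => ?_
    rw [mul_comm (ENNReal.ofReal _), mul_assoc, mul_assoc, mul_assoc]
    gcongr
    exact l2Norm_conv_le' (measurable_slice hF t) (ebump_measurable l) _
  · rw [lintegral_tsum fun n => ((hm n).const_mul _).aemeasurable]
    refine ENNReal.tsum_le_tsum fun n => ?_
    rw [lintegral_const_mul _ (hm n), mul_assoc]
    rfl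

theorem IsConcentrated.l2Sum_cell12_le {l : ℕ} {C : ℝ} (hC : 0 ≤ C) {k : ℝ → ℝ≥0∞}
    {F : ℝ → ℝ → ℝ≥0∞} (D : Choices) (h : IsConcentrated l C k)
    (hF : Measurable (Function.uncurry F)) :
    l2Sum (D.cell12 (conv k F)) ≤
      ENNReal.ofReal (4 * C) * decaySum * l2Norm volume (ebump l) * l2Sum (D.cell1 F) := by
  refine (l2Sum_mono (h.cell12_le hC D hF)).trans ?_
  apply le_of_sq_le_sq
  refine (schur_test _ _ (fun m => (tsum_decay_sub m).le) fun n => (tsum_decay_sub' n).le).trans ?_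
  rw [l2Sum_const_mul]
  apply le_of_eq
  ring

/-! ### Overlaps between unit intervals and the supports of the partition of unity -/

theorem χ_ne_zero (D : Choices) {l : ℕ} {m : ℤ} {x : ℝ} (h : D.χ l m x ≠ 0) :
    D.off (2 * l) + m * 2 ^ (2 * l) - 1 / 2 < x ∧
      x < D.off (2 * l) + (m + 1) * 2 ^ (2 * l) + 1 / 2 := by
  have := D.χ_supp l m (subset_tsupport _ h)
  obtain ⟨y, hy, hd⟩ := Metric.mem_thickening_iff.1 this
  rw [Real.dist_eq, abs_lt] at hd
  obtain ⟨h1, h2⟩ := hy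
  constructor <;> linarith [hd.1, hd.2]

/-- The support of `χ_Q` for the `m`-th interval of `𝒬_{2l}` meets the `n`-th unit interval. -/
def Touches (D : Choices) (l : ℕ) (m n : ℤ) : Prop := ∃ x ∈ D.Q 0 n, D.χ l m x ≠ 0

open Classical in
/-- The indicator function of `Touches`. -/
noncomputable def touch (D : Choices) (l : ℕ) (m n : ℤ) : ℝ≥0∞ :=
  if D.Touches l m n then 1 else 0

theorem touch_eq_zero {D : Choices} {l : ℕ} {m n : ℤ} {x : ℝ} (h : D.touch l m n = 0)
    (hx : x ∈ D.Q 0 n) : D.χ l m x = 0 := by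
  by_contra hne
  have : D.Touches l m n := ⟨x, hx, hne⟩
  simp [touch, this] at h

theorem touch_eq_zero_or_one (D : Choices) (l : ℕ) (m n : ℤ) :
    D.touch l m n = 0 ∨ D.touch l m n = 1 := by
  unfold touch; split_ifs <;> simp

/-- The support of the cutoff lies in an interval of length 4^l + 1, which meets at most 4^l + 3
unit intervals. This count is the source of every factor 2^l lost between the scales 4^l and 1. -/
theorem tsum_touch_le (D : Choices) (l : ℕ) (m : ℤ) :
    ∑' n, D.touch l m n ≤ 4 * 2 ^ (2 * l) := by
  set L : ℝ := 2 ^ (2 * l)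
  have hL : 1 ≤ L := one_le_pow₀ (by norm_num)
  refine (ENNReal.tsum_le_tsum fun n => ?_).trans ((tsum_indicator_int_le
    (D.off (2 * l) + m * L - 3 / 2 - D.off 0) (L + 2) (by linarith)).trans ?_)
  · unfold touch
    split_ifs with h1 h2 h2
    · exact le_rfl
    · exfalso
      apply h2
      obtain ⟨x, hx, hne⟩ := h1
      rw [mem_Q_zero] at hx
      have := D.χ_ne_zero hne
      constructor
      · linarith [this.1, hx.2]
      · linarith [this.2, hx.1]
    · simp
    · exact le_rfl
  · rw [show (4 * 2 ^ (2 * l) : ℝ≥0∞) = ENNReal.ofReal (4 * L) by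
      rw [ENNReal.ofReal_mul (by norm_num), ENNReal.ofReal_pow (by norm_num)]; norm_num]
    apply ENNReal.ofReal_le_ofReal
    linarith

/-- The intervals have length at least 1 and their supports are enlarged by only 1/2, so the overlap
is bounded independently of l. -/
theorem tsum_touch_le' (D : Choices) (l : ℕ) (n : ℤ) : ∑' m, D.touch l m n ≤ 4 := by
  set L : ℝ := 2 ^ (2 * l)
  have hL : 1 ≤ L := one_le_pow₀ (by norm_num)
  refine (ENNReal.tsum_le_tsum fun m => ?_).trans ((tsum_indicator_int_le
    ((D.off 0 + n - D.off (2 * l) - 1 / 2) / L - 1) 3 (by norm_num)).trans ?_)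
  · unfold touch
    split_ifs with h1 h2 h2
    · exact le_rfl
    · exfalso
      apply h2
      obtain ⟨x, hx, hne⟩ := h1
      rw [mem_Q_zero] at hx
      have := D.χ_ne_zero hne
      constructor
      · rw [sub_lt_iff_lt_add, div_lt_iff₀ (by linarith)]
        linarith [this.2, hx.1]
      · have h3 : (m : ℝ) < (D.off 0 + n - D.off (2 * l) + 3 / 2) / L := by
          rw [lt_div_iff₀ (by linarith)]
          linarith [this.1, hx.2]
        have h4 : (D.off 0 + n - D.off (2 * l) + 3 / 2) / L =
          (D.off 0 + n - D.off (2 * l) - 1 / 2) / L + 2 / L := by ring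
        have h5 : 2 / L ≤ 2 := by rw [div_le_iff₀ (by linarith)]; linarith
        linarith
    · simp
    · exact le_rfl
  · norm_num

theorem tsum_enorm_χ_sq (D : Choices) (l : ℕ) (x : ℝ) :
    ∑' m, ‖(D.χ l m x : ℂ)‖ₑ ^ 2 = 1 := by
  have h := D.χ_sq_sum l x
  have e : ∀ m, ‖(D.χ l m x : ℂ)‖ₑ ^ 2 = ENNReal.ofReal (D.χ l m x ^ 2) := fun m => by
    rw [← ofReal_norm, ← ENNReal.ofReal_pow (norm_nonneg _), Complex.norm_real, Real.norm_eq_abs,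
      sq_abs]
  simp_rw [e]
  rw [← ENNReal.ofReal_tsum_of_nonneg (fun m => sq_nonneg _) h.summable, h.tsum_eq]
  simp

theorem enorm_χ_le (D : Choices) (l : ℕ) (m : ℤ) (x : ℝ) : ‖(D.χ l m x : ℂ)‖ₑ ≤ 1 := by
  apply le_of_sq_le_sq
  rw [one_pow, ← D.tsum_enorm_χ_sq l x]
  exact ENNReal.le_tsum (f := fun m => ‖(D.χ l m x : ℂ)‖ₑ ^ 2) m

theorem χ_measurable (D : Choices) (l : ℕ) (m : ℤ) : Measurable (fun x => (D.χ l m x : ℂ)) :=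
  Complex.measurable_ofReal.comp (D.χ_smooth l m).continuous.measurable

theorem lintegral_sq_eq_tsum_χ (D : Choices) (l : ℕ) (ν : Measure ℝ) {f : ℝ → ℂ}
    (hf : Measurable f) :
    ∫⁻ x, ‖f x‖ₑ ^ 2 ∂ν = ∑' m, ∫⁻ x, ‖f x * (D.χ l m x : ℂ)‖ₑ ^ 2 ∂ν := by
  have hχ := D.χ_measurable l
  rw [← lintegral_tsum fun m => by have := hχ m; fun_prop]
  refine lintegral_congr fun x => ?_
  simp_rw [enorm_mul, mul_pow]
  rw [ENNReal.tsum_mul_left, tsum_enorm_χ_sq, mul_one]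

/-! ### Consequences of the finiteness of the dyadic norms -/

theorem eLpNorm_two_eq {X : Type*} [MeasurableSpace X] (μ : Measure X) (f : X → ℂ) :
    eLpNorm f 2 μ = l2Norm μ (fun x => ‖f x‖ₑ) := by
  rw [eLpNorm_eq_lintegral_rpow_enorm_toReal (by norm_num) (by norm_num)]
  simp [l2Norm]

/-- The dyadic norm `‖g‖_{l²_{2i} X_i}`. -/
noncomputable def dyadicX (D : Choices) (i : ℕ) (g : ℝ → ℝ → ℂ) : ℝ≥0∞ := D.l2Loc i (D.normXj i) g

theorem dyadicX_eq (D : Choices) (i : ℕ) (g : ℝ → ℝ → ℂ) :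
    D.dyadicX i g = l2Sum (fun m => D.normXj i (fun t x => g t x * (D.χ i m x : ℂ))) := rfl

/-- The `L^∞_t L²_x` norm of `g` multiplied by the `m`-th cutoff. -/
noncomputable def energy (D : Choices) (i : ℕ) (g : ℝ → ℝ → ℂ) (m : ℤ) : ℝ≥0∞ :=
  normLinfL2 (fun t x => g t x * (D.χ i m x : ℂ))

theorem l2Sum_energy_le (D : Choices) (i : ℕ) (g : ℝ → ℝ → ℂ) :
    l2Sum (D.energy i g) ≤ D.dyadicX i g := by
  rw [dyadicX_eq]
  exact l2Sum_mono fun m => self_le_add_left _ _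

theorem ae_le_energy (D : Choices) (i : ℕ) (g : ℝ → ℝ → ℂ) :
    ∀ᵐ t ∂unitTime, ∀ m, l2Norm volume (fun x => ‖g t x * (D.χ i m x : ℂ)‖ₑ) ≤
      D.energy i g m := by
  rw [ae_all_iff]
  intro m
  filter_upwards [ENNReal.ae_le_essSup (μ := unitTime)
    (fun t => eLpNorm (fun x => g t x * (D.χ i m x : ℂ)) 2 volume)] with t ht
  rw [← eLpNorm_two_eq]
  exact ht

theorem ae_l2Norm_le (D : Choices) (i : ℕ) {g : ℝ → ℝ → ℂ} (hg : ∀ t, Measurable (g t)) :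
    ∀ᵐ t ∂unitTime, l2Norm volume (fun x => ‖g t x‖ₑ) ≤ D.dyadicX i g := by
  filter_upwards [D.ae_le_energy i g] with t ht
  refine le_trans ?_ (D.l2Sum_energy_le i g)
  apply le_of_sq_le_sq
  rw [l2Norm_sq, l2Sum_sq, D.lintegral_sq_eq_tsum_χ i volume (hg t)]
  refine ENNReal.tsum_le_tsum fun m => ?_
  rw [← l2Norm_sq]
  gcongr
  exact ht m

/-- The sum of the local energies near the `n`-th unit interval. -/
noncomputable def cellEnergy (D : Choices) (i : ℕ) (g : ℝ → ℝ → ℂ) (n : ℤ) : ℝ≥0∞ :=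
  l2Sum (fun m => D.touch i m n * D.energy i g m)

/-- The squares of the cutoffs sum to 1, and only cutoffs touching the unit interval contribute.
Each is bounded by its whole energy, which is wasteful but independent of time. -/
theorem ae_l2Norm_cell_le (D : Choices) (i : ℕ) {g : ℝ → ℝ → ℂ} (hg : ∀ t, Measurable (g t)) :
    ∀ᵐ t ∂unitTime, ∀ n, l2Norm (volume.restrict (D.Q 0 n)) (fun x => ‖g t x‖ₑ) ≤
      D.cellEnergy i g n := by
  filter_upwards [D.ae_le_energy i g] with t ht n
  apply le_of_sq_le_sq
  rw [l2Norm_sq, cellEnergy, l2Sum_sq, D.lintegral_sq_eq_tsum_χ i _ (hg t)]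
  refine ENNReal.tsum_le_tsum fun m => ?_
  rcases D.touch_eq_zero_or_one i m n with h | h
  · rw [setLIntegral_congr_fun (g := fun _ => 0) (D.measurableSet_Q 0 n) fun x hx => by
      simp [touch_eq_zero h hx]]
    simp
  · rw [h, one_mul]
    refine le_trans (lintegral_mono' Measure.restrict_le_self le_rfl) ?_
    rw [← l2Norm_sq]
    gcongr
    exact ht m

/-- Each local energy is counted once per unit interval that it touches, at most 4·4^i times. -/
theorem l2Sum_cellEnergy_sq_le (D : Choices) (i : ℕ) (g : ℝ → ℝ → ℂ) :
    l2Sum (D.cellEnergy i g) ^ 2 ≤ 4 * 2 ^ (2 * i) * D.dyadicX i g ^ 2 := by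
  rw [l2Sum_sq]
  simp_rw [cellEnergy, l2Sum_sq]
  rw [ENNReal.tsum_comm]
  calc ∑' m, ∑' n, (D.touch i m n * D.energy i g m) ^ 2
      = ∑' m, (∑' n, D.touch i m n) * D.energy i g m ^ 2 := by
        refine tsum_congr fun m => ?_
        rw [← ENNReal.tsum_mul_right]
        refine tsum_congr fun n => ?_
        rcases D.touch_eq_zero_or_one i m n with h | h <;> simp [h]
    _ ≤ ∑' m, 4 * 2 ^ (2 * i) * D.energy i g m ^ 2 := by
        gcongr with m
        exact D.tsum_touch_le i m
    _ = 4 * 2 ^ (2 * i) * l2Sum (D.energy i g) ^ 2 := by rw [ENNReal.tsum_mul_left, l2Sum_sq]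
    _ ≤ _ := by gcongr; exact D.l2Sum_energy_le i g

theorem cell2_enorm_eq (D : Choices) {f : ℝ → ℝ → ℂ} (hf : Measurable (Function.uncurry f))
    (n : ℤ) : D.cell2 (fun t x => ‖f t x‖ₑ) n = eLpNorm (Function.uncurry f) 2
      ((volume : Measure (ℝ × ℝ)).restrict (Icc 0 1 ×ˢ D.Q 0 n)) := by
  rw [eLpNorm_two_eq, Measure.volume_eq_prod, ← Measure.prod_restrict]
  unfold cell2 l2Norm
  rw [lintegral_prod _ (by fun_prop)]
  simp_rw [rpow_half_sq]
  rfl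

/-- The norm `sup_Q ‖g‖_{L²([0,1] × Q)}` over the unit intervals is controlled by the dyadic
norm, with a gain of a derivative. -/
theorem cell2_le_dyadicX (D : Choices) (i : ℕ) {g : ℝ → ℝ → ℂ}
    (hg : Measurable (Function.uncurry g)) (n : ℤ) :
    2 ^ i * D.cell2 (fun t x => ‖g t x‖ₑ) n ≤ D.dyadicX i g := by
  have hgt : ∀ t, Measurable (g t) := fun t => hg.comp measurable_prodMk_left
  have hgχ : ∀ m, Measurable (Function.uncurry fun t x => g t x * (D.χ i m x : ℂ)) := fun m =>
    hg.mul ((D.χ_measurable i m).comp measurable_snd)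
  have hX : ∀ f : ℝ → ℝ → ℂ, Measurable (Function.uncurry f) →
      D.cell2 (fun t x => ‖f t x‖ₑ) n ≤ D.normX f := by
    intro f hf
    -- The unit interval is the competitor l = 0 in the supremum, where the weight is 1.
    refine le_trans (le_of_eq ?_) (le_iSup₂_of_le 0 n le_rfl)
    rw [D.cell2_enorm_eq hf]
    simp
  apply le_of_sq_le_sq
  rw [dyadicX_eq, l2Sum_sq, mul_pow]
  have e : D.cell2 (fun t x => ‖g t x‖ₑ) n ^ 2 =
      ∑' m, D.cell2 (fun t x => ‖g t x * (D.χ i m x : ℂ)‖ₑ) n ^ 2 := by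
    unfold cell2
    simp_rw [l2Norm_sq]
    rw [← lintegral_tsum fun m => ?_]
    · exact lintegral_congr fun t => D.lintegral_sq_eq_tsum_χ i _ (hgt t)
    · exact (measurable_lintegral (G := fun t x => ‖g t x * (D.χ i m x : ℂ)‖ₑ ^ 2)
        ((hgχ m).enorm.pow_const 2) _).aemeasurable
  rw [e, ← ENNReal.tsum_mul_left]
  refine ENNReal.tsum_le_tsum fun m => ?_
  rw [← mul_pow]
  gcongr
  refine le_trans ?_ (self_le_add_right _ _)
  gcongr
  exact hX _ (hgχ m)

/-- Bernstein's inequality on unit intervals: `U` bounds the function on the unit intervals. -/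
structure IsCellBound (D : Choices) (g : ℝ → ℝ → ℂ) (U : ℤ → ℝ≥0∞) : Prop where
  bound : ∀ᵐ t ∂unitTime, ∀ n, ∀ x ∈ D.Q 0 n, ‖g t x‖ₑ ≤ U n

/-- Cauchy-Schwarz in the reproducing formula, one unit interval at a time: the squared L² norm of
the kernel gives 2^i, the squared cell energies give 2^{2i}, and Schur's test sums the decay between
the intervals. The bound U does not depend on time, so the supremum in t is taken before the sum
over the intervals. -/
theorem exists_cellBound (D : Choices) : ∃ C : ℝ≥0∞, C < ⊤ ∧ ∀ i (g : ℝ → ℝ → ℂ),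
    (∀ t, Continuous (g t)) →
    (∀ t x, g t x = ∫ y, kern (D.wideSymbol i) (x - y) * g t y) →
    ∃ U, D.IsCellBound g U ∧ l2Sum U ^ 2 ≤ C * 2 ^ (3 * i) * D.dyadicX i g ^ 2 := by
  obtain ⟨C, hC0, hC⟩ := D.kern_symbol_le
  set A : ℝ≥0∞ := ENNReal.ofReal (4 * C)
  set B : ℝ≥0∞ := ∫⁻ x, ebump 0 x
  refine ⟨(A * decaySum) ^ 2 * B * 4, ?_, fun i g hg he => ?_⟩
  · have := decaySum_lt_top
    have := lintegral_ebump_lt_top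
    have hA : A < ⊤ := ENNReal.ofReal_lt_top
    refine ENNReal.mul_lt_top (ENNReal.mul_lt_top (ENNReal.pow_lt_top ?_) this) (by norm_num)
    exact ENNReal.mul_lt_top hA decaySum_lt_top
  have hgm : ∀ t, Measurable (g t) := fun t => (hg t).measurable
  refine ⟨fun m => ∑' n, decay (m - n) * (A * l2Norm volume (ebump i) * D.cellEnergy i g n),
    ⟨?_⟩, ?_⟩
  · filter_upwards [D.ae_l2Norm_cell_le i hgm] with t ht m x hx
    have hk : IsConcentrated i C (fun x => ‖kern (D.wideSymbol i) x‖ₑ) := by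
      refine ⟨(kern (D.wideSymbol i)).continuous.measurable.enorm, fun x => ?_⟩
      simp only [← ofReal_norm]
      exact ENNReal.ofReal_le_ofReal (hC i x).2
    calc ‖g t x‖ₑ ≤ ∫⁻ y, ‖kern (D.wideSymbol i) (x - y)‖ₑ * ‖g t y‖ₑ := by
          conv_lhs => rw [he t x]
          refine (enorm_integral_le_lintegral_enorm _).trans ?_
          simp only [enorm_mul]
          exact le_rfl
      _ ≤ ∑' n, A * decay (m - n) * ∫⁻ y in D.Q 0 n, ebump i (x - y) * ‖g t y‖ₑ :=
          hk.lintegral_le hC0 D (hgm t).enorm hx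
      _ ≤ _ := by
          refine ENNReal.tsum_le_tsum fun n => ?_
          rw [mul_comm A, mul_assoc, mul_assoc]
          gcongr
          have hb : Measurable (fun y => ebump i (x - y)) :=
            (ebump_measurable i).comp (by fun_prop)
          refine (lintegral_mul_le_l2Norm _ hb.aemeasurable (hgm t).enorm.aemeasurable).trans ?_
          gcongr
          · refine (l2Norm_mono_measure _ Measure.restrict_le_self).trans ?_
            rw [l2Norm_comp_sub_left]
          · exact ht n
  · refine (schur_test _ _ (fun m => (tsum_decay_sub m).le)
      fun n => (tsum_decay_sub' n).le).trans ?_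
    rw [l2Sum_const_mul, mul_pow, mul_pow]
    calc decaySum * decaySum *
          (A ^ 2 * l2Norm volume (ebump i) ^ 2 * l2Sum (D.cellEnergy i g) ^ 2)
        ≤ decaySum * decaySum * (A ^ 2 * (2 ^ i * B) *
          (4 * 2 ^ (2 * i) * D.dyadicX i g ^ 2)) := by
          gcongr
          · exact l2Norm_ebump_sq_le i
          · exact D.l2Sum_cellEnergy_sq_le i g
      _ = _ := by
          rw [show 3 * i = i + 2 * i by ring, pow_add]; ring

/-! ### Products of three functions on unit intervals -/

/-- The modulus of a triple product. -/
noncomputable def triple (u v w : ℝ → ℝ → ℂ) (t x : ℝ) : ℝ≥0∞ := ‖u t x‖ₑ * ‖v t x‖ₑ * ‖w t x‖ₑ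

theorem measurable_triple {u v w : ℝ → ℝ → ℂ} (hu : Measurable (Function.uncurry u))
    (hv : Measurable (Function.uncurry v)) (hw : Measurable (Function.uncurry w)) :
    Measurable (Function.uncurry (triple u v w)) :=
  (hu.enorm.mul hv.enorm).mul hw.enorm

theorem cell2_triple_le {D : Choices} {u v w : ℝ → ℝ → ℂ} {U V : ℤ → ℝ≥0∞}
    (hu : D.IsCellBound u U) (hv : D.IsCellBound v V) (hw : Measurable (Function.uncurry w))
    (n : ℤ) : D.cell2 (triple u v w) n ≤ U n * V n * D.cell2 (fun t x => ‖w t x‖ₑ) n := by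
  have hw' := measurable_l2Norm (G := fun t x => ‖w t x‖ₑ) hw.enorm (volume.restrict (D.Q 0 n))
  unfold cell2
  rw [← l2Norm_const_mul _ _ hw'.aemeasurable]
  refine l2Norm_mono ?_
  filter_upwards [hu.bound, hv.bound] with t h1 h2
  rw [← l2Norm_const_mul _ _
    (measurable_slice (F := fun t x => ‖w t x‖ₑ) hw.enorm t).aemeasurable]
  refine l2Norm_mono ((ae_restrict_mem (D.measurableSet_Q 0 n)).mono fun x hx => ?_)
  unfold triple
  gcongr
  · exact h1 n x hx
  · exact h2 n x hx

/-- Hölder with ℓ², ℓ² and ℓ^∞ in the unit intervals. Two square summable suprema give the absolute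
sum that Y requires. -/
theorem tsum_cell2_triple_le {D : Choices} {u v w : ℝ → ℝ → ℂ} {U V : ℤ → ℝ≥0∞} {W : ℝ≥0∞}
    (hu : D.IsCellBound u U) (hv : D.IsCellBound v V) (hw : Measurable (Function.uncurry w))
    (hW : ∀ n, D.cell2 (fun t x => ‖w t x‖ₑ) n ≤ W) :
    ∑' n, D.cell2 (triple u v w) n ≤ l2Sum U * l2Sum V * W := by
  calc ∑' n, D.cell2 (triple u v w) n ≤ ∑' n, U n * V n * W :=
        ENNReal.tsum_le_tsum fun n => (cell2_triple_le hu hv hw n).trans (by gcongr; exact hW n)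
    _ ≤ _ := by
        rw [ENNReal.tsum_mul_right]
        gcongr
        exact tsum_mul_le_l2Sum U V

theorem cell1_triple_le {D : Choices} {u v w : ℝ → ℝ → ℂ} {U : ℤ → ℝ≥0∞}
    (hu : D.IsCellBound u U) (hv : Measurable (Function.uncurry v))
    (hw : Measurable (Function.uncurry w)) (n : ℤ) :
    D.cell1 (triple u v w) n ≤
      U n * (D.cell2 (fun t x => ‖v t x‖ₑ) n * D.cell2 (fun t x => ‖w t x‖ₑ) n) := by
  have hv' := measurable_l2Norm (G := fun t x => ‖v t x‖ₑ) hv.enorm (volume.restrict (D.Q 0 n))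
  have hw' := measurable_l2Norm (G := fun t x => ‖w t x‖ₑ) hw.enorm (volume.restrict (D.Q 0 n))
  calc D.cell1 (triple u v w) n
      ≤ ∫⁻ t, U n * (l2Norm (volume.restrict (D.Q 0 n)) (fun x => ‖v t x‖ₑ) *
          l2Norm (volume.restrict (D.Q 0 n)) (fun x => ‖w t x‖ₑ)) ∂unitTime := by
        refine lintegral_mono_ae ?_
        filter_upwards [hu.bound] with t h1
        have m1 := measurable_slice (F := fun t x => ‖v t x‖ₑ) hv.enorm t
        have m2 := measurable_slice (F := fun t x => ‖w t x‖ₑ) hw.enorm t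
        calc ∫⁻ x in D.Q 0 n, triple u v w t x
            ≤ ∫⁻ x in D.Q 0 n, U n * (‖v t x‖ₑ * ‖w t x‖ₑ) := by
              refine setLIntegral_mono' (D.measurableSet_Q 0 n) fun x hx => ?_
              unfold triple
              rw [mul_assoc]
              gcongr
              exact h1 n x hx
          _ = U n * ∫⁻ x in D.Q 0 n, ‖v t x‖ₑ * ‖w t x‖ₑ := lintegral_const_mul _ (m1.mul m2)
          _ ≤ _ := by
              gcongr
              exact lintegral_mul_le_l2Norm _ m1.aemeasurable m2.aemeasurable
    _ = U n * ∫⁻ t, l2Norm (volume.restrict (D.Q 0 n)) (fun x => ‖v t x‖ₑ) *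
          l2Norm (volume.restrict (D.Q 0 n)) (fun x => ‖w t x‖ₑ) ∂unitTime :=
        lintegral_const_mul _ (hv'.mul hw')
    _ ≤ _ := by
        gcongr
        exact lintegral_mul_le_l2Norm _ hv'.aemeasurable hw'.aemeasurable

/-- Hölder with ℓ², ℓ^∞ and ℓ^∞ in the unit intervals. Only one supremum is spent, and both L²
factors gain a derivative. -/
theorem l2Sum_cell1_triple_le {D : Choices} {u v w : ℝ → ℝ → ℂ} {U : ℤ → ℝ≥0∞} {V W : ℝ≥0∞}
    (hu : D.IsCellBound u U) (hv : Measurable (Function.uncurry v))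
    (hw : Measurable (Function.uncurry w)) (hV : ∀ n, D.cell2 (fun t x => ‖v t x‖ₑ) n ≤ V)
    (hW : ∀ n, D.cell2 (fun t x => ‖w t x‖ₑ) n ≤ W) :
    l2Sum (D.cell1 (triple u v w)) ≤ l2Sum U * V * W := by
  calc l2Sum (D.cell1 (triple u v w)) ≤ l2Sum (fun n => (V * W) * U n) := by
        refine l2Sum_mono fun n => (cell1_triple_le hu hv hw n).trans ?_
        rw [mul_comm]
        gcongr
        · exact hV n
        · exact hW n
    _ = _ := by rw [l2Sum_const_mul]; ring

theorem cell1_le_cell2 (D : Choices) {F : ℝ → ℝ → ℝ≥0∞} (hF : Measurable (Function.uncurry F))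
    (n : ℤ) : D.cell1 F n ≤ D.cell2 F n := by
  have h1 : ∀ (f : ℝ → ℝ≥0∞) (ν : Measure ℝ), ν univ = 1 → Measurable f →
      ∫⁻ x, f x ∂ν ≤ l2Norm ν f := by
    intro f ν hν hf
    have := lintegral_mul_le_l2Norm ν hf.aemeasurable (aemeasurable_const (b := (1 : ℝ≥0∞)))
    simpa [l2Norm, hν] using this
  unfold cell1 cell2
  refine le_trans (lintegral_mono fun t => h1 _ _ ?_ (measurable_slice hF t)) (h1 _ _ ?_ ?_)
  · simp [Q, interval, ← sub_sub]
  · simp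
  · exact measurable_l2Norm hF _

/-! ### Upper bounds for the norm of `Y_l` -/

/-- The restrictions of f to unit intervals, divided by their L² norms, are atoms with l = 0, and
the norms are the coefficients. -/
theorem normY_le (D : Choices) {f : ℝ → ℝ → ℂ} (hf : Measurable (Function.uncurry f)) :
    D.normY f ≤ ∑' n, D.cell2 (fun t x => ‖f t x‖ₑ) n := by
  set b : ℤ → ℝ≥0∞ := D.cell2 (fun t x => ‖f t x‖ₑ)
  by_cases htop : ∑' n, b n = ⊤
  · rw [htop]; exact le_top
  have hb : ∀ n, b n ≠ ⊤ := fun n => ENNReal.ne_top_of_tsum_ne_top htop n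
  let e : ℕ ≃ ℤ := (Denumerable.eqv ℤ).symm
  let c : ℕ → ℂ := fun k => ((b (e k)).toReal : ℂ)
  have hc : ∀ k, ‖c k‖ₑ = b (e k) := fun k => by
    rw [← ofReal_norm, Complex.norm_real, Real.norm_of_nonneg ENNReal.toReal_nonneg,
      ENNReal.ofReal_toReal (hb _)]
  let s : ℕ → Set (ℝ × ℝ) := fun k => Icc 0 1 ×ˢ D.Q 0 (e k)
  have hs : ∀ k, MeasurableSet (s k) := fun k => measurableSet_Icc.prod (D.measurableSet_Q 0 _)
  let a : ℕ → ℝ → ℝ → ℂ := fun k t x =>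
    (s k).indicator (fun z => (c k)⁻¹ • Function.uncurry f z) (t, x)
  have ha : ∀ k, Function.uncurry (a k) =
      (s k).indicator ((c k)⁻¹ • Function.uncurry f) := fun k => rfl
  have hatom : ∀ k, D.IsAtom (a k) := fun k => by
    refine ⟨?_, 0, e k, fun t x h => indicator_of_notMem h _, ?_⟩
    · rw [ha]
      exact ((hf.const_smul _).indicator (hs k)).aestronglyMeasurable
    · rw [ha, eLpNorm_indicator_eq_eLpNorm_restrict (hs k), eLpNorm_const_smul,
        ← D.cell2_enorm_eq hf]
      simp only [CharP.cast_eq_zero, neg_zero, zero_div, ENNReal.rpow_zero]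
      change ‖(c k)⁻¹‖ₑ * b (e k) ≤ 1
      by_cases h0 : c k = 0
      · simp [h0]
      · rw [enorm_inv h0, hc]
        exact ENNReal.inv_mul_le_one _
  -- For a zero coefficient the inverse is 0 and so is the atom. The expansion stays correct because
  -- f then vanishes almost everywhere on that interval.
  have hzero : ∀ k, ∀ᵐ z ∂((volume : Measure (ℝ × ℝ)).restrict (Icc 0 1 ×ˢ univ)),
      c k = 0 → z.2 ∈ D.Q 0 (e k) → f z.1 z.2 = 0 := fun k => by
    by_cases h0 : c k = 0
    · have h1 : b (e k) = 0 := by rw [← hc, h0, enorm_zero]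
      have h2 := D.cell2_enorm_eq hf (e k)
      rw [show D.cell2 (fun t x => ‖f t x‖ₑ) (e k) = 0 from h1] at h2
      have h3 := (eLpNorm_eq_zero_iff hf.aestronglyMeasurable (by norm_num)).1 h2.symm
      rw [Filter.EventuallyEq, ae_restrict_iff' (hs k)] at h3
      rw [ae_restrict_iff' (measurableSet_Icc.prod MeasurableSet.univ)]
      filter_upwards [h3] with z hz hzI _ hzQ
      exact hz ⟨hzI.1, hzQ⟩
    · exact Eventually.of_forall fun z h => absurd h h0
  have hsum : ∀ᵐ z ∂((volume : Measure (ℝ × ℝ)).restrict (Icc 0 1 ×ˢ univ)),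
      HasSum (fun k => c k * a k z.1 z.2) (f z.1 z.2) := by
    filter_upwards [ae_all_iff.2 hzero,
      ae_restrict_mem (measurableSet_Icc.prod MeasurableSet.univ)] with z hz hzI
    obtain ⟨n, hn⟩ := mem_iUnion.1 (D.iUnion_Q_zero ▸ mem_univ z.2 : z.2 ∈ ⋃ n, D.Q 0 n)
    have hk : z.2 ∈ D.Q 0 (e (e.symm n)) := by simpa using hn
    have hval : c (e.symm n) * a (e.symm n) z.1 z.2 = f z.1 z.2 := by
      have hmem : (z.1, z.2) ∈ s (e.symm n) := ⟨hzI.1, hk⟩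
      simp only [a, indicator_of_mem hmem, smul_eq_mul, Function.uncurry]
      by_cases h0 : c (e.symm n) = 0
      · rw [hz _ h0 hk]; simp
      · rw [← mul_assoc, mul_inv_cancel₀ h0, one_mul]
    rw [← hval]
    refine hasSum_single _ fun k hne => ?_
    have hnot : (z.1, z.2) ∉ s k := fun hmem => hne (by
      rw [← D.Q_zero_unique hmem.2 hn, Equiv.symm_apply_apply])
    simp only [a, indicator_of_notMem hnot, mul_zero]
  refine iInf_le_of_le c (iInf_le_of_le a (iInf_le_of_le hatom (iInf_le_of_le hsum ?_)))
  simp_rw [hc]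
  exact le_of_eq (e.tsum_eq b)

theorem l2Norm_le_tsum_Q (D : Choices) (f : ℝ → ℝ≥0∞) :
    l2Norm volume f ≤ ∑' n, l2Norm (volume.restrict (D.Q 0 n)) f := by
  refine le_trans (le_of_eq ?_) (l2Sum_le_tsum _)
  unfold l2Sum
  simp_rw [l2Norm_sq]
  rw [← D.lintegral_eq_tsum_Q]
  rfl

theorem l2Norm_mul_χ_le (D : Choices) (l : ℕ) (m n : ℤ) (f : ℝ → ℂ) :
    l2Norm (volume.restrict (D.Q 0 n)) (fun x => ‖f x * (D.χ l m x : ℂ)‖ₑ) ≤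
      D.touch l m n * l2Norm (volume.restrict (D.Q 0 n)) (fun x => ‖f x‖ₑ) := by
  rcases D.touch_eq_zero_or_one l m n with h | h
  · rw [h, zero_mul]
    apply le_of_sq_le_sq
    rw [l2Norm_sq, setLIntegral_congr_fun (g := fun _ => 0) (D.measurableSet_Q 0 n) fun x hx => by
      simp [touch_eq_zero h hx]]
    simp
  · rw [h, one_mul]
    refine l2Norm_mono (Eventually.of_forall fun x => ?_)
    rw [enorm_mul]
    exact mul_le_of_le_one_right' (D.enorm_χ_le l m x)

theorem normY_mul_χ_le (D : Choices) (l : ℕ) (m : ℤ) {g : ℝ → ℝ → ℂ} {G : ℝ → ℝ → ℝ≥0∞}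
    (hg : Measurable (Function.uncurry g)) (hG : Measurable (Function.uncurry G))
    (h : ∀ t x, ‖g t x‖ₑ ≤ 2 * G t x) :
    D.normY (fun t x => g t x * (D.χ l m x : ℂ)) ≤ ∑' n, D.touch l m n * (2 * D.cell2 G n) := by
  have hgχ : Measurable (Function.uncurry fun t x => g t x * (D.χ l m x : ℂ)) :=
    hg.mul ((D.χ_measurable l m).comp measurable_snd)
  refine (D.normY_le hgχ).trans ?_
  refine ENNReal.tsum_le_tsum fun n => ?_
  have hm := measurable_l2Norm hG (volume.restrict (D.Q 0 n))
  unfold cell2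
  rw [← mul_assoc, ← l2Norm_const_mul _ _ hm.aemeasurable]
  refine l2Norm_mono (Eventually.of_forall fun t => ?_)
  refine (D.l2Norm_mul_χ_le l m n (g t)).trans ?_
  rw [mul_assoc]
  gcongr
  rw [← l2Norm_const_mul _ _ (measurable_slice hG t).aemeasurable]
  exact l2Norm_mono (Eventually.of_forall fun x => h t x)

theorem normL1L2_mul_χ_le (D : Choices) (l : ℕ) (m : ℤ) {g : ℝ → ℝ → ℂ} {G : ℝ → ℝ → ℝ≥0∞}
    (hG : Measurable (Function.uncurry G)) (h : ∀ t x, ‖g t x‖ₑ ≤ 2 * G t x) :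
    normL1L2 (fun t x => g t x * (D.χ l m x : ℂ)) ≤
      ∑' n, D.touch l m n * (2 * D.cell12 G n) := by
  have hm := fun n => measurable_l2Norm hG (volume.restrict (D.Q 0 n))
  unfold normL1L2 cell12
  calc ∫⁻ t in Icc (0 : ℝ) 1, eLpNorm (fun x => g t x * (D.χ l m x : ℂ)) 2 volume
      ≤ ∫⁻ t, ∑' n, D.touch l m n * (2 * l2Norm (volume.restrict (D.Q 0 n)) (G t)) ∂unitTime := by
        refine lintegral_mono fun t => ?_
        rw [eLpNorm_two_eq]
        refine (D.l2Norm_le_tsum_Q _).trans (ENNReal.tsum_le_tsum fun n => ?_)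
        refine (D.l2Norm_mul_χ_le l m n (g t)).trans ?_
        gcongr
        rw [← l2Norm_const_mul _ _ (measurable_slice hG t).aemeasurable]
        exact l2Norm_mono (Eventually.of_forall fun x => h t x)
    _ = _ := by
        rw [lintegral_tsum fun n => (((hm n).const_mul _).const_mul _).aemeasurable]
        refine tsum_congr fun n => ?_
        rw [lintegral_const_mul _ ((hm n).const_mul _), lintegral_const_mul _ (hm n)]

/-- A function that is dominated by `G₁ + G₂` is estimated in `l²_{2l} Y_l` by a sum of local `L²`
norms of `G₁` and a square sum of local `L¹_t L²_x` norms of `G₂`. -/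
theorem l2Loc_normYj_le (D : Choices) (l : ℕ) {g : ℝ → ℝ → ℂ} {G₁ G₂ : ℝ → ℝ → ℝ≥0∞}
    (hg : Measurable (Function.uncurry g)) (hG₁ : Measurable (Function.uncurry G₁))
    (hG₂ : Measurable (Function.uncurry G₂)) (h : ∀ t x, ‖g t x‖ₑ ≤ G₁ t x + G₂ t x) :
    D.l2Loc l (D.normYj l) g ≤
      8 * (((2 : ℝ≥0∞) ^ l)⁻¹ * ∑' n, D.cell2 G₁ n) + 8 * (2 ^ l * l2Sum (D.cell12 G₂)) := by
  -- Only |g| ≤ G₁ + G₂ is known. Cutting space-time according to which majorant is larger gives a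
  -- measurable splitting with |g₁| ≤ 2G₁ and |g₂| ≤ 2G₂.
  let S : Set (ℝ × ℝ) := {z | Function.uncurry G₂ z ≤ Function.uncurry G₁ z}
  have hS : MeasurableSet S := measurableSet_le hG₂ hG₁
  let g₁ : ℝ → ℝ → ℂ := fun t x => S.indicator (Function.uncurry g) (t, x)
  let g₂ : ℝ → ℝ → ℂ := fun t x => Sᶜ.indicator (Function.uncurry g) (t, x)
  have hg₁ : Measurable (Function.uncurry g₁) := hg.indicator hS
  have hg₂ : Measurable (Function.uncurry g₂) := hg.indicator hS.compl
  have hadd : ∀ t x, g t x = g₁ t x + g₂ t x := fun t x =>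
    (indicator_self_add_compl_apply S (Function.uncurry g) (t, x)).symm
  have b₁ : ∀ t x, ‖g₁ t x‖ₑ ≤ 2 * G₁ t x := fun t x => by
    by_cases hz : (t, x) ∈ S
    · simp only [g₁, indicator_of_mem hz]
      refine (h t x).trans ?_
      rw [two_mul]
      gcongr
      exact hz
    · simp [g₁, indicator_of_notMem hz]
  have b₂ : ∀ t x, ‖g₂ t x‖ₑ ≤ 2 * G₂ t x := fun t x => by
    by_cases hz : (t, x) ∈ S
    · simp [g₂, hz]
    · have hz' : (t, x) ∈ Sᶜ := hz
      simp only [g₂, indicator_of_mem hz']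
      refine (h t x).trans ?_
      rw [two_mul]
      gcongr
      exact (not_le.1 hz).le
  have hY : ∀ m, D.normYj l (fun t x => g t x * (D.χ l m x : ℂ)) ≤
      ((2 : ℝ≥0∞) ^ l)⁻¹ * (∑' n, D.touch l m n * (2 * D.cell2 G₁ n)) +
        ∑' n, D.touch l m n * (2 * D.cell12 G₂ n) := fun m => by
    have hχ : Measurable (fun z : ℝ × ℝ => (D.χ l m z.2 : ℂ)) :=
      (D.χ_measurable l m).comp measurable_snd
    refine iInf_le_of_le (fun t x => g₁ t x * (D.χ l m x : ℂ))
      (iInf_le_of_le (fun t x => g₂ t x * (D.χ l m x : ℂ))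
        (iInf_le_of_le (hg₂.mul hχ).aestronglyMeasurable (iInf_le_of_le ?_ ?_)))
    · exact Eventually.of_forall fun z => by beta_reduce; rw [hadd, add_mul]
    · gcongr
      · exact D.normY_mul_χ_le l m hg₁ hG₁ b₁
      · exact D.normL1L2_mul_χ_le l m hG₂ b₂
  refine (l2Sum_mono hY).trans ((l2Sum_add_le _ _).trans ?_)
  gcongr
  · rw [l2Sum_const_mul, ← mul_assoc, mul_comm 8, mul_assoc]
    gcongr
    refine (l2Sum_le_tsum _).trans ?_
    rw [ENNReal.tsum_comm]
    simp_rw [ENNReal.tsum_mul_right]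
    rw [← ENNReal.tsum_mul_left]
    refine ENNReal.tsum_le_tsum fun n => ?_
    calc (∑' m, D.touch l m n) * (2 * D.cell2 G₁ n) ≤ 4 * (2 * D.cell2 G₁ n) := by
          gcongr; exact D.tsum_touch_le' l n
      _ = _ := by rw [← mul_assoc]; norm_num
  -- Schur's test with row sums 4·4^l and column sums 4: the square root 4·2^l and the factor 2 from
  -- the splitting make 8·2^l.
  · apply le_of_sq_le_sq
    refine (schur_test _ _ (D.tsum_touch_le l) (D.tsum_touch_le' l)).trans ?_
    rw [l2Sum_const_mul]
    apply le_of_eq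
    ring

end Choices

/-! ### Powers of two -/

/-- The power `2^x` in `[0, ∞]`. -/
noncomputable def pow2 (x : ℝ) : ℝ≥0∞ := 2 ^ x

theorem pow2_add (x y : ℝ) : pow2 (x + y) = pow2 x * pow2 y :=
  ENNReal.rpow_add _ _ (by norm_num) (by norm_num)

theorem pow2_zero : pow2 0 = 1 := ENNReal.rpow_zero

theorem pow2_ne_top (x : ℝ) : pow2 x ≠ ⊤ := by simp [pow2]

theorem pow2_mono {x y : ℝ} (h : x ≤ y) : pow2 x ≤ pow2 y :=
  ENNReal.rpow_le_rpow_of_exponent_le (by norm_num) h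

theorem pow2_natCast (n : ℕ) : pow2 n = 2 ^ n := ENNReal.rpow_natCast _ _

theorem pow2_neg (x : ℝ) : pow2 (-x) = (pow2 x)⁻¹ := ENNReal.rpow_neg _ _

theorem pow2_sq (x : ℝ) : pow2 x ^ 2 = pow2 (2 * x) := by rw [sq, ← pow2_add, two_mul]

theorem le_pow2_neg_mul {n : ℝ} {a b : ℝ≥0∞} (h : pow2 n * a ≤ b) : a ≤ pow2 (-n) * b := by
  calc a = pow2 (-n) * (pow2 n * a) := by
        rw [← mul_assoc, ← pow2_add, neg_add_cancel, pow2_zero, one_mul]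
    _ ≤ _ := by gcongr

namespace Choices

/-! ### Triple products of functions with localized frequencies -/

/-- A measurable function whose frequencies are localized at `2^i` for every time. -/
structure IsBand (D : Choices) (i : ℕ) (g : ℝ → ℝ → ℂ) : Prop where
  measurable : Measurable (Function.uncurry g)
  reproduced : ∀ t, IsReproduced (g t) (D.wideSymbol i)

theorem triple_comm (u v w : ℝ → ℝ → ℂ) : triple u v w = triple v u w := by
  ext t x; unfold triple; ring

theorem triple_comm' (u v w : ℝ → ℝ → ℂ) : triple u v w = triple u w v := by
  ext t x; unfold triple; ring

theorem IsBand.cell2_le {D : Choices} {i : ℕ} {g : ℝ → ℝ → ℂ} (h : D.IsBand i g) (n : ℤ) :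
    D.cell2 (fun t x => ‖g t x‖ₑ) n ≤ pow2 (-i) * D.dyadicX i g :=
  le_pow2_neg_mul (by rw [pow2_natCast]; exact D.cell2_le_dyadicX i h.measurable n)

/-- Each factor in the supremum norm costs 2^{3i/2} and each factor in local L² gains 2^{-i}. No
order of the indices is assumed; which bound is efficient depends on it. -/
theorem exists_triple_bound (D : Choices) : ∃ K : ℝ≥0∞, K < ⊤ ∧ ∀ (i j k : ℕ)
    (u v w : ℝ → ℝ → ℂ), D.IsBand i u → D.IsBand j v → D.IsBand k w →
    ∑' n, D.cell2 (triple u v w) n ≤ K * (pow2 (3 / 2 * i + 3 / 2 * j - k) *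
      (D.dyadicX i u * D.dyadicX j v * D.dyadicX k w)) ∧
    l2Sum (D.cell1 (triple u v w)) ≤ K * (pow2 (3 / 2 * i - j - k) *
      (D.dyadicX i u * D.dyadicX j v * D.dyadicX k w)) := by
  obtain ⟨C, hC, hU⟩ := D.exists_cellBound
  have hC1 : ∃ A : ℝ≥0∞, A < ⊤ ∧ ∀ i (g : ℝ → ℝ → ℂ), D.IsBand i g → ∃ U, D.IsCellBound g U ∧
      l2Sum U ≤ A * (pow2 (3 / 2 * i) * D.dyadicX i g) := by
    refine ⟨C ^ (1 / 2 : ℝ), ENNReal.rpow_lt_top_of_nonneg (by norm_num) hC.ne,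
      fun i g h => ?_⟩
    obtain ⟨U, h1, h2⟩ := hU i g (fun t => (h.reproduced t).continuous)
      fun t x => (h.reproduced t).eq_integral x
    refine ⟨U, h1, le_of_sq_le_sq (h2.trans (le_of_eq ?_))⟩
    rw [mul_pow, mul_pow, rpow_half_sq, pow2_sq, ← pow2_natCast, mul_assoc]
    congr 3
    push_cast; ring
  obtain ⟨A, hA, hU⟩ := hC1
  refine ⟨A * A + A, ?_, fun i j k u v w hu hv hw => ?_⟩
  · exact ENNReal.add_lt_top.2 ⟨ENNReal.mul_lt_top hA hA, hA⟩
  obtain ⟨U, hU1, hU2⟩ := hU i u hu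
  obtain ⟨V, hV1, hV2⟩ := hU j v hv
  constructor
  · refine (tsum_cell2_triple_le hU1 hV1 hw.measurable hw.cell2_le).trans ?_
    calc l2Sum U * l2Sum V * (pow2 (-k) * D.dyadicX k w)
        ≤ (A * (pow2 (3 / 2 * i) * D.dyadicX i u)) * (A * (pow2 (3 / 2 * j) * D.dyadicX j v)) *
          (pow2 (-k) * D.dyadicX k w) := by gcongr
      _ = A * A * (pow2 (3 / 2 * i + 3 / 2 * j - k) *
          (D.dyadicX i u * D.dyadicX j v * D.dyadicX k w)) := by
          rw [sub_eq_add_neg, pow2_add, pow2_add]; ring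
      _ ≤ _ := by gcongr; exact self_le_add_right _ _
  · refine (l2Sum_cell1_triple_le hU1 hv.measurable hw.measurable hv.cell2_le hw.cell2_le).trans ?_
    calc l2Sum U * (pow2 (-j) * D.dyadicX j v) * (pow2 (-k) * D.dyadicX k w)
        ≤ (A * (pow2 (3 / 2 * i) * D.dyadicX i u)) * (pow2 (-j) * D.dyadicX j v) *
          (pow2 (-k) * D.dyadicX k w) := by gcongr
      _ = A * (pow2 (3 / 2 * i - j - k) *
          (D.dyadicX i u * D.dyadicX j v * D.dyadicX k w)) := by
          rw [sub_eq_add_neg, sub_eq_add_neg, pow2_add, pow2_add]; ring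
      _ ≤ _ := by gcongr; exact self_le_add_left _ _

/-- The modulus of the kernel of `S_l`. -/
noncomputable def absKern (D : Choices) (l : ℕ) (x : ℝ) : ℝ≥0∞ := ‖kern (D.symbol l) x‖ₑ

theorem absKern_measurable (D : Choices) (l : ℕ) : Measurable (D.absKern l) :=
  (kern (D.symbol l)).continuous.measurable.enorm

/-- The prefactors are those of `l2Loc_normYj_le`. The first bound loses nothing; in the second,
Bernstein from L¹ to L² turns 2^l into 2^{3l/2}. -/
theorem exists_conv_bound (D : Choices) : ∃ K : ℝ≥0∞, K < ⊤ ∧ ∀ (l : ℕ) (F : ℝ → ℝ → ℝ≥0∞),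
    Measurable (Function.uncurry F) →
    ((2 : ℝ≥0∞) ^ l)⁻¹ * ∑' n, D.cell2 (conv (D.absKern l) F) n ≤
      K * (pow2 (-l) * ∑' n, D.cell2 F n) ∧
    2 ^ l * l2Sum (D.cell12 (conv (D.absKern l) F)) ≤
      K * (pow2 (3 / 2 * l) * l2Sum (D.cell1 F)) := by
  obtain ⟨C, hC0, hC⟩ := D.kern_symbol_le
  have hk : ∀ l, IsConcentrated l C (D.absKern l) := fun l => by
    refine ⟨D.absKern_measurable l, fun x => ?_⟩
    unfold absKern
    rw [← ofReal_norm]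
    exact ENNReal.ofReal_le_ofReal (hC l x).1
  set B : ℝ≥0∞ := ∫⁻ x, ebump 0 x
  have hB : B < ⊤ := lintegral_ebump_lt_top
  have hb : ∀ l, l2Norm volume (ebump l) ≤ B ^ (1 / 2 : ℝ) * pow2 (1 / 2 * l) := fun l => by
    refine le_of_sq_le_sq ((l2Norm_ebump_sq_le l).trans (le_of_eq ?_))
    rw [mul_pow, rpow_half_sq, pow2_sq, ← pow2_natCast, mul_comm]
    congr 2
    ring
  have hD := decaySum_lt_top
  refine ⟨ENNReal.ofReal (4 * C) * decaySum * (B + B ^ (1 / 2 : ℝ)), ?_, fun l F hF => ⟨?_, ?_⟩⟩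
  · refine ENNReal.mul_lt_top (ENNReal.mul_lt_top ENNReal.ofReal_lt_top hD) ?_
    exact ENNReal.add_lt_top.2 ⟨hB, ENNReal.rpow_lt_top_of_nonneg (by norm_num) hB.ne⟩
  · rw [pow2_neg, pow2_natCast]
    calc ((2 : ℝ≥0∞) ^ l)⁻¹ * ∑' n, D.cell2 (conv (D.absKern l) F) n
        ≤ ((2 : ℝ≥0∞) ^ l)⁻¹ * (ENNReal.ofReal (4 * C) * decaySum * B * ∑' n, D.cell2 F n) := by
          gcongr; exact (hk l).tsum_cell2_le hC0 D hF
      _ = ENNReal.ofReal (4 * C) * decaySum * B * (((2 : ℝ≥0∞) ^ l)⁻¹ * ∑' n, D.cell2 F n) := by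
          ring
      _ ≤ _ := by gcongr; exact self_le_add_right _ _
  · calc 2 ^ l * l2Sum (D.cell12 (conv (D.absKern l) F))
        ≤ pow2 l * (ENNReal.ofReal (4 * C) * decaySum * (B ^ (1 / 2 : ℝ) * pow2 (1 / 2 * l)) *
          l2Sum (D.cell1 F)) := by
          rw [pow2_natCast]
          gcongr
          refine ((hk l).l2Sum_cell12_le hC0 D hF).trans ?_
          gcongr
          exact hb l
      _ = ENNReal.ofReal (4 * C) * decaySum * B ^ (1 / 2 : ℝ) *
          (pow2 (3 / 2 * l) * l2Sum (D.cell1 F)) := by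
          rw [show (3 / 2 * l : ℝ) = l + 1 / 2 * l by ring, pow2_add]; ring
      _ ≤ _ := by gcongr; exact self_le_add_left _ _

/-! ### Exponents -/

/-- Up to bounded terms l = k. The nonpositive coefficient s-2-γ is moved from k to j, where it
becomes s-1/2-β-γ ≤ -4δ, and this is moved on to i, where it becomes s+1-α-β-γ ≤ -4δ. -/
theorem exponent_of_dominates {s α β γ δ : ℝ} (hγ : s - 2 ≤ γ) (hδ : 0 < δ)
    (h2 : 4 * δ ≤ β + γ - (s - 1 / 2)) (h3 : 4 * δ ≤ α + β + γ - (s + 1)) {i j k l : ℕ}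
    (hij : i ≤ j) (hjk : j ≤ k) (hl : l ≤ k + 3 ∧ k ≤ l + 3) :
    s * l + (-l + (3 / 2 * i + 3 / 2 * j - k)) - α * i - β * j - γ * k ≤
      3 * |s - 1| + 3 * δ - δ * (i + j + |(l : ℝ) - k|) := by
  have hij' : (i : ℝ) ≤ j := by exact_mod_cast hij
  have hjk' : (j : ℝ) ≤ k := by exact_mod_cast hjk
  have hi0 : (0 : ℝ) ≤ i := i.cast_nonneg
  have ha : |(l : ℝ) - k| ≤ 3 := by
    have h1 : (l : ℝ) ≤ k + 3 := by exact_mod_cast hl.1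
    have h2 : (k : ℝ) ≤ l + 3 := by exact_mod_cast hl.2
    rw [abs_le]; constructor <;> linarith
  have e1 : (s - 1) * (l - k) ≤ |s - 1| * 3 :=
    (le_abs_self _).trans (by rw [abs_mul]; gcongr)
  have e2 : 0 ≤ (γ - (s - 2)) * (k - j) := mul_nonneg (by linarith) (by linarith)
  have e3 := mul_le_mul_of_nonneg_right h2 (sub_nonneg.2 hij')
  have e4 := mul_le_mul_of_nonneg_right h3 hi0
  have e5 := mul_le_mul_of_nonneg_left ha hδ.le
  have e6 := mul_le_mul_of_nonneg_left hij' hδ.le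
  have e7 : 0 ≤ δ * i := by positivity
  nlinarith

/-- Since s + 3/2 ≥ 0, l may be raised to k + 6, and j is k up to a bounded error. This leaves
(s-1/2-β-γ)k + (3/2-α)i, treated as in the dominated case. -/
theorem exponent_of_not_dominates {s α β γ δ : ℝ} (hs : -3 / 2 ≤ s) (hδ : 0 < δ)
    (h2 : 4 * δ ≤ β + γ - (s - 1 / 2)) (h3 : 4 * δ ≤ α + β + γ - (s + 1)) {i j k l : ℕ}
    (hij : i ≤ j) (hjk : j ≤ k + 2) (hkj : k ≤ j + 5) (hl : l ≤ k + 6) :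
    s * l + (3 / 2 * l + (3 / 2 * i - j - k)) - α * i - β * j - γ * k ≤
      (6 * (s + 3 / 2) + 5 * |1 + β| + 2 * (β + γ - (s - 1 / 2)) + 10 * δ) -
        δ * (i + j + k + l) := by
  have hij' : (i : ℝ) ≤ j := by exact_mod_cast hij
  have hjk' : (j : ℝ) ≤ k + 2 := by exact_mod_cast hjk
  have hkj' : (k : ℝ) ≤ j + 5 := by exact_mod_cast hkj
  have hl' : (l : ℝ) ≤ k + 6 := by exact_mod_cast hl
  have hi0 : (0 : ℝ) ≤ i := i.cast_nonneg
  have e1 : (1 + β) * (k - j) ≤ |1 + β| * 5 := by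
    refine (le_abs_self _).trans ?_
    rw [abs_mul]
    gcongr
    rw [abs_le]; constructor <;> linarith
  have e2 := mul_le_mul_of_nonneg_left hl' (show 0 ≤ s + 3 / 2 by linarith)
  have e3 := mul_le_mul_of_nonneg_right h2 (show 0 ≤ (k : ℝ) - i + 2 by linarith)
  have e4 := mul_le_mul_of_nonneg_right h3 hi0
  have e5 : δ * (i + j + k + l) ≤ δ * (4 * k + 10) :=
    mul_le_mul_of_nonneg_left (by linarith) hδ.le
  nlinarith

/-! ### Weighted bounds for triple products -/

/-- The weight `2^{-δ|x|}`. -/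
noncomputable def gain (δ x : ℝ) : ℝ≥0∞ := pow2 (-(δ * |x|))

/-- The kernel that remains in the sum over all interactions, for the largest index `k`. -/
noncomputable def gainKernel (δ : ℝ) (i j k l : ℕ) : ℝ≥0∞ :=
  gain δ i * gain δ j * gain δ ((l : ℝ) - k)

/-- The contribution of the frequency `2^i` to the norm of `l²X^s`. -/
noncomputable def weightedX (D : Choices) (s : ℝ) (i : ℕ) (g : ℝ → ℝ → ℂ) : ℝ≥0∞ :=
  pow2 (s * i) * D.dyadicX i g

theorem dyadicX_eq_weightedX (D : Choices) (s : ℝ) (i : ℕ) (g : ℝ → ℝ → ℂ) :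
    D.dyadicX i g = pow2 (-(s * i)) * D.weightedX s i g := by
  rw [weightedX, ← mul_assoc, ← pow2_add, neg_add_cancel, pow2_zero, one_mul]

theorem dyadicX_mul_eq (D : Choices) (α β γ x : ℝ) (i j k : ℕ) (u v w : ℝ → ℝ → ℂ) :
    pow2 x * (D.dyadicX i u * D.dyadicX j v * D.dyadicX k w) =
      pow2 (x - α * i - β * j - γ * k) *
        (D.weightedX α i u * D.weightedX β j v * D.weightedX γ k w) := by
  rw [D.dyadicX_eq_weightedX α, D.dyadicX_eq_weightedX β, D.dyadicX_eq_weightedX γ]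
  simp only [sub_eq_add_neg, pow2_add]
  ring

theorem gainKernel_eq (δ : ℝ) (i j k l : ℕ) :
    gainKernel δ i j k l = pow2 (-(δ * (i + j + |(l : ℝ) - k|))) := by
  unfold gainKernel gain
  rw [← pow2_add, ← pow2_add, abs_of_nonneg (i.cast_nonneg : (0 : ℝ) ≤ i),
    abs_of_nonneg (j.cast_nonneg : (0 : ℝ) ≤ j)]
  congr 1; ring

/-- The bounds for the contribution of a triple product to the frequency `2^l`, in the local `L²`
norms if the largest frequency dominates and in the `L¹_t L²_x` norms otherwise. -/
def IsTripleBound (D : Choices) (s : ℝ) (l : ℕ) (dom : Prop) (F : ℝ → ℝ → ℝ≥0∞) (B : ℝ≥0∞) :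
    Prop :=
  (dom → pow2 (s * l) * (((2 : ℝ≥0∞) ^ l)⁻¹ * ∑' n, D.cell2 (conv (D.absKern l) F) n) ≤ B) ∧
  (¬ dom → pow2 (s * l) * (2 ^ l * l2Sum (D.cell12 (conv (D.absKern l) F))) ≤ B)

/-- The slack in j ≤ k + 2 serves part b), where the bands of S_j v and S_k w spread by one index
each. The last clause controls the pairing with Schwartz functions. -/
theorem exists_weighted_bound (D : Choices) {s α β γ δ : ℝ} (hs : -3 / 2 ≤ s) (hγ : s - 2 ≤ γ)
    (hδ : 0 < δ) (h2 : 4 * δ ≤ β + γ - (s - 1 / 2)) (h3 : 4 * δ ≤ α + β + γ - (s + 1)) :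
    ∃ K : ℝ≥0∞, K < ⊤ ∧ ∀ (i j k : ℕ) (u v w : ℝ → ℝ → ℂ), D.IsBand i u → D.IsBand j v →
      D.IsBand k w → i ≤ j → j ≤ k + 2 →
      (∀ l, Interacts i j k l → D.IsTripleBound s l (Dominates i j k) (triple u v w)
        (K * (gainKernel δ i j k l *
          (D.weightedX α i u * D.weightedX β j v * D.weightedX γ k w)))) ∧
      (¬ Dominates i j k → l2Sum (D.cell1 (triple u v w)) ≤ K * (pow2 (-(δ * (i + j + k))) *
          (D.weightedX α i u * D.weightedX β j v * D.weightedX γ k w))) := by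
  obtain ⟨K₁, hK₁, hT⟩ := D.exists_triple_bound
  obtain ⟨K₂, hK₂, hV⟩ := D.exists_conv_bound
  set M : ℝ := max (3 * |s - 1| + 3 * δ)
    (6 * (s + 3 / 2) + 5 * |1 + β| + 2 * (β + γ - (s - 1 / 2)) + 10 * δ) with hM
  have hM1 : 3 * |s - 1| + 3 * δ ≤ M := le_max_left _ _
  have hM2 : 6 * (s + 3 / 2) + 5 * |1 + β| + 2 * (β + γ - (s - 1 / 2)) + 10 * δ ≤ M :=
    le_max_right _ _
  refine ⟨(K₂ + 1) * K₁ * pow2 M, ?_, fun i j k u v w hu hv hw hij hjk => ⟨fun l hl => ⟨?_, ?_⟩,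
    ?_⟩⟩
  · exact ENNReal.mul_lt_top (ENNReal.mul_lt_top (ENNReal.add_lt_top.2 ⟨hK₂, by norm_num⟩) hK₁)
      (pow2_ne_top M).lt_top
  all_goals
    have hF := measurable_triple hu.measurable hv.measurable hw.measurable
    obtain ⟨t1, t2⟩ := hT i j k u v w hu hv hw
    set W := D.weightedX α i u * D.weightedX β j v * D.weightedX γ k w
  · intro hd
    have hx := exponent_of_dominates hγ hδ h2 h3 (l := l) hij (by have := hd.2; omega)
      (hl.2.1 hd)
    calc pow2 (s * l) * (((2 : ℝ≥0∞) ^ l)⁻¹ *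
          ∑' n, D.cell2 (conv (D.absKern l) (triple u v w)) n)
        ≤ pow2 (s * l) * (K₂ * (pow2 (-l) * (K₁ * (pow2 (3 / 2 * i + 3 / 2 * j - k) *
          (D.dyadicX i u * D.dyadicX j v * D.dyadicX k w))))) := by
          refine mul_le_mul_right (((hV l _ hF).1).trans ?_) _
          gcongr
      _ = K₂ * K₁ * (pow2 (s * l + (-l + (3 / 2 * i + 3 / 2 * j - k))) *
          (D.dyadicX i u * D.dyadicX j v * D.dyadicX k w)) := by
          rw [pow2_add, pow2_add]; ring
      _ ≤ (K₂ + 1) * K₁ * (pow2 (M + -(δ * (i + j + |(l : ℝ) - k|))) * W) := by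
          rw [D.dyadicX_mul_eq α β γ]
          gcongr
          · exact self_le_add_right _ _
          · apply pow2_mono; linarith
      _ = _ := by rw [pow2_add, gainKernel_eq]; ring
  · intro hd
    have hkj : k ≤ j + 5 := by
      by_contra h
      exact hd ⟨by omega, by omega⟩
    have hx := exponent_of_not_dominates hs hδ h2 h3 (l := l) hij hjk hkj (by have := hl.1; omega)
    have ha : |(l : ℝ) - k| ≤ k + l := by
      have h1 : (0 : ℝ) ≤ k := k.cast_nonneg
      have h2 : (0 : ℝ) ≤ l := l.cast_nonneg
      rw [abs_le]; constructor <;> linarith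
    have ha' := mul_le_mul_of_nonneg_left ha hδ.le
    calc pow2 (s * l) * (2 ^ l * l2Sum (D.cell12 (conv (D.absKern l) (triple u v w))))
        ≤ pow2 (s * l) * (K₂ * (pow2 (3 / 2 * l) * (K₁ * (pow2 (3 / 2 * i - j - k) *
          (D.dyadicX i u * D.dyadicX j v * D.dyadicX k w))))) := by
          refine mul_le_mul_right (((hV l _ hF).2).trans ?_) _
          gcongr
      _ = K₂ * K₁ * (pow2 (s * l + (3 / 2 * l + (3 / 2 * i - j - k))) *
          (D.dyadicX i u * D.dyadicX j v * D.dyadicX k w)) := by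
          rw [pow2_add, pow2_add]; ring
      _ ≤ (K₂ + 1) * K₁ * (pow2 (M + -(δ * (i + j + |(l : ℝ) - k|))) * W) := by
          rw [D.dyadicX_mul_eq α β γ]
          gcongr
          · exact self_le_add_right _ _
          · apply pow2_mono; linarith
      _ = _ := by rw [pow2_add, gainKernel_eq]; ring
  · intro hd
    have hkj : k ≤ j + 5 := by
      by_contra h
      exact hd ⟨by omega, by omega⟩
    -- At l = 0 the output weights disappear and the exponent is that of the bare L¹ bound.
    have hx := exponent_of_not_dominates hs hδ h2 h3 (l := 0) hij hjk hkj (by omega)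
    simp only [CharP.cast_eq_zero, mul_zero, zero_add, add_zero] at hx
    calc l2Sum (D.cell1 (triple u v w))
        ≤ K₁ * (pow2 (3 / 2 * i - j - k) *
          (D.dyadicX i u * D.dyadicX j v * D.dyadicX k w)) := t2
      _ ≤ 1 * K₁ * (pow2 (M + -(δ * (i + j + k))) * W) := by
          rw [D.dyadicX_mul_eq α β γ, one_mul]
          gcongr
          apply pow2_mono; linarith
      _ ≤ (K₂ + 1) * K₁ * (pow2 (M + -(δ * (i + j + k))) * W) := by
          gcongr
          exact self_le_add_left _ _
      _ = _ := by rw [pow2_add]; ring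

/-! ### Summation of the kernel -/

/-- The sum of the weights `2^{-δ|n|}`. -/
noncomputable def gainSum (δ : ℝ) : ℝ≥0∞ := ∑' n : ℤ, gain δ n

theorem gainSum_lt_top {δ : ℝ} (hδ : 0 < δ) : gainSum δ < ⊤ := by
  have e : ∀ n : ℤ, gain δ n = ENNReal.ofReal ((2 : ℝ) ^ (-(δ * |(n : ℝ)|))) := fun n => by
    rw [gain, pow2, ← ENNReal.ofReal_rpow_of_pos (by norm_num)]
    norm_num
  have h1 : Summable (fun n : ℕ => (2 : ℝ) ^ (-(δ * (n : ℝ)))) := by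
    have := summable_geometric_of_lt_one (r := (2 : ℝ) ^ (-δ)) (by positivity)
      (Real.rpow_lt_one_of_one_lt_of_neg (by norm_num) (by linarith))
    refine this.congr fun n => ?_
    rw [← Real.rpow_natCast, ← Real.rpow_mul (by norm_num)]
    congr 1; ring
  have h2 : Summable (fun n : ℤ => (2 : ℝ) ^ (-(δ * |(n : ℝ)|))) := by
    refine Summable.of_nat_of_neg ?_ ?_ <;> simpa using h1
  unfold gainSum
  simp_rw [e]
  rw [← ENNReal.ofReal_tsum_of_nonneg (fun n => by positivity) h2]
  exact ENNReal.ofReal_lt_top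

theorem tsum_gain_sub_le (δ : ℝ) (l : ℕ) : ∑' k : ℕ, gain δ ((l : ℝ) - k) ≤ gainSum δ := by
  refine le_trans (le_of_eq (tsum_congr fun k => ?_)) (ENNReal.tsum_comp_le_tsum_of_injective
    (f := fun k : ℕ => (l : ℤ) - k) (fun a b h => by simpa using h) fun n : ℤ => gain δ n)
  push_cast; rfl

theorem gain_neg (δ x : ℝ) : gain δ (-x) = gain δ x := by rw [gain, gain, abs_neg]

theorem tsum_gain_sub_le' (δ : ℝ) (k : ℕ) : ∑' l : ℕ, gain δ ((l : ℝ) - k) ≤ gainSum δ := by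
  refine le_trans (le_of_eq (tsum_congr fun l => ?_)) (tsum_gain_sub_le δ k)
  rw [← gain_neg, neg_sub]

theorem tsum_gain_mul_le (δ : ℝ) (a : ℕ → ℝ≥0∞) :
    ∑' i : ℕ, gain δ i * a i ≤ gainSum δ * l2Sum a := by
  refine (tsum_mul_le_l2Sum _ _).trans ?_
  gcongr
  refine (l2Sum_le_tsum _).trans ?_
  have := tsum_gain_sub_le' δ 0
  simpa using this

theorem tsum_gainKernel (δ : ℝ) (l : ℕ) (a b c : ℕ → ℝ≥0∞) :
    ∑' p : ℕ × ℕ × ℕ, gainKernel δ p.1 p.2.1 p.2.2 l * (a p.1 * b p.2.1 * c p.2.2) =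
      ((∑' i : ℕ, gain δ i * a i) * ∑' j : ℕ, gain δ j * b j) *
        ∑' k : ℕ, gain δ ((l : ℝ) - k) * c k := by
  rw [ENNReal.tsum_prod', mul_assoc, ← ENNReal.tsum_mul_right]
  refine tsum_congr fun i => ?_
  rw [ENNReal.tsum_prod', ← ENNReal.tsum_mul_right, ← ENNReal.tsum_mul_left]
  refine tsum_congr fun j => ?_
  rw [← ENNReal.tsum_mul_left, ← ENNReal.tsum_mul_left]
  refine tsum_congr fun k => ?_
  unfold gainKernel
  ring

/-- For fixed l the sum factors. Cauchy-Schwarz handles i and j, and Schur's test handles the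
convolution in k. -/
theorem l2Sum_gainKernel_le (δ : ℝ) (a b c : ℕ → ℝ≥0∞) :
    l2Sum (fun l => ∑' p : ℕ × ℕ × ℕ,
      gainKernel δ p.1 p.2.1 p.2.2 l * (a p.1 * b p.2.1 * c p.2.2)) ≤
      gainSum δ ^ 3 * (l2Sum a * l2Sum b * l2Sum c) := by
  simp_rw [tsum_gainKernel]
  rw [l2Sum_const_mul]
  have h3 : l2Sum (fun l : ℕ => ∑' k : ℕ, gain δ ((l : ℝ) - k) * c k) ≤ gainSum δ * l2Sum c := by
    apply le_of_sq_le_sq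
    refine (schur_test _ _ (tsum_gain_sub_le δ) (tsum_gain_sub_le' δ)).trans (le_of_eq ?_)
    ring
  calc _ ≤ ((gainSum δ * l2Sum a) * (gainSum δ * l2Sum b)) * (gainSum δ * l2Sum c) := by
        gcongr
        · exact tsum_gain_mul_le δ a
        · exact tsum_gain_mul_le δ b
    _ = _ := by ring

/-- The sum of the kernels over the possible positions of the largest index. -/
noncomputable def symKernel (δ : ℝ) (i j k l : ℕ) : ℝ≥0∞ :=
  gainKernel δ i j k l + gainKernel δ i k j l + gainKernel δ j k i l

theorem l2Sum_symKernel_le (δ : ℝ) (a b c : ℕ → ℝ≥0∞) :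
    l2Sum (fun l => ∑' p : ℕ × ℕ × ℕ,
      symKernel δ p.1 p.2.1 p.2.2 l * (a p.1 * b p.2.1 * c p.2.2)) ≤
      3 * gainSum δ ^ 3 * (l2Sum a * l2Sum b * l2Sum c) := by
  let e₁ : ℕ × ℕ × ℕ ≃ ℕ × ℕ × ℕ :=
    ⟨fun p => (p.1, p.2.2, p.2.1), fun p => (p.1, p.2.2, p.2.1), fun _ => rfl, fun _ => rfl⟩
  let e₂ : ℕ × ℕ × ℕ ≃ ℕ × ℕ × ℕ :=
    ⟨fun p => (p.2.1, p.2.2, p.1), fun p => (p.2.2, p.1, p.2.1), fun _ => rfl, fun _ => rfl⟩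
  have h1 := l2Sum_gainKernel_le δ a b c
  have h2 := l2Sum_gainKernel_le δ a c b
  have h3 := l2Sum_gainKernel_le δ b c a
  have key : ∀ l, ∑' p : ℕ × ℕ × ℕ, symKernel δ p.1 p.2.1 p.2.2 l * (a p.1 * b p.2.1 * c p.2.2) =
      (∑' p : ℕ × ℕ × ℕ, gainKernel δ p.1 p.2.1 p.2.2 l * (a p.1 * b p.2.1 * c p.2.2)) +
      (∑' p : ℕ × ℕ × ℕ, gainKernel δ p.1 p.2.1 p.2.2 l * (a p.1 * c p.2.1 * b p.2.2)) +
      ∑' p : ℕ × ℕ × ℕ, gainKernel δ p.1 p.2.1 p.2.2 l * (b p.1 * c p.2.1 * a p.2.2) := fun l => by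
    rw [← e₁.tsum_eq fun p : ℕ × ℕ × ℕ =>
        gainKernel δ p.1 p.2.1 p.2.2 l * (a p.1 * c p.2.1 * b p.2.2),
      ← e₂.tsum_eq fun p : ℕ × ℕ × ℕ =>
        gainKernel δ p.1 p.2.1 p.2.2 l * (b p.1 * c p.2.1 * a p.2.2),
      ← ENNReal.tsum_add, ← ENNReal.tsum_add]
    refine tsum_congr fun p => ?_
    simp only [symKernel, e₁, e₂, Equiv.coe_fn_mk]
    ring
  simp_rw [key]
  refine (l2Sum_add_le _ _).trans ((add_le_add_left (l2Sum_add_le _ _) _).trans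
    ((add_le_add (add_le_add h1 h2) h3).trans (le_of_eq ?_)))
  ring

/-! ### The output norm of a sum over interactions -/

theorem cell2_tsum_le (D : Choices) {ι : Type*} [Countable ι] {F : ι → ℝ → ℝ → ℝ≥0∞}
    (hF : ∀ p, Measurable (Function.uncurry (F p))) (n : ℤ) :
    D.cell2 (fun t x => ∑' p, F p t x) n ≤ ∑' p, D.cell2 (F p) n := by
  unfold cell2
  refine le_trans (l2Norm_mono (Eventually.of_forall fun t => l2Norm_tsum_le _
    fun p => (measurable_slice (hF p) t).aemeasurable)) ?_
  exact l2Norm_tsum_le _ fun p => (measurable_l2Norm (hF p) _).aemeasurable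

theorem cell12_tsum_le (D : Choices) {ι : Type*} [Countable ι] {F : ι → ℝ → ℝ → ℝ≥0∞}
    (hF : ∀ p, Measurable (Function.uncurry (F p))) (n : ℤ) :
    D.cell12 (fun t x => ∑' p, F p t x) n ≤ ∑' p, D.cell12 (F p) n := by
  unfold cell12
  rw [← lintegral_tsum fun p => (measurable_l2Norm (hF p) _).aemeasurable]
  exact lintegral_mono fun t => l2Norm_tsum_le _
    fun p => (measurable_slice (hF p) t).aemeasurable

-- The dominated triples are collected in G₁ and all others in G₂ of `l2Loc_normYj_le`. Thus only an
-- absolutely convergent majorant of g has to be split, not g itself.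
open Classical in
theorem l2Loc_normYj_le_tsum (D : Choices) (s : ℝ) (l : ℕ) {ι : Type*} [Countable ι]
    (dom : ι → Prop) {F : ι → ℝ → ℝ → ℝ≥0∞} (hF : ∀ p, Measurable (Function.uncurry (F p)))
    (B : ι → ℝ≥0∞) (hB : ∀ p, D.IsTripleBound s l (dom p) (F p) (B p)) {g : ℝ → ℝ → ℂ}
    (hg : Measurable (Function.uncurry g))
    (h : ∀ t x, ‖g t x‖ₑ ≤ ∑' p, conv (D.absKern l) (F p) t x) :
    pow2 (s * l) * D.l2Loc l (D.normYj l) g ≤ 8 * ∑' p, B p := by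
  let H : (ι → Prop) → ι → ℝ → ℝ → ℝ≥0∞ := fun d p t x =>
    if d p then conv (D.absKern l) (F p) t x else 0
  have hm : ∀ d p, Measurable (Function.uncurry (H d p)) := fun d p => by
    by_cases hd : d p
    · simpa only [H, hd, if_true] using measurable_conv (D.absKern_measurable l) (hF p)
    · simp only [H, hd, if_false]
      exact measurable_const
  have hmt : ∀ d, Measurable (Function.uncurry fun t x => ∑' p, H d p t x) := fun d =>
    Measurable.tsum fun p => hm d p
  have hY := D.l2Loc_normYj_le l hg (hmt dom) (hmt fun p => ¬ dom p) fun t x => by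
    refine (h t x).trans (le_of_eq ?_)
    rw [← ENNReal.tsum_add]
    refine tsum_congr fun p => ?_
    by_cases hd : dom p <;> simp [H, hd]
  have b₁ : pow2 (s * l) * (((2 : ℝ≥0∞) ^ l)⁻¹ *
      ∑' n, D.cell2 (fun t x => ∑' p, H dom p t x) n) ≤ ∑' p, if dom p then B p else 0 := by
    calc _ ≤ pow2 (s * l) * (((2 : ℝ≥0∞) ^ l)⁻¹ * ∑' n, ∑' p, D.cell2 (H dom p) n) := by
          gcongr with n
          exact D.cell2_tsum_le (hm dom) n
      _ = ∑' p, pow2 (s * l) * (((2 : ℝ≥0∞) ^ l)⁻¹ * ∑' n, D.cell2 (H dom p) n) := by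
          rw [ENNReal.tsum_comm, ENNReal.tsum_mul_left, ENNReal.tsum_mul_left]
      _ ≤ _ := by
          refine ENNReal.tsum_le_tsum fun p => ?_
          by_cases hd : dom p
          · simp only [H, hd, if_true]
            exact (hB p).1 hd
          · simp [H, hd, cell2, l2Norm]
  have b₂ : pow2 (s * l) * (2 ^ l *
      l2Sum (D.cell12 (fun t x => ∑' p, H (fun p => ¬ dom p) p t x))) ≤
        ∑' p, if dom p then 0 else B p := by
    calc _ ≤ pow2 (s * l) * (2 ^ l * ∑' p, l2Sum (D.cell12 (H (fun p => ¬ dom p) p))) := by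
          gcongr
          exact (l2Sum_mono (D.cell12_tsum_le (hm _))).trans (l2Sum_tsum_le _)
      _ = ∑' p, pow2 (s * l) * (2 ^ l * l2Sum (D.cell12 (H (fun p => ¬ dom p) p))) := by
          rw [ENNReal.tsum_mul_left, ENNReal.tsum_mul_left]
      _ ≤ _ := by
          refine ENNReal.tsum_le_tsum fun p => ?_
          by_cases hd : dom p
          · simp [H, hd, cell12, l2Norm, l2Sum]
          · simp only [H, hd, if_true, not_false_eq_true, if_false]
            exact (hB p).2 hd
  calc _ ≤ pow2 (s * l) * (8 * (((2 : ℝ≥0∞) ^ l)⁻¹ *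
          ∑' n, D.cell2 (fun t x => ∑' p, H dom p t x) n) +
        8 * (2 ^ l * l2Sum (D.cell12 (fun t x => ∑' p, H (fun p => ¬ dom p) p t x)))) := by
        gcongr
    _ = 8 * (pow2 (s * l) * (((2 : ℝ≥0∞) ^ l)⁻¹ *
          ∑' n, D.cell2 (fun t x => ∑' p, H dom p t x) n)) +
        8 * (pow2 (s * l) *
          (2 ^ l * l2Sum (D.cell12 (fun t x => ∑' p, H (fun p => ¬ dom p) p t x)))) := by ring
    _ ≤ 8 * (∑' p, if dom p then B p else 0) + 8 * (∑' p, if dom p then 0 else B p) := by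
        gcongr
    _ = _ := by
        rw [← mul_add, ← ENNReal.tsum_add]
        congr 1
        refine tsum_congr fun p => ?_
        split_ifs <;> simp

theorem normL2Y_eq (D : Choices) (s : ℝ) (f : ℝ → 𝓢'(ℝ, ℂ)) :
    D.normL2Y s f =
      l2Sum (fun l : ℕ => pow2 (s * l) * D.l2Loc l (D.normYj l) (fun t => D.SFun l (f t))) := by
  unfold normL2Y l2Sum
  simp_rw [mul_pow, pow2_sq]
  congr 1
  refine tsum_congr fun l => ?_
  rw [pow2]
  congr 2; ring

theorem normL2X_eq (D : Choices) (s : ℝ) (u : ℝ → 𝓢'(ℝ, ℂ)) :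
    D.normL2X s u = l2Sum (fun i => D.weightedX s i (fun t => D.SFun i (u t))) := by
  unfold normL2X l2Sum weightedX dyadicX
  simp_rw [mul_pow, pow2_sq]
  congr 1
  refine tsum_congr fun l => ?_
  rw [pow2]
  congr 2; ring

/-! ### Symmetric bounds -/

/-- One of the three indices is much larger than the others. -/
def SomeDominates (i j k : ℕ) : Prop := Dominates i j k ∨ Dominates i k j ∨ Dominates j k i

/-- The two bounds for a triple product that do not depend on the order of the indices. -/
def IsSymBound (D : Choices) (s δ : ℝ) (i j k : ℕ) (F : ℝ → ℝ → ℝ≥0∞) (B : ℝ≥0∞) : Prop :=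
  (∀ l, Interacts i j k l →
    D.IsTripleBound s l (SomeDominates i j k) F (symKernel δ i j k l * B)) ∧
  (¬ SomeDominates i j k → l2Sum (D.cell1 F) ≤ pow2 (-(δ * (i + j + k))) * B)

theorem IsSymBound.mono {D : Choices} {s δ : ℝ} {i j k : ℕ} {F : ℝ → ℝ → ℝ≥0∞} {B B' : ℝ≥0∞}
    (h : D.IsSymBound s δ i j k F B) (hB : B ≤ B') : D.IsSymBound s δ i j k F B' := by
  refine ⟨fun l hl => ⟨fun hd => ((h.1 l hl).1 hd).trans ?_, fun hd => ((h.1 l hl).2 hd).trans ?_⟩,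
    fun hd => (h.2 hd).trans ?_⟩ <;> gcongr

theorem dominates_comm {i j k : ℕ} : Dominates i j k ↔ Dominates j i k := and_comm

theorem interacts_comm {i j k l : ℕ} : Interacts i j k l ↔ Interacts j i k l := by
  unfold Interacts
  rw [dominates_comm (i := i), max_left_comm i]
  tauto

theorem interacts_comm' {i j k l : ℕ} : Interacts i j k l ↔ Interacts i k j l := by
  unfold Interacts
  rw [dominates_comm (i := j) (j := k), max_comm j]
  tauto

theorem someDominates_comm {i j k : ℕ} : SomeDominates i j k ↔ SomeDominates j i k := by
  unfold SomeDominates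
  rw [dominates_comm (i := i)]
  tauto

theorem someDominates_comm' {i j k : ℕ} : SomeDominates i j k ↔ SomeDominates i k j := by
  unfold SomeDominates
  rw [dominates_comm (i := j) (j := k)]
  tauto

theorem gainKernel_comm (δ : ℝ) (i j k l : ℕ) : gainKernel δ i j k l = gainKernel δ j i k l := by
  unfold gainKernel; ring

theorem IsSymBound.swap {D : Choices} {s δ : ℝ} {i j k : ℕ} {u v w : ℝ → ℝ → ℂ} {B : ℝ≥0∞}
    (h : D.IsSymBound s δ i j k (triple u v w) B) :
    D.IsSymBound s δ j i k (triple v u w) B := by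
  rw [triple_comm]
  refine ⟨fun l hl => ?_, fun hd => ?_⟩
  · have := h.1 l (interacts_comm.1 hl)
    unfold IsTripleBound at this ⊢
    rw [someDominates_comm]
    convert this using 3 <;>
    · unfold symKernel
      rw [gainKernel_comm δ j i]
      ring
  · have := h.2 (fun hn => hd (someDominates_comm.1 hn))
    rwa [add_comm (j : ℝ)]

theorem IsSymBound.swap' {D : Choices} {s δ : ℝ} {i j k : ℕ} {u v w : ℝ → ℝ → ℂ} {B : ℝ≥0∞}
    (h : D.IsSymBound s δ i j k (triple u v w) B) :
    D.IsSymBound s δ i k j (triple u w v) B := by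
  rw [triple_comm']
  refine ⟨fun l hl => ?_, fun hd => ?_⟩
  · have := h.1 l (interacts_comm'.1 hl)
    unfold IsTripleBound at this ⊢
    rw [someDominates_comm']
    convert this using 3 <;>
    · unfold symKernel
      rw [gainKernel_comm δ j k]
      ring
  · have := h.2 (fun hn => hd (someDominates_comm'.1 hn))
    rwa [add_right_comm (i : ℝ)]

theorem exists_sorted_bound (D : Choices) {s α β γ δ : ℝ} (hs : -3 / 2 ≤ s) (hγ : s - 2 ≤ γ)
    (hδ : 0 < δ) (h2 : 4 * δ ≤ β + γ - (s - 1 / 2)) (h3 : 4 * δ ≤ α + β + γ - (s + 1)) :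
    ∃ K : ℝ≥0∞, K < ⊤ ∧ ∀ (i j k : ℕ) (u v w : ℝ → ℝ → ℂ), D.IsBand i u → D.IsBand j v →
      D.IsBand k w → i ≤ j → j ≤ k → D.IsSymBound s δ i j k (triple u v w)
        (K * (D.weightedX α i u * D.weightedX β j v * D.weightedX γ k w)) := by
  obtain ⟨K, hK, h⟩ := D.exists_weighted_bound hs hγ hδ h2 h3
  refine ⟨K, hK, fun i j k u v w hu hv hw hij hjk => ?_⟩
  obtain ⟨h1, h2⟩ := h i j k u v w hu hv hw hij (by omega)
  have hdom : SomeDominates i j k ↔ Dominates i j k := by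
    unfold SomeDominates Dominates; omega
  refine ⟨fun l hl => ?_, fun hd => ?_⟩
  · rw [hdom]
    obtain ⟨b1, b2⟩ := h1 l hl
    refine ⟨fun hd => (b1 hd).trans ?_, fun hd => (b2 hd).trans ?_⟩ <;>
    · rw [mul_left_comm]
      gcongr
      unfold symKernel
      rw [add_assoc]
      exact self_le_add_right _ _
  · refine (h2 (hdom.not.1 hd)).trans (le_of_eq ?_)
    ring

/-- The sorted bound needs s-2 ≤ the exponent of the highest factor and the pair condition for the
two highest factors. Over the six orders this uses all hypotheses of part a). -/
theorem exists_sym_bound (D : Choices) {s α β γ : ℝ} (hs : -3 / 2 ≤ s) (hsum : s + 1 < α + β + γ)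
    (hα : s - 2 ≤ α) (hβ : s - 2 ≤ β) (hγ : s - 2 ≤ γ) (hαβ : s - 1 / 2 < α + β)
    (hβγ : s - 1 / 2 < β + γ) (hγα : s - 1 / 2 < γ + α) :
    ∃ K : ℝ≥0∞, K < ⊤ ∧ ∃ δ : ℝ, 0 < δ ∧ ∀ (i j k : ℕ) (u v w : ℝ → ℝ → ℂ),
      D.IsBand i u → D.IsBand j v → D.IsBand k w → D.IsSymBound s δ i j k (triple u v w)
        (K * (D.weightedX α i u * D.weightedX β j v * D.weightedX γ k w)) := by
  obtain ⟨δ, hδ, d1, d2, d3, d4⟩ : ∃ δ : ℝ, 0 < δ ∧ 4 * δ ≤ α + β - (s - 1 / 2) ∧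
      4 * δ ≤ β + γ - (s - 1 / 2) ∧ 4 * δ ≤ γ + α - (s - 1 / 2) ∧
      4 * δ ≤ α + β + γ - (s + 1) := by
    refine ⟨min (min (α + β - (s - 1 / 2)) (β + γ - (s - 1 / 2)))
      (min (γ + α - (s - 1 / 2)) (α + β + γ - (s + 1))) / 4, ?_, ?_, ?_, ?_, ?_⟩
    · refine div_pos (lt_min (lt_min ?_ ?_) (lt_min ?_ ?_)) (by norm_num) <;> linarith
    all_goals
      rw [mul_div_cancel₀ _ (by norm_num)]
      simp
  obtain ⟨K₁, hK₁, h₁⟩ := D.exists_sorted_bound (α := α) (β := β) (γ := γ) hs hγ hδ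
    (by linarith) (by linarith)
  obtain ⟨K₂, hK₂, h₂⟩ := D.exists_sorted_bound (α := β) (β := α) (γ := γ) hs hγ hδ
    (by linarith) (by linarith)
  obtain ⟨K₃, hK₃, h₃⟩ := D.exists_sorted_bound (α := α) (β := γ) (γ := β) hs hβ hδ
    (by linarith) (by linarith)
  obtain ⟨K₄, hK₄, h₄⟩ := D.exists_sorted_bound (α := γ) (β := α) (γ := β) hs hβ hδ
    (by linarith) (by linarith)
  obtain ⟨K₅, hK₅, h₅⟩ := D.exists_sorted_bound (α := β) (β := γ) (γ := α) hs hα hδ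
    (by linarith) (by linarith)
  obtain ⟨K₆, hK₆, h₆⟩ := D.exists_sorted_bound (α := γ) (β := β) (γ := α) hs hα hδ
    (by linarith) (by linarith)
  refine ⟨K₁ + K₂ + K₃ + K₄ + K₅ + K₆, ?_, δ, hδ, fun i j k u v w hu hv hw => ?_⟩
  · simp only [ENNReal.add_lt_top]
    exact ⟨⟨⟨⟨⟨hK₁, hK₂⟩, hK₃⟩, hK₄⟩, hK₅⟩, hK₆⟩
  set K := K₁ + K₂ + K₃ + K₄ + K₅ + K₆
  have e₆ : K₆ ≤ K := self_le_add_left _ _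
  have e₅ : K₅ ≤ K := le_add_right (self_le_add_left _ _)
  have e₄ : K₄ ≤ K := le_add_right (le_add_right (self_le_add_left _ _))
  have e₃ : K₃ ≤ K := le_add_right (le_add_right (le_add_right (self_le_add_left _ _)))
  have e₂ : K₂ ≤ K :=
    le_add_right (le_add_right (le_add_right (le_add_right (self_le_add_left _ _))))
  have e₁ : K₁ ≤ K :=
    le_add_right (le_add_right (le_add_right (le_add_right (self_le_add_right _ _))))
  have hle : ∀ {L x y : ℝ≥0∞}, L ≤ K → x = y → L * x ≤ K * y := fun h1 h2 => by
    rw [h2]; gcongr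
  have hijk : (i ≤ j ∧ j ≤ k) ∨ (j ≤ i ∧ i ≤ k) ∨ (i ≤ k ∧ k ≤ j) ∨ (k ≤ i ∧ i ≤ j) ∨
    (j ≤ k ∧ k ≤ i) ∨ (k ≤ j ∧ j ≤ i) := by omega
  rcases hijk with ⟨a, b⟩ | ⟨a, b⟩ | ⟨a, b⟩ | ⟨a, b⟩ | ⟨a, b⟩ | ⟨a, b⟩
  · exact (h₁ i j k u v w hu hv hw a b).mono (hle e₁ rfl)
  · exact ((h₂ j i k v u w hv hu hw a b).swap).mono (hle e₂ (by ring))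
  · exact ((h₃ i k j u w v hu hw hv a b).swap').mono (hle e₃ (by ring))
  · exact ((h₄ k i j w u v hw hu hv a b).swap.swap').mono (hle e₄ (by ring))
  · exact ((h₅ j k i v w u hv hw hu a b).swap'.swap).mono (hle e₅ (by ring))
  · exact ((h₆ k j i w v u hw hv hu a b).swap.swap'.swap).mono (hle e₆ (by ring))

/-- The sum of the local `L²` norms of a triple product is bounded up to powers of the
frequencies. -/
theorem exists_crude_bound (D : Choices) (α β γ : ℝ) : ∃ K : ℝ≥0∞, K < ⊤ ∧ ∃ M : ℕ,
    ∀ (i j k : ℕ) (u v w : ℝ → ℝ → ℂ), D.IsBand i u → D.IsBand j v → D.IsBand k w →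
      pow2 (-(M * (i + j + k))) * ∑' n, D.cell2 (triple u v w) n ≤ pow2 (-(i + j + k)) *
        (K * (D.weightedX α i u * D.weightedX β j v * D.weightedX γ k w)) := by
  obtain ⟨K, hK, hT⟩ := D.exists_triple_bound
  obtain ⟨M, hM⟩ := exists_nat_ge (3 + |α| + |β| + |γ|)
  refine ⟨K, hK, M, fun i j k u v w hu hv hw => ?_⟩
  have hx : -(M * ((i : ℝ) + j + k)) + (3 / 2 * i + 3 / 2 * j - k) - α * i - β * j - γ * k ≤
      -((i : ℝ) + j + k) := by
    have hi : (0 : ℝ) ≤ i := i.cast_nonneg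
    have hj : (0 : ℝ) ≤ j := j.cast_nonneg
    have hk : (0 : ℝ) ≤ k := k.cast_nonneg
    have a1 := neg_abs_le α
    have a2 := neg_abs_le β
    have a3 := neg_abs_le γ
    have p1 := abs_nonneg α
    have p2 := abs_nonneg β
    have p3 := abs_nonneg γ
    have e1 : (5 / 2 - α) * i ≤ M * i := by gcongr; linarith
    have e2 : (5 / 2 - β) * j ≤ M * j := by gcongr; linarith
    have e3 : (-γ) * k ≤ M * k := by gcongr; linarith
    linarith
  calc _ ≤ pow2 (-(M * (i + j + k))) * (K * (pow2 (3 / 2 * i + 3 / 2 * j - k) *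
        (D.dyadicX i u * D.dyadicX j v * D.dyadicX k w))) := by
        gcongr
        exact (hT i j k u v w hu hv hw).1
    _ = K * (pow2 (-(M * (i + j + k)) + (3 / 2 * i + 3 / 2 * j - k)) *
        (D.dyadicX i u * D.dyadicX j v * D.dyadicX k w)) := by rw [pow2_add]; ring
    _ ≤ K * (pow2 (-(i + j + k)) *
        (D.weightedX α i u * D.weightedX β j v * D.weightedX γ k w)) := by
        rw [D.dyadicX_mul_eq α β γ]
        gcongr
        exact pow2_mono hx
    _ = _ := by ring

/-! ### Pairing of triple products with Schwartz functions -/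

open Classical in
/-- The quantity that controls the pairing of a triple product with Schwartz functions. -/
noncomputable def pairBound (M i j k : ℕ) (F : ℝ → ℝ≥0∞) : ℝ≥0∞ :=
  if SomeDominates i j k then pow2 (-(M * (i + j + k))) * ∫⁻ x, F x
  else ∫⁻ x, F x * ENNReal.ofReal (1 + x ^ 2)⁻¹

theorem enorm_integral_le_of_dominates' {D : Choices} {i j k : ℕ} (h : Dominates i j k)
    {u v w : ℝ → ℂ} (hu : IsReproduced u (D.wideSymbol i)) (hv : IsReproduced v (D.wideSymbol j))
    (hw : IsReproduced w (D.wideSymbol k)) (M : ℕ) (ψ : 𝓢(ℝ, ℂ)) :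
    ‖∫ y, u y * v y * w y * ψ y‖ₑ ≤
      ENNReal.ofReal (2 ^ (12 * M) * ∫ ξ, |ξ| ^ (3 * M) * ‖kern ψ ξ‖) *
        (pow2 (-(M * (i + j + k))) * ∫⁻ y, ‖u y * v y * w y‖ₑ) := by
  -- The order 3M suffices because i + j + k ≤ 3k, and 2^{12M} compensates for the shift by 4 in
  -- 2^{k-4}.
  refine (enorm_integral_le_of_dominates h hu hv hw (3 * M) ψ).trans ?_
  rw [← mul_assoc]
  gcongr
  have e : pow2 (-(M * ((i : ℝ) + j + k))) = ENNReal.ofReal (2 ^ (M * (i + j + k)))⁻¹ := by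
    rw [pow2_neg, ENNReal.ofReal_inv_of_pos (by positivity), ENNReal.ofReal_pow (by norm_num)]
    have : (M : ℝ) * ((i : ℝ) + j + k) = ((M * (i + j + k) : ℕ) : ℝ) := by push_cast; ring
    rw [this, pow2_natCast]
    norm_num
  have hI : 0 ≤ ∫ ξ, |ξ| ^ (3 * M) * ‖kern ψ ξ‖ := by positivity
  rw [e, ← ENNReal.ofReal_mul (by positivity)]
  apply ENNReal.ofReal_le_ofReal
  rw [← div_eq_mul_inv, div_le_div_iff₀ (by positivity) (by positivity), ← pow_mul]
  have hp : (2 : ℝ) ^ (M * (i + j + k)) ≤ 2 ^ (12 * M) * 2 ^ ((k - 4) * (3 * M)) := by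
    rw [← pow_add]
    refine pow_le_pow_right₀ (by norm_num) ?_
    obtain ⟨n, rfl⟩ : ∃ n, k = n + 4 := ⟨k - 4, by have := h.1; omega⟩
    have h1 : i + j + (n + 4) ≤ 3 * (n + 4) := by have := h.1; have := h.2; omega
    calc M * (i + j + (n + 4)) ≤ M * (3 * (n + 4)) := Nat.mul_le_mul_left _ h1
      _ = 12 * M + (n + 4 - 4) * (3 * M) := by rw [Nat.add_sub_cancel]; ring
  calc _ ≤ (∫ ξ, |ξ| ^ (3 * M) * ‖kern ψ ξ‖) * (2 ^ (12 * M) * 2 ^ ((k - 4) * (3 * M))) := by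
        gcongr
    _ = _ := by ring

/-- Dominated products see only the frequency tail of ψ; for the others only the spatial decay of ψ
is used. A single seminorm serves all indices, which makes the sum of all products a continuous
functional. -/
theorem exists_pairing_bound (M : ℕ) : ∃ (s : Finset (ℕ × ℕ)) (C : ℝ), 0 ≤ C ∧
    ∀ (D : Choices) (i j k : ℕ) (u v w : ℝ → ℂ), IsReproduced u (D.wideSymbol i) →
      IsReproduced v (D.wideSymbol j) → IsReproduced w (D.wideSymbol k) → ∀ ψ : 𝓢(ℝ, ℂ),
      ‖∫ y, u y * v y * w y * ψ y‖ₑ ≤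
        ENNReal.ofReal (C * s.sup (schwartzSeminormFamily ℂ ℝ ℂ) ψ) *
          pairBound M i j k (fun y => ‖u y‖ₑ * ‖v y‖ₑ * ‖w y‖ₑ) := by
  obtain ⟨s, C, hC0, hC⟩ := exists_schwartz_seminorm (3 * M)
  refine ⟨s, 2 ^ (12 * M) * C, by positivity, fun D i j k u v w hu hv hw ψ => ?_⟩
  obtain ⟨h1, h2⟩ := hC ψ
  have hle : ENNReal.ofReal (2 ^ (12 * M) * ∫ ξ, |ξ| ^ (3 * M) * ‖kern ψ ξ‖) ≤
      ENNReal.ofReal (2 ^ (12 * M) * C * s.sup (schwartzSeminormFamily ℂ ℝ ℂ) ψ) := by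
    apply ENNReal.ofReal_le_ofReal
    rw [mul_assoc]
    gcongr
  have hF : ∀ a b c : ℂ, ‖a * b * c‖ₑ = ‖a‖ₑ * ‖b‖ₑ * ‖c‖ₑ := fun a b c => by
    rw [enorm_mul, enorm_mul]
  unfold pairBound
  split_ifs with hd
  · rcases hd with hd | hd | hd
    · refine (enorm_integral_le_of_dominates' hd hu hv hw M ψ).trans ?_
      simp only [hF]
      gcongr
    · rw [show (fun y => u y * v y * w y * ψ y) = fun y => u y * w y * v y * ψ y by ext; ring]
      refine (enorm_integral_le_of_dominates' hd hu hw hv M ψ).trans ?_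
      simp only [hF, mul_right_comm _ ‖w _‖ₑ, add_right_comm (i : ℝ)]
      gcongr
    · rw [show (fun y => u y * v y * w y * ψ y) = fun y => v y * w y * u y * ψ y by ext; ring]
      refine (enorm_integral_le_of_dominates' hd hv hw hu M ψ).trans ?_
      simp only [hF]
      rw [show (fun y => ‖v y‖ₑ * ‖w y‖ₑ * ‖u y‖ₑ) = fun y => ‖u y‖ₑ * ‖v y‖ₑ * ‖w y‖ₑ by
        ext; ring, show (j : ℝ) + k + i = i + j + k by ring]
      gcongr
  · refine (enorm_integral_le_lintegral_enorm _).trans ?_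
    rw [← lintegral_const_mul' _ _ ENNReal.ofReal_ne_top]
    refine lintegral_mono fun y => ?_
    rw [enorm_mul, hF, mul_left_comm]
    gcongr
    rw [← ENNReal.ofReal_mul (by positivity), ← ofReal_norm]
    apply ENNReal.ofReal_le_ofReal
    rw [← div_eq_mul_inv, le_div_iff₀ (by positivity), mul_comm ‖ψ y‖, mul_assoc]
    refine (h2 y).trans (le_mul_of_one_le_left ?_ (one_le_pow₀ (by norm_num)))
    positivity

theorem lintegral_eq_tsum_cell1 (D : Choices) {F : ℝ → ℝ → ℝ≥0∞}
    (hF : Measurable (Function.uncurry F)) :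
    ∫⁻ t, (∫⁻ x, F t x) ∂unitTime = ∑' n, D.cell1 F n := by
  unfold cell1
  rw [← lintegral_tsum fun n => (measurable_lintegral hF _).aemeasurable]
  exact lintegral_congr fun t => D.lintegral_eq_tsum_Q _

/-- Relative to the unit interval containing 0 the weight decays quadratically, so its bounds on the
unit intervals are square summable. -/
theorem exists_lintegral_weight_le (D : Choices) : ∃ K : ℝ≥0∞, K < ⊤ ∧ ∀ F : ℝ → ℝ → ℝ≥0∞,
    Measurable (Function.uncurry F) →
    ∫⁻ t, (∫⁻ x, F t x * ENNReal.ofReal (1 + x ^ 2)⁻¹) ∂unitTime ≤ K * l2Sum (D.cell1 F) := by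
  obtain ⟨m, hm⟩ := mem_iUnion.1 (D.iUnion_Q_zero ▸ mem_univ (0 : ℝ) : (0 : ℝ) ∈ ⋃ n, D.Q 0 n)
  have hω : ∀ n, ∀ x ∈ D.Q 0 n, ENNReal.ofReal (1 + x ^ 2)⁻¹ ≤ 8 * decay (m - n) := by
    intro n x hx
    have h1 := D.abs_sub_ge hm hx
    rw [zero_sub, abs_neg] at h1
    rw [show (8 : ℝ≥0∞) = ENNReal.ofReal 8 by norm_num, decay, ← ENNReal.ofReal_mul (by norm_num)]
    apply ENNReal.ofReal_le_ofReal
    rw [← div_eq_mul_inv, inv_eq_one_div, div_le_div_iff₀ (by positivity) (by positivity), one_mul]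
    have h2 := sq_abs x
    have h3 := abs_nonneg ((m - n : ℤ) : ℝ)
    nlinarith [sq_nonneg (|x| - 1)]
  refine ⟨8 * decaySum, ENNReal.mul_lt_top (by norm_num) decaySum_lt_top, fun F hF => ?_⟩
  have hG : Measurable (Function.uncurry fun t x => F t x * ENNReal.ofReal (1 + x ^ 2)⁻¹) := by
    refine hF.mul ?_
    exact (show Measurable fun x : ℝ => ENNReal.ofReal (1 + x ^ 2)⁻¹ by fun_prop).comp
      measurable_snd
  rw [D.lintegral_eq_tsum_cell1 hG]
  calc _ ≤ ∑' n, 8 * decay (m - n) * D.cell1 F n := by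
        refine ENNReal.tsum_le_tsum fun n => ?_
        unfold cell1
        rw [← lintegral_const_mul _ (measurable_lintegral hF _)]
        refine lintegral_mono fun t => ?_
        rw [← lintegral_const_mul _ (measurable_slice hF t)]
        refine setLIntegral_mono' (D.measurableSet_Q 0 n) fun x hx => ?_
        rw [mul_comm]
        exact mul_le_mul_right (hω n x hx) _
    _ ≤ l2Sum (fun n => 8 * decay (m - n)) * l2Sum (D.cell1 F) := tsum_mul_le_l2Sum _ _
    _ ≤ _ := by
        gcongr
        refine (l2Sum_le_tsum _).trans (le_of_eq ?_)
        rw [ENNReal.tsum_mul_left, tsum_decay_sub]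

theorem measurable_pairBound (M i j k : ℕ) {F : ℝ → ℝ → ℝ≥0∞}
    (hF : Measurable (Function.uncurry F)) : Measurable fun t => pairBound M i j k (F t) := by
  unfold pairBound
  split_ifs
  · exact (measurable_lintegral hF _).const_mul _
  · refine measurable_lintegral (G := fun t x => F t x * ENNReal.ofReal (1 + x ^ 2)⁻¹)
      (hF.mul ?_) _
    exact (show Measurable fun x : ℝ => ENNReal.ofReal (1 + x ^ 2)⁻¹ by fun_prop).comp
      measurable_snd

/-- In the dominated case the total L¹ norm is at most the sum of the local L² norms, since [0,1] ×
Q has measure 1. Otherwise the weighted bound applies. -/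
theorem exists_lintegral_pairBound_le (D : Choices) : ∃ K : ℝ≥0∞, K < ⊤ ∧
    ∀ (M i j k : ℕ) (F : ℝ → ℝ → ℝ≥0∞) (B : ℝ≥0∞), Measurable (Function.uncurry F) →
    pow2 (-(M * (i + j + k))) * ∑' n, D.cell2 F n ≤ B →
    (¬ SomeDominates i j k → l2Sum (D.cell1 F) ≤ B) →
    ∫⁻ t, pairBound M i j k (F t) ∂unitTime ≤ K * B := by
  obtain ⟨K, hK, h⟩ := D.exists_lintegral_weight_le
  refine ⟨K + 1, ENNReal.add_lt_top.2 ⟨hK, by norm_num⟩, fun M i j k F B hF h1 h2 => ?_⟩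
  unfold pairBound
  split_ifs with hd
  · rw [lintegral_const_mul _ (measurable_lintegral hF _), D.lintegral_eq_tsum_cell1 hF]
    calc _ ≤ pow2 (-(M * (i + j + k))) * ∑' n, D.cell2 F n := by
          gcongr with n
          exact D.cell1_le_cell2 hF n
      _ ≤ 1 * B := by rw [one_mul]; exact h1
      _ ≤ _ := by gcongr; exact self_le_add_left _ _
  · calc _ ≤ K * l2Sum (D.cell1 F) := h F hF
      _ ≤ (K + 1) * B := by
        gcongr
        · exact self_le_add_right _ _
        · exact h2 hd

/-! ### Frequency localized parts of continuous families of distributions -/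

/-- The projection to the time interval `[0, 1]`. -/
noncomputable def clamp (t : ℝ) : ℝ := max 0 (min 1 t)

theorem clamp_mem (t : ℝ) : clamp t ∈ Icc (0 : ℝ) 1 :=
  ⟨le_max_left _ _, max_le (by norm_num) (min_le_left _ _)⟩

theorem clamp_of_mem {t : ℝ} (h : t ∈ Icc (0 : ℝ) 1) : clamp t = t := by
  rw [clamp, min_eq_right h.2, max_eq_right h.1]

theorem clamp_continuous : Continuous clamp := by unfold clamp; fun_prop

theorem normXj_congr (D : Choices) (i : ℕ) {g g' : ℝ → ℝ → ℂ}
    (h : ∀ t ∈ Icc (0 : ℝ) 1, g t = g' t) : D.normXj i g = D.normXj i g' := by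
  unfold normXj normX normLinfL2
  refine congrArg₂ (· + ·) (congrArg _ ?_) ?_
  · refine iSup_congr fun l => iSup_congr fun m => ?_
    congr 1
    refine eLpNorm_congr_ae ?_
    filter_upwards [ae_restrict_mem (measurableSet_Icc.prod (D.measurableSet_Q l m))] with z hz
    simp only [Function.uncurry, h z.1 hz.1]
  · refine essSup_congr_ae ?_
    filter_upwards [ae_restrict_mem measurableSet_Icc] with t ht
    rw [h t ht]

theorem weightedX_congr (D : Choices) (s : ℝ) (i : ℕ) {g g' : ℝ → ℝ → ℂ}
    (h : ∀ t ∈ Icc (0 : ℝ) 1, g t = g' t) : D.weightedX s i g = D.weightedX s i g' := by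
  unfold weightedX dyadicX l2Loc
  congr 3
  ext m
  congr 1
  exact D.normXj_congr i fun t ht => by rw [h t ht]

/-- The part of `u` with frequencies near `2^i`, extended from `[0, 1]` to all times. -/
noncomputable def band (D : Choices) (i : ℕ) (u : ℝ → 𝓢'(ℝ, ℂ)) (t : ℝ) : ℝ → ℂ :=
  D.SFun i (u (clamp t))

theorem band_of_mem (D : Choices) (i : ℕ) (u : ℝ → 𝓢'(ℝ, ℂ)) {t : ℝ} (h : t ∈ Icc (0 : ℝ) 1) :
    D.band i u t = D.SFun i (u t) := by rw [band, clamp_of_mem h]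

theorem weightedX_band (D : Choices) (s : ℝ) (i : ℕ) (u : ℝ → 𝓢'(ℝ, ℂ)) :
    D.weightedX s i (D.band i u) = D.weightedX s i (fun t => D.SFun i (u t)) :=
  D.weightedX_congr s i fun _ ht => D.band_of_mem i u ht

theorem continuous_band_time (D : Choices) (i : ℕ) {u : ℝ → 𝓢'(ℝ, ℂ)}
    (hu : ∀ ψ : 𝓢(ℝ, ℂ), ContinuousOn (fun t => u t ψ) (Icc 0 1)) (x : ℝ) :
    Continuous fun t => D.band i u t x := by
  have h := (hu (𝓕 (modulate x (D.symbol i)))).comp_continuous clamp_continuous clamp_mem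
  exact h.congr fun t => (D.SFun_eq_apply i _ x).symm

theorem measurable_band (D : Choices) (i : ℕ) {u : ℝ → 𝓢'(ℝ, ℂ)}
    (hu : ∀ ψ : 𝓢(ℝ, ℂ), ContinuousOn (fun t => u t ψ) (Icc 0 1)) :
    Measurable (Function.uncurry (D.band i u)) :=
  (stronglyMeasurable_uncurry_of_continuous_of_stronglyMeasurable
    (D.continuous_band_time i hu)
    fun t => (D.SFun_continuous i (u (clamp t))).stronglyMeasurable).measurable

/-- The essential supremum controls only almost every time. Such times are dense in [0,1], and
continuity in t with Fatou's lemma carries the bound to every time, as `IsBand` demands. -/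
theorem l2Norm_band_le (D : Choices) (i : ℕ) {u : ℝ → 𝓢'(ℝ, ℂ)}
    (hu : ∀ ψ : 𝓢(ℝ, ℂ), ContinuousOn (fun t => u t ψ) (Icc 0 1)) (t : ℝ) :
    l2Norm volume (fun x => ‖D.band i u t x‖ₑ) ≤ D.dyadicX i (D.band i u) := by
  set N := D.dyadicX i (D.band i u)
  have hm : ∀ t, Measurable (D.band i u t) := fun t =>
    (D.SFun_continuous i (u (clamp t))).measurable
  have hae := D.ae_l2Norm_le i hm
  rw [unitTime, ae_restrict_iff' measurableSet_Icc] at hae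
  have hd := Measure.dense_of_ae hae
  have hmem : clamp t ∈ closure (Ioo (0 : ℝ) 1 ∩
      {t | t ∈ Icc (0 : ℝ) 1 → l2Norm volume (fun x => ‖D.band i u t x‖ₑ) ≤ N}) := by
    have h1 := hd.open_subset_closure_inter (isOpen_Ioo (a := (0 : ℝ)) (b := 1))
    have h2 := closure_mono h1
    rw [closure_closure, closure_Ioo (by norm_num)] at h2
    exact h2 (clamp_mem t)
  obtain ⟨τ, hτ, hlim⟩ := mem_closure_iff_seq_limit.1 hmem
  have hb : D.band i u t = D.band i u (clamp t) := (D.band_of_mem i u (clamp_mem t)).symm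
  rw [hb]
  apply le_of_sq_le_sq
  rw [l2Norm_sq]
  calc ∫⁻ x, ‖D.band i u (clamp t) x‖ₑ ^ 2
      = ∫⁻ x, liminf (fun n => ‖D.band i u (τ n) x‖ₑ ^ 2) atTop := by
        refine lintegral_congr fun x => ?_
        have h := ((D.continuous_band_time i hu x).tendsto (clamp t)).comp hlim
        have h2 := ((ENNReal.continuous_pow 2).tendsto _).comp h.enorm
        exact h2.liminf_eq.symm
    _ ≤ liminf (fun n => ∫⁻ x, ‖D.band i u (τ n) x‖ₑ ^ 2) atTop :=
        lintegral_liminf_le fun n => (hm _).enorm.pow_const 2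
    _ ≤ N ^ 2 := by
        refine Filter.liminf_le_of_frequently_le' (Eventually.frequently ?_)
        refine Eventually.of_forall fun n => ?_
        rw [← l2Norm_sq]
        gcongr
        exact (hτ n).2 (Ioo_subset_Icc_self (hτ n).1)

theorem isBand_band (D : Choices) (s : ℝ) {u : ℝ → 𝓢'(ℝ, ℂ)} (h : D.MemL2X s u) (i : ℕ) :
    D.IsBand i (D.band i u) := by
  have hfin : D.dyadicX i (D.band i u) < ⊤ := by
    rw [D.dyadicX_eq_weightedX s, D.weightedX_band]
    refine ENNReal.mul_lt_top (pow2_ne_top _).lt_top (lt_of_le_of_lt ?_ h.2)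
    rw [normL2X_eq]
    exact le_l2Sum (fun i => D.weightedX s i (fun t => D.SFun i (u t))) i
  exact ⟨D.measurable_band i h.1, fun t =>
    D.isReproduced_SFun i _ ((D.l2Norm_band_le i h.1 t).trans_lt hfin)⟩

theorem l2Sum_weightedX_band (D : Choices) (s : ℝ) (u : ℝ → 𝓢'(ℝ, ℂ)) :
    l2Sum (fun i => D.weightedX s i (D.band i u)) = D.normL2X s u := by
  simp_rw [weightedX_band]
  rw [normL2X_eq]

/-! ### Distributions given by sums of triple products -/

/-- The product of the functions with the indices `p`. -/
noncomputable def prodAt (U V W : ℕ → ℝ → ℝ → ℂ) (p : ℕ × ℕ × ℕ) (t x : ℝ) : ℂ :=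
  U p.1 t x * V p.2.1 t x * W p.2.2 t x

/-- The modulus of the product of the functions with the indices `p`. -/
noncomputable def tripleAt (U V W : ℕ → ℝ → ℝ → ℂ) (p : ℕ × ℕ × ℕ) : ℝ → ℝ → ℝ≥0∞ :=
  triple (U p.1) (V p.2.1) (W p.2.2)

/-- The quantity that controls the pairing of the product with Schwartz functions. -/
noncomputable def pairAt (M : ℕ) (U V W : ℕ → ℝ → ℝ → ℂ) (p : ℕ × ℕ × ℕ) (t : ℝ) : ℝ≥0∞ :=
  pairBound M p.1 p.2.1 p.2.2 (tripleAt U V W p t)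

variable {D : Choices} {U V W : ℕ → ℝ → ℝ → ℂ}

theorem enorm_prodAt (p : ℕ × ℕ × ℕ) (t x : ℝ) :
    ‖prodAt U V W p t x‖ₑ = tripleAt U V W p t x := by
  rw [prodAt, enorm_mul, enorm_mul]; rfl

theorem integrable_prodAt_mul (hU : ∀ i, D.IsBand i (U i)) (hV : ∀ i, D.IsBand i (V i))
    (hW : ∀ i, D.IsBand i (W i)) (p : ℕ × ℕ × ℕ) (t : ℝ) (ψ : 𝓢(ℝ, ℂ)) :
    Integrable fun x => prodAt U V W p t x * ψ x := by
  have := ((hU p.1).reproduced t).integrable_mul (((hV p.2.1).reproduced t).integrable_mul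
    (((hW p.2.2).reproduced t).integrable_mul ψ.integrable))
  refine this.congr (Eventually.of_forall fun y => ?_)
  simp only [prodAt]; ring

theorem measurable_prodAt (hU : ∀ i, D.IsBand i (U i)) (hV : ∀ i, D.IsBand i (V i))
    (hW : ∀ i, D.IsBand i (W i)) (p : ℕ × ℕ × ℕ) :
    Measurable (Function.uncurry (prodAt U V W p)) :=
  ((hU p.1).measurable.mul (hV p.2.1).measurable).mul (hW p.2.2).measurable

theorem measurable_tripleAt (hU : ∀ i, D.IsBand i (U i)) (hV : ∀ i, D.IsBand i (V i))
    (hW : ∀ i, D.IsBand i (W i)) (p : ℕ × ℕ × ℕ) :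
    Measurable (Function.uncurry (tripleAt U V W p)) :=
  measurable_triple (hU p.1).measurable (hV p.2.1).measurable (hW p.2.2).measurable

theorem measurable_pairing (hU : ∀ i, D.IsBand i (U i)) (hV : ∀ i, D.IsBand i (V i))
    (hW : ∀ i, D.IsBand i (W i)) (p : ℕ × ℕ × ℕ) (ψ : 𝓢(ℝ, ℂ)) :
    Measurable fun t => ∫ x, prodAt U V W p t x * ψ x := by
  have h : Measurable fun z : ℝ × ℝ => prodAt U V W p z.1 z.2 * ψ z.2 :=
    (measurable_prodAt hU hV hW p).mul (ψ.continuous.measurable.comp measurable_snd)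
  exact (h.stronglyMeasurable.integral_prod_right' (ν := volume)).measurable

/-- Each pairing is at most one Schwartz seminorm of ψ times `pairAt`. Where `pairAt` is summable
the series therefore converges absolutely, to a functional bounded by that seminorm. The factor c
depends on ψ alone, not on time. -/
theorem exists_distribution (M : ℕ) (hU : ∀ i, D.IsBand i (U i)) (hV : ∀ i, D.IsBand i (V i))
    (hW : ∀ i, D.IsBand i (W i)) (I : Set (ℕ × ℕ × ℕ)) : ∃ (c : 𝓢(ℝ, ℂ) → ℝ≥0),
    (∀ (p : ℕ × ℕ × ℕ) t ψ,
      ‖∫ x, prodAt U V W p t x * ψ x‖ₑ ≤ c ψ * pairAt M U V W p t) ∧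
    ∀ t, ∑' p : I, pairAt M U V W p t < ⊤ → ∃ T : 𝓢'(ℝ, ℂ), ∀ ψ,
      HasSum (fun p : I => ∫ x, prodAt U V W p t x * ψ x) (T ψ) := by
  obtain ⟨s, C, hC0, hC⟩ := exists_pairing_bound M
  let q : 𝓢(ℝ, ℂ) → ℝ := fun ψ => C * s.sup (schwartzSeminormFamily ℂ ℝ ℂ) ψ
  have hq : ∀ ψ, 0 ≤ q ψ := fun ψ => by positivity
  have hb : ∀ (p : ℕ × ℕ × ℕ) t ψ,
      ‖∫ x, prodAt U V W p t x * ψ x‖ₑ ≤ ENNReal.ofReal (q ψ) * pairAt M U V W p t :=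
    fun p t ψ => hC D p.1 p.2.1 p.2.2 _ _ _ ((hU p.1).reproduced t) ((hV p.2.1).reproduced t)
      ((hW p.2.2).reproduced t) ψ
  refine ⟨fun ψ => (q ψ).toNNReal, hb, fun t ht => ?_⟩
  have hfin : ∀ p : I, pairAt M U V W p t ≠ ⊤ := ENNReal.ne_top_of_tsum_ne_top ht.ne
  have hs : Summable fun p : I => (pairAt M U V W p t).toReal := ENNReal.summable_toReal ht.ne
  have hn : ∀ (p : I) ψ,
      ‖∫ x, prodAt U V W p t x * ψ x‖ ≤ q ψ * (pairAt M U V W p t).toReal := fun p ψ => by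
    have := ENNReal.toReal_mono (ENNReal.mul_ne_top ENNReal.ofReal_ne_top (hfin p)) (hb p t ψ)
    rwa [toReal_enorm, ENNReal.toReal_mul, ENNReal.toReal_ofReal (hq ψ)] at this
  have hsum : ∀ ψ : 𝓢(ℝ, ℂ), Summable fun p : I => ∫ x, prodAt U V W p t x * ψ x := fun ψ =>
    Summable.of_norm_bounded (hs.mul_left _) fun p => hn p ψ
  let L : 𝓢(ℝ, ℂ) →L[ℂ] ℂ := SchwartzMap.mkCLMtoNormedSpace
    (fun ψ => ∑' p : I, ∫ x, prodAt U V W p t x * ψ x)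
    (fun ψ η => by
      rw [← (hsum ψ).tsum_add (hsum η)]
      refine tsum_congr fun p => ?_
      rw [← integral_add (integrable_prodAt_mul hU hV hW p t ψ)
        (integrable_prodAt_mul hU hV hW p t η)]
      simp only [_root_.add_apply, mul_add])
    (fun a ψ => by
      rw [RingHom.id_apply, smul_eq_mul, ← (hsum ψ).tsum_mul_left]
      refine tsum_congr fun p => ?_
      rw [← integral_const_mul]
      refine integral_congr_ae (Eventually.of_forall fun x => ?_)
      simp only [_root_.smul_apply, smul_eq_mul]; ring)
    ⟨s, C * ∑' p : I, (pairAt M U V W p t).toReal,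
      mul_nonneg hC0 (tsum_nonneg fun _ => ENNReal.toReal_nonneg), fun ψ => by
      refine (tsum_of_norm_bounded (hs.mul_left (q ψ)).hasSum fun p => hn p ψ).trans ?_
      rw [tsum_mul_left]
      exact le_of_eq (by simp only [q]; ring)⟩
  exact ⟨ContinuousLinearMap.toPointwiseConvergenceCLM _ _ _ _ L, fun ψ => (hsum ψ).hasSum⟩

/-- The distribution that is the sum of the products over the indices in `I`. -/
structure IsSumOver (M : ℕ) (U V W : ℕ → ℝ → ℝ → ℂ) (I : Set (ℕ × ℕ × ℕ))
    (f : ℝ → 𝓢'(ℝ, ℂ)) : Prop where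
  hasSum : ∀ t, ∑' p : I, pairAt M U V W p t < ⊤ → ∀ ψ : 𝓢(ℝ, ℂ),
    HasSum (fun p : I => ∫ x, prodAt U V W p t x * ψ x) (f t ψ)
  eq_zero : ∀ t, ¬ ∑' p : I, pairAt M U V W p t < ⊤ → f t = 0
  tail : ∀ ψ : 𝓢(ℝ, ℂ), ∃ c : ℝ≥0, ∀ t, ∑' p : I, pairAt M U V W p t < ⊤ → ∀ S : Finset I,
    ‖(∑ p ∈ S, ∫ x, prodAt U V W p t x * ψ x) - f t ψ‖ₑ ≤
      c * ∑' p : {p : I // p ∉ S}, pairAt M U V W p t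

theorem exists_isSumOver (M : ℕ) (hU : ∀ i, D.IsBand i (U i)) (hV : ∀ i, D.IsBand i (V i))
    (hW : ∀ i, D.IsBand i (W i)) (I : Set (ℕ × ℕ × ℕ)) : ∃ f, IsSumOver M U V W I f := by
  classical
  obtain ⟨c, hc, h⟩ := exists_distribution M hU hV hW I
  choose T hT using h
  have hgood : ∀ t (ht : ∑' p : I, pairAt M U V W p t < ⊤), (if ht :
      ∑' p : I, pairAt M U V W p t < ⊤ then T t ht else 0) = T t ht := fun t ht => dif_pos ht
  -- The remaining times get the value 0. This keeps f measurable and makes the bounds for S_l f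
  -- trivial there.
  refine ⟨fun t => if ht : ∑' p : I, pairAt M U V W p t < ⊤ then T t ht else 0, ?_, ?_, ?_⟩
  · intro t ht ψ
    rw [hgood t ht]
    exact hT t ht ψ
  · intro t ht
    exact dif_neg ht
  · intro ψ
    refine ⟨c ψ, fun t ht S => ?_⟩
    rw [hgood t ht, ← (hT t ht ψ).tsum_eq, ← (hT t ht ψ).summable.sum_add_tsum_subtype_compl S,
      sub_add_cancel_left, enorm_neg]
    refine enorm_tsum_le_tsum_enorm.trans ?_
    rw [← ENNReal.tsum_mul_left]
    exact ENNReal.tsum_le_tsum fun p => hc p t ψ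

variable {M : ℕ} {I : Set (ℕ × ℕ × ℕ)} {f : ℝ → 𝓢'(ℝ, ℂ)}

theorem measurable_pairAt (M : ℕ) (hU : ∀ i, D.IsBand i (U i)) (hV : ∀ i, D.IsBand i (V i))
    (hW : ∀ i, D.IsBand i (W i)) (p : ℕ × ℕ × ℕ) : Measurable (pairAt M U V W p) :=
  measurable_pairBound M _ _ _ (measurable_tripleAt hU hV hW p)

theorem IsSumOver.measurable (h : IsSumOver M U V W I f) (hU : ∀ i, D.IsBand i (U i))
    (hV : ∀ i, D.IsBand i (V i)) (hW : ∀ i, D.IsBand i (W i)) (ψ : 𝓢(ℝ, ℂ)) :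
    Measurable fun t => f t ψ := by
  let G : Set ℝ := {t | ∑' p : I, pairAt M U V W p t < ⊤}
  have hG : MeasurableSet G := measurableSet_lt
    (Measurable.tsum fun p : I => measurable_pairAt M hU hV hW p) measurable_const
  refine measurable_of_tendsto_metrizable' (atTop : Filter (Finset I))
    (f := fun S : Finset I => G.indicator fun t => ∑ p ∈ S, ∫ x, prodAt U V W p t x * ψ x) (fun S => ?_) ?_
  · exact (Finset.measurable_fun_sum S fun p _ => measurable_pairing hU hV hW p ψ).indicator hG
  · rw [tendsto_pi_nhds]
    intro t
    by_cases ht : t ∈ G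
    · simp only [indicator_of_mem ht]
      exact h.hasSum t ht ψ
    · simp only [indicator_of_notMem ht]
      rw [h.eq_zero t ht]
      exact tendsto_const_nhds

theorem IsSumOver.measurable_SFun (h : IsSumOver M U V W I f) (hU : ∀ i, D.IsBand i (U i))
    (hV : ∀ i, D.IsBand i (V i)) (hW : ∀ i, D.IsBand i (W i)) (l : ℕ) :
    Measurable (Function.uncurry fun t => D.SFun l (f t)) := by
  have h1 := stronglyMeasurable_uncurry_of_continuous_of_stronglyMeasurable
    (u := fun x t => D.SFun l (f t) x) (fun t => D.SFun_continuous l (f t)) fun x => by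
      have := h.measurable hU hV hW (𝓕 (modulate x (D.symbol l)))
      refine Measurable.stronglyMeasurable ?_
      simp_rw [SFun_eq_apply]
      exact this
  exact h1.measurable.comp measurable_swap

/-- S_l f(x) is the pairing of f with a Schwartz function, so it may be expanded in the series.
Terms whose frequencies miss 2^l vanish, and the others are bounded by moving the modulus inside. -/
theorem IsSumOver.enorm_SFun_le (h : IsSumOver M U V W I f) (hU : ∀ i, D.IsBand i (U i))
    (hV : ∀ i, D.IsBand i (V i)) (hW : ∀ i, D.IsBand i (W i)) (l : ℕ) (t x : ℝ) :
    ‖D.SFun l (f t) x‖ₑ ≤ ∑' p : {p : I // Interacts p.1.1 p.1.2.1 p.1.2.2 l},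
      conv (D.absKern l) (tripleAt U V W p) t x := by
  rw [SFun_eq_apply]
  by_cases ht : ∑' p : I, pairAt M U V W p t < ⊤
  · rw [← (h.hasSum t ht _).tsum_eq]
    refine enorm_tsum_le_tsum_enorm.trans ?_
    rw [← tsum_subtype_eq_of_support_subset
      (s := {p : I | Interacts p.1.1 p.1.2.1 p.1.2.2 l}) fun p hp => ?_]
    · refine ENNReal.tsum_le_tsum fun p => ?_
      refine (enorm_integral_le_lintegral_enorm _).trans (le_of_eq ?_)
      unfold conv
      refine lintegral_congr fun y => ?_
      rw [enorm_mul, enorm_prodAt, fourier_modulate, mul_comm]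
      rfl
    · by_contra hi
      exact hp (by
        beta_reduce
        rw [enorm_eq_zero]
        exact integral_eq_zero_of_not_interacts hi ((hU _).reproduced t) ((hV _).reproduced t)
          ((hW _).reproduced t) x)
  · rw [h.eq_zero t ht]
    simp

/-- The bound in `l²Y^s` for a sum of products. -/
theorem IsSumOver.normL2Y_le (h : IsSumOver M U V W I f) (hU : ∀ i, D.IsBand i (U i))
    (hV : ∀ i, D.IsBand i (V i)) (hW : ∀ i, D.IsBand i (W i)) {s : ℝ}
    (dom : ℕ × ℕ × ℕ → Prop) (B : ℕ → ℕ × ℕ × ℕ → ℝ≥0∞)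
    (hB : ∀ l, ∀ p ∈ I, Interacts p.1 p.2.1 p.2.2 l →
      D.IsTripleBound s l (dom p) (tripleAt U V W p) (B l p)) :
    D.normL2Y s f ≤ 8 * l2Sum fun l => ∑' p, B l p := by
  rw [normL2Y_eq, ← l2Sum_const_mul]
  refine l2Sum_mono fun l => ?_
  refine (D.l2Loc_normYj_le_tsum s l
    (ι := {p : I // Interacts p.1.1 p.1.2.1 p.1.2.2 l}) (fun p => dom p)
    (fun p => measurable_tripleAt hU hV hW p) (fun p => B l p)
    (fun p => hB l _ p.1.2 p.2) (h.measurable_SFun hU hV hW l)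
    (h.enorm_SFun_le hU hV hW l)).trans ?_
  gcongr
  exact ENNReal.tsum_comp_le_tsum_of_injective
    (f := fun p : {p : I // Interacts p.1.1 p.1.2.1 p.1.2.2 l} => (p : ℕ × ℕ × ℕ))
    (Subtype.val_injective.comp Subtype.val_injective) (B l)

/-! ### The product of three functions -/

/-- The indices at most `N - 1`. -/
def cube (N : ℕ) : Finset (ℕ × ℕ × ℕ) :=
  Finset.range N ×ˢ Finset.range N ×ˢ Finset.range N

theorem sum_prodAt (U V W : ℕ → ℝ → ℝ → ℂ) (A B C : Finset ℕ) (t x : ℝ) :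
    ∑ p ∈ A ×ˢ B ×ˢ C, prodAt U V W p t x =
      (∑ i ∈ A, U i t x) * (∑ j ∈ B, V j t x) * ∑ k ∈ C, W k t x := by
  rw [Finset.sum_product, mul_assoc, Finset.sum_mul]
  refine Finset.sum_congr rfl fun i _ => ?_
  rw [Finset.sum_product, Finset.sum_mul, Finset.mul_sum]
  refine Finset.sum_congr rfl fun j _ => ?_
  rw [Finset.mul_sum, Finset.mul_sum]
  refine Finset.sum_congr rfl fun k _ => ?_
  unfold prodAt; ring

theorem sum_integral_prodAt (hU : ∀ i, D.IsBand i (U i)) (hV : ∀ i, D.IsBand i (V i))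
    (hW : ∀ i, D.IsBand i (W i)) (A B C : Finset ℕ) (t : ℝ) (ψ : 𝓢(ℝ, ℂ)) :
    Integrable (fun x =>
      (∑ i ∈ A, U i t x) * (∑ j ∈ B, V j t x) * (∑ k ∈ C, W k t x) * ψ x) ∧
    ∑ p ∈ A ×ˢ B ×ˢ C, ∫ x, prodAt U V W p t x * ψ x =
      ∫ x, (∑ i ∈ A, U i t x) * (∑ j ∈ B, V j t x) * (∑ k ∈ C, W k t x) * ψ x := by
  have hi := fun p => integrable_prodAt_mul hU hV hW p t ψ
  have e : (fun x => (∑ i ∈ A, U i t x) * (∑ j ∈ B, V j t x) * (∑ k ∈ C, W k t x) * ψ x) =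
      fun x => ∑ p ∈ A ×ˢ B ×ˢ C, prodAt U V W p t x * ψ x := by
    ext x
    rw [← sum_prodAt, Finset.sum_mul]
  rw [e]
  exact ⟨integrable_finsetSum _ fun p _ => hi p, (integral_finsetSum _ fun p _ => hi p).symm⟩

/-- The partial products converge in `L¹([0,1]; 𝓢')` if the pairings are summable. -/
theorem IsSumOver.tendsto (h : IsSumOver M U V W univ f) (hU : ∀ i, D.IsBand i (U i))
    (hV : ∀ i, D.IsBand i (V i)) (hW : ∀ i, D.IsBand i (W i))
    (hfin : ∑' p, ∫⁻ t, pairAt M U V W p t ∂unitTime < ⊤) (ψ : 𝓢(ℝ, ℂ)) :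
    Tendsto (fun N : ℕ => ∫⁻ t, ‖(∫ x, (∑ i ∈ Finset.range N, U i t x) *
      (∑ i ∈ Finset.range N, V i t x) * (∑ i ∈ Finset.range N, W i t x) * ψ x) - f t ψ‖ₑ
        ∂unitTime) atTop (𝓝 0) := by
  obtain ⟨c, hc⟩ := h.tail ψ
  have hm := fun p => measurable_pairAt M hU hV hW p
  have hfin' : ∑' p : (univ : Set (ℕ × ℕ × ℕ)), ∫⁻ t, pairAt M U V W p t ∂unitTime < ⊤ := by
    rwa [tsum_univ fun p => ∫⁻ t, pairAt M U V W p t ∂unitTime]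
  have hgood : ∀ᵐ t ∂unitTime, ∑' p : (univ : Set (ℕ × ℕ × ℕ)), pairAt M U V W p t < ⊤ := by
    refine ae_lt_top (Measurable.tsum fun p : (univ : Set (ℕ × ℕ × ℕ)) => hm p) ?_
    rw [lintegral_tsum fun p : (univ : Set (ℕ × ℕ × ℕ)) => (hm p).aemeasurable]
    exact hfin'.ne
  -- The product of the three partial sums is the sum over a cube. The cubes exhaust all indices, so
  -- absolute summability gives convergence along them.
  let S : ℕ → Finset (univ : Set (ℕ × ℕ × ℕ)) := fun N => (cube N).subtype (· ∈ univ)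
  have hS : Tendsto S atTop atTop := by
    refine tendsto_atTop_finset_of_monotone (fun a b hab p hp => ?_) fun p => ?_
    · simp only [S, cube, Finset.mem_subtype, Finset.mem_product, Finset.mem_range] at hp ⊢
      omega
    · refine ⟨p.1.1 + p.1.2.1 + p.1.2.2 + 1, ?_⟩
      simp only [S, cube, Finset.mem_subtype, Finset.mem_product, Finset.mem_range]
      omega
  have hlim := (ENNReal.tendsto_tsum_compl_atTop_zero hfin'.ne).comp hS
  have hlim2 := ENNReal.Tendsto.const_mul (a := (c : ℝ≥0∞)) hlim (Or.inr ENNReal.coe_ne_top)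
  rw [mul_zero] at hlim2
  refine tendsto_of_tendsto_of_tendsto_of_le_of_le tendsto_const_nhds hlim2
    (fun N => zero_le) fun N => ?_
  simp only [Function.comp]
  rw [← lintegral_tsum fun p : {p : (univ : Set (ℕ × ℕ × ℕ)) // p ∉ S N} => (hm p).aemeasurable,
    ← lintegral_const_mul _ (Measurable.tsum
      fun p : {p : (univ : Set (ℕ × ℕ × ℕ)) // p ∉ S N} => hm p)]
  refine lintegral_mono_ae ?_
  filter_upwards [hgood] with t ht
  refine le_trans (le_of_eq ?_) (hc t ht (S N))
  congr 2
  rw [← (sum_integral_prodAt hU hV hW _ _ _ t ψ).2]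
  exact (Finset.sum_subtype_of_mem (fun p => ∫ x, prodAt U V W p t x * ψ x)
    fun p _ => mem_univ p).symm

theorem SLowFun_eq_sum_band (D : Choices) (N : ℕ) (u : ℝ → 𝓢'(ℝ, ℂ)) {t : ℝ}
    (ht : t ∈ Icc (0 : ℝ) 1) (x : ℝ) :
    D.SLowFun N (u t) x = ∑ i ∈ Finset.range N, D.band i u t x := by
  unfold SLowFun
  exact Finset.sum_congr rfl fun i _ => by rw [D.band_of_mem i u ht]

/-- The sum of all products, as constructed by `exists_isSumOver`, is the limit. Its norm comes from
the symmetric bounds, its convergence from the summability of the pairings. -/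
theorem exists_product (D : Choices) {s α β γ : ℝ} (hs : -3 / 2 ≤ s)
    (hsum : s + 1 < α + β + γ) (hα : s - 2 ≤ α) (hβ : s - 2 ≤ β) (hγ : s - 2 ≤ γ)
    (hαβ : s - 1 / 2 < α + β) (hβγ : s - 1 / 2 < β + γ) (hγα : s - 1 / 2 < γ + α) :
    ∃ C : ℝ≥0, ∀ u v w : ℝ → 𝓢'(ℝ, ℂ), D.MemL2X α u → D.MemL2X β v → D.MemL2X γ w →
      ∃ f : ℝ → 𝓢'(ℝ, ℂ), D.IsProduct u v w f ∧ D.MemL2Y s f ∧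
        D.normL2Y s f ≤ C * D.normL2X α u * D.normL2X β v * D.normL2X γ w := by
  obtain ⟨K, hK, δ, hδ, hsym⟩ := D.exists_sym_bound hs hsum hα hβ hγ hαβ hβγ hγα
  obtain ⟨K₁, hK₁, M, hcrude⟩ := D.exists_crude_bound α β γ
  obtain ⟨K₂, hK₂, hpair⟩ := D.exists_lintegral_pairBound_le
  have hG := gainSum_lt_top hδ
  have hC : 8 * (K * (3 * gainSum δ ^ 3)) ≠ ⊤ := by
    refine ENNReal.mul_ne_top (by norm_num) (ENNReal.mul_ne_top hK.ne
      (ENNReal.mul_ne_top (by norm_num) (ENNReal.pow_ne_top hG.ne)))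
  refine ⟨(8 * (K * (3 * gainSum δ ^ 3))).toNNReal, fun u v w hu hv hw => ?_⟩
  rw [ENNReal.coe_toNNReal hC]
  have hU := D.isBand_band α hu
  have hV := D.isBand_band β hv
  have hW := D.isBand_band γ hw
  set a : ℕ → ℝ≥0∞ := fun i => D.weightedX α i (D.band i u)
  set b : ℕ → ℝ≥0∞ := fun i => D.weightedX β i (D.band i v)
  set c : ℕ → ℝ≥0∞ := fun i => D.weightedX γ i (D.band i w)
  have ha : l2Sum a = D.normL2X α u := D.l2Sum_weightedX_band α u
  have hb : l2Sum b = D.normL2X β v := D.l2Sum_weightedX_band β v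
  have hc : l2Sum c = D.normL2X γ w := D.l2Sum_weightedX_band γ w
  obtain ⟨f, hf⟩ := exists_isSumOver M hU hV hW univ
  have hnorm : D.normL2Y s f ≤
      8 * (K * (3 * gainSum δ ^ 3)) * D.normL2X α u * D.normL2X β v * D.normL2X γ w := by
    refine (hf.normL2Y_le hU hV hW (fun p => SomeDominates p.1 p.2.1 p.2.2)
      (fun l p => K * (symKernel δ p.1 p.2.1 p.2.2 l * (a p.1 * b p.2.1 * c p.2.2)))
      fun l p _ hl => ?_).trans ?_
    · have := (hsym p.1 p.2.1 p.2.2 _ _ _ (hU p.1) (hV p.2.1) (hW p.2.2)).1 l hl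
      rwa [mul_left_comm] at this
    · simp_rw [ENNReal.tsum_mul_left]
      rw [l2Sum_const_mul]
      calc _ ≤ 8 * (K * (3 * gainSum δ ^ 3 * (l2Sum a * l2Sum b * l2Sum c))) := by
            gcongr
            exact l2Sum_symKernel_le δ a b c
        _ = _ := by rw [ha, hb, hc]; ring
  refine ⟨f, fun ψ => ?_, ⟨fun ψ => (hf.measurable hU hV hW ψ).aemeasurable, ?_⟩, hnorm⟩
  · have hfin : ∑' p, ∫⁻ t, pairAt M (fun i => D.band i u) (fun i => D.band i v)
        (fun i => D.band i w) p t ∂unitTime < ⊤ := by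
      -- The dominated pairings decay at rate 1 (`exists_crude_bound`), the others at rate δ. With l
      -- = 0, `gainKernel ε` is just 2^{-ε(i+j+k)}.
      set ε := min δ 1
      have hε : 0 < ε := lt_min hδ one_pos
      have hp : ∀ p : ℕ × ℕ × ℕ, ∫⁻ t, pairAt M (fun i => D.band i u) (fun i => D.band i v)
          (fun i => D.band i w) p t ∂unitTime ≤ K₂ * ((K + K₁) *
            (gainKernel ε p.1 p.2.1 p.2.2 0 * (a p.1 * b p.2.1 * c p.2.2))) := fun p => by
        have h0 : (0 : ℝ) ≤ p.1 + p.2.1 + p.2.2 := by positivity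
        have hg : ∀ η, ε ≤ η → pow2 (-(η * (p.1 + p.2.1 + p.2.2))) ≤
            gainKernel ε p.1 p.2.1 p.2.2 0 := fun η hη => by
          rw [gainKernel_eq]
          apply pow2_mono
          have := mul_le_mul_of_nonneg_right hη h0
          rw [Nat.cast_zero, zero_sub, abs_neg, abs_of_nonneg (Nat.cast_nonneg _)]
          linarith
        refine hpair M _ _ _ _ _ (measurable_tripleAt hU hV hW p) ?_ fun hd => ?_
        · refine (hcrude p.1 p.2.1 p.2.2 _ _ _ (hU p.1) (hV p.2.1) (hW p.2.2)).trans ?_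
          have := hg 1 (min_le_right _ _)
          rw [one_mul] at this
          rw [mul_left_comm]
          gcongr
          exact self_le_add_left _ _
        · refine ((hsym p.1 p.2.1 p.2.2 _ _ _ (hU p.1) (hV p.2.1) (hW p.2.2)).2 hd).trans ?_
          rw [mul_left_comm]
          gcongr
          · exact self_le_add_right _ _
          · exact hg δ (min_le_left _ _)
      refine (ENNReal.tsum_le_tsum hp).trans_lt ?_
      rw [ENNReal.tsum_mul_left, ENNReal.tsum_mul_left, tsum_gainKernel]
      have hGε := gainSum_lt_top hε
      have h1 : ∀ x : ℕ → ℝ≥0∞, l2Sum x < ⊤ → ∑' i : ℕ, gain ε i * x i < ⊤ := fun x hx =>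
        (tsum_gain_mul_le ε x).trans_lt (ENNReal.mul_lt_top hGε hx)
      refine ENNReal.mul_lt_top hK₂ (ENNReal.mul_lt_top (ENNReal.add_lt_top.2 ⟨hK, hK₁⟩)
        (ENNReal.mul_lt_top (ENNReal.mul_lt_top (h1 a (ha ▸ hu.2)) (h1 b (hb ▸ hv.2))) ?_))
      have h3 := h1 c (hc ▸ hw.2)
      simpa only [Nat.cast_zero, zero_sub, gain_neg] using h3
    refine (hf.tendsto hU hV hW hfin ψ).congr fun N => ?_
    refine setLIntegral_congr_fun measurableSet_Icc fun t ht => ?_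
    simp only [D.SLowFun_eq_sum_band N _ ht]
  · refine hnorm.trans_lt ?_
    exact ENNReal.mul_lt_top (ENNReal.mul_lt_top (ENNReal.mul_lt_top hC.lt_top hu.2) hv.2) hw.2

/-! ### Products with two localized factors -/

theorem sum_symbol (D : Choices) (n : ℕ) :
    ∑ i ∈ Finset.range (n + 1), D.symbol i = D.lowSymbol n := by
  induction n with
  | zero => simp [symbol]
  | succ n ih =>
    rw [Finset.sum_range_succ, ih]
    simp [symbol]

/-- The sum telescopes. For j ≤ 1 the truncated j - 1 is 0, so nothing is subtracted, in agreement
with the second case of `wideSymbol`. -/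
theorem sum_symbol_near (D : Choices) (j : ℕ) :
    ∑ i ∈ Finset.Icc (j - 1) (j + 1), D.symbol i = D.wideSymbol j := by
  have e : Finset.Icc (j - 1) (j + 1) = Finset.Ico (j - 1) (j + 1 + 1) := by
    ext; simp
  rw [e, Finset.sum_Ico_eq_sub _ (by omega), sum_symbol]
  unfold wideSymbol
  split_ifs with h
  · rw [show j - 1 = j - 2 + 1 by omega, sum_symbol]
  · rw [show j - 1 = 0 by omega]
    simp

theorem SFun_S (D : Choices) (i j : ℕ) (T : 𝓢'(ℝ, ℂ)) (x : ℝ) :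
    D.SFun i (D.S j T) x = (𝓕 T) (mulS (D.symbol j) (modulate x (D.symbol i))) := by
  rw [SFun_eq, S, TemperedDistribution.fourierMultiplierCLM_apply,
    FourierTransform.fourier_fourierInv_eq, TemperedDistribution.smulLeftCLM_apply_apply]
  have : (fun ξ => (D.φ j ξ : ℂ)) = D.symbol j := by
    ext ξ; rw [symbol_apply]
  rw [this, mulS]

/-- In part b) only S_j v is controlled, not v. Since the wide symbol is the sum of three
neighbouring φ_i, S_j v is the sum of the three neighbouring pieces of S_j v itself. -/
theorem SFun_eq_sum_SFun_S (D : Choices) (j : ℕ) (T : 𝓢'(ℝ, ℂ)) (x : ℝ) :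
    D.SFun j T x = ∑ i ∈ Finset.Icc (j - 1) (j + 1), D.SFun i (D.S j T) x := by
  simp_rw [SFun_S]
  rw [SFun_eq, ← map_sum]
  congr 1
  ext ξ
  rw [_root_.sum_apply]
  simp only [mulS_apply, modulate_apply]
  calc wave x ξ * D.symbol j ξ = wave x ξ * (D.symbol j ξ * D.wideSymbol j ξ) := by
        rw [symbol_mul_wideSymbol]
    _ = _ := by
        rw [← sum_symbol_near, _root_.sum_apply, Finset.mul_sum, Finset.mul_sum]
        exact Finset.sum_congr rfl fun i _ => by ring

theorem SFun_eq_sum_band (D : Choices) (j : ℕ) (v : ℝ → 𝓢'(ℝ, ℂ)) {t : ℝ}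
    (ht : t ∈ Icc (0 : ℝ) 1) (x : ℝ) :
    D.SFun j (v t) x =
      ∑ i ∈ Finset.Icc (j - 1) (j + 1), D.band i (fun t => D.S j (v t)) t x := by
  rw [SFun_eq_sum_SFun_S]
  exact Finset.sum_congr rfl fun i _ => by rw [D.band_of_mem i _ ht]

/-- A single product is integrable at every time, with one factor bounded and two in L². For a
finite index set this leaves no exceptional times. -/
theorem pairAt_zero_lt_top (hU : ∀ i, D.IsBand i (U i)) (hV : ∀ i, D.IsBand i (V i))
    (hW : ∀ i, D.IsBand i (W i)) (p : ℕ × ℕ × ℕ) (t : ℝ) : pairAt 0 U V W p t < ⊤ := by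
  have hI : ∫⁻ x, tripleAt U V W p t x < ⊤ := by
    have hu := (hU p.1).reproduced t
    have hv := (hV p.2.1).reproduced t
    have hw := (hW p.2.2).reproduced t
    obtain ⟨C, -, hC⟩ := hu.exists_bound
    calc ∫⁻ x, tripleAt U V W p t x
        ≤ ∫⁻ x, ENNReal.ofReal C * (‖V p.2.1 t x‖ₑ * ‖W p.2.2 t x‖ₑ) := by
          refine lintegral_mono fun x => ?_
          unfold tripleAt triple
          rw [mul_assoc]
          gcongr
          rw [← ofReal_norm]
          exact ENNReal.ofReal_le_ofReal (hC x)
      _ = ENNReal.ofReal C * ∫⁻ x, ‖V p.2.1 t x‖ₑ * ‖W p.2.2 t x‖ₑ :=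
          lintegral_const_mul' _ _ ENNReal.ofReal_ne_top
      _ ≤ ENNReal.ofReal C * (l2Norm volume (fun x => ‖V p.2.1 t x‖ₑ) *
          l2Norm volume (fun x => ‖W p.2.2 t x‖ₑ)) := by
          gcongr
          exact lintegral_mul_le_l2Norm volume hv.continuous.measurable.enorm.aemeasurable
            hw.continuous.measurable.enorm.aemeasurable
      _ < ⊤ := ENNReal.mul_lt_top ENNReal.ofReal_lt_top (ENNReal.mul_lt_top hv.memLp hw.memLp)
  unfold pairAt pairBound
  split_ifs
  · exact ENNReal.mul_lt_top (pow2_ne_top _).lt_top hI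
  · refine lt_of_le_of_lt (lintegral_mono fun x => mul_le_of_le_one_right' ?_) hI
    rw [ENNReal.ofReal_le_one]
    exact inv_le_one_of_one_le₀ (by nlinarith [sq_nonneg x])

/-- The product is a finite sum over triples with i ≤ j' ≤ k' + 2, so the bound for a single order
of the indices suffices, and the decay in the indices makes the constant independent of j and k. -/
theorem exists_localized_product (D : Choices) {s α β γ : ℝ} (hs : -3 / 2 ≤ s)
    (hsum : s + 1 < α + β + γ) (hγ : s - 2 ≤ γ) (hβγ : s - 1 / 2 < β + γ) :
    ∃ C : ℝ≥0, ∀ j k : ℕ, j ≤ k → ∀ u v w : ℝ → 𝓢'(ℝ, ℂ),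
      D.MemL2X α u → D.MemL2X β (fun t => D.S j (v t)) → D.MemL2X γ (fun t => D.S k (w t)) →
      ∃ f : ℝ → 𝓢'(ℝ, ℂ),
        (∀ t ∈ Icc (0 : ℝ) 1, IsGivenBy (f t) (fun x =>
          D.SLowFun (j - 4) (u t) x * D.SFun j (v t) x * D.SFun k (w t) x)) ∧
        D.MemL2Y s f ∧
        D.normL2Y s f ≤ C * D.normL2X α u * D.normL2X β (fun t => D.S j (v t)) *
          D.normL2X γ (fun t => D.S k (w t)) := by
  set δ := min (β + γ - (s - 1 / 2)) (α + β + γ - (s + 1)) / 4 with hδdef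
  have hδ : 0 < δ := div_pos (lt_min (by linarith) (by linarith)) (by norm_num)
  obtain ⟨K, hK, hKb⟩ := D.exists_weighted_bound (α := α) (β := β) (γ := γ) (δ := δ) hs hγ hδ
    (by rw [hδdef, mul_div_cancel₀ _ (by norm_num)]; exact min_le_left _ _)
    (by rw [hδdef, mul_div_cancel₀ _ (by norm_num)]; exact min_le_right _ _)
  have hC : 8 * (K * gainSum δ ^ 3) ≠ ⊤ :=
    ENNReal.mul_ne_top (by norm_num)
      (ENNReal.mul_ne_top hK.ne (ENNReal.pow_ne_top (gainSum_lt_top hδ).ne))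
  refine ⟨(8 * (K * gainSum δ ^ 3)).toNNReal, fun j k hjk u v w hu hv hw => ?_⟩
  rw [ENNReal.coe_toNNReal hC]
  set v' : ℝ → 𝓢'(ℝ, ℂ) := fun t => D.S j (v t)
  set w' : ℝ → 𝓢'(ℝ, ℂ) := fun t => D.S k (w t)
  have hU := D.isBand_band α hu
  have hV := D.isBand_band β hv
  have hW := D.isBand_band γ hw
  set a : ℕ → ℝ≥0∞ := fun i => D.weightedX α i (D.band i u)
  set b : ℕ → ℝ≥0∞ := fun i => D.weightedX β i (D.band i v')
  set c : ℕ → ℝ≥0∞ := fun i => D.weightedX γ i (D.band i w')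
  have ha : l2Sum a = D.normL2X α u := D.l2Sum_weightedX_band α u
  have hb : l2Sum b = D.normL2X β v' := D.l2Sum_weightedX_band β v'
  have hc : l2Sum c = D.normL2X γ w' := D.l2Sum_weightedX_band γ w'
  let I : Finset (ℕ × ℕ × ℕ) := Finset.range (j - 4) ×ˢ Finset.Icc (j - 1) (j + 1) ×ˢ
    Finset.Icc (k - 1) (k + 1)
  -- The index set is finite, so no gain from oscillation is needed and M = 0 will do.
  obtain ⟨f, hf⟩ := exists_isSumOver 0 hU hV hW (I : Set (ℕ × ℕ × ℕ))
  have hnorm : D.normL2Y s f ≤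
      8 * (K * gainSum δ ^ 3) * D.normL2X α u * D.normL2X β v' * D.normL2X γ w' := by
    refine (hf.normL2Y_le hU hV hW (fun p => Dominates p.1 p.2.1 p.2.2)
      (fun l p => K * (gainKernel δ p.1 p.2.1 p.2.2 l * (a p.1 * b p.2.1 * c p.2.2)))
      fun l p hp hl => ?_).trans ?_
    · simp only [I, Finset.coe_product, mem_prod, Finset.mem_coe, Finset.mem_range,
        Finset.mem_Icc] at hp
      exact (hKb p.1 p.2.1 p.2.2 _ _ _ (hU p.1) (hV p.2.1) (hW p.2.2) (by omega)
        (by omega)).1 l hl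
    · simp_rw [ENNReal.tsum_mul_left]
      rw [l2Sum_const_mul]
      calc _ ≤ 8 * (K * (gainSum δ ^ 3 * (l2Sum a * l2Sum b * l2Sum c))) := by
            gcongr
            exact l2Sum_gainKernel_le δ a b c
        _ = _ := by rw [ha, hb, hc]; ring
  refine ⟨f, fun t ht ψ => ?_, ⟨fun ψ => (hf.measurable hU hV hW ψ).aemeasurable, ?_⟩, hnorm⟩
  · simp only [D.SLowFun_eq_sum_band _ _ ht, D.SFun_eq_sum_band _ _ ht]
    obtain ⟨h1, h2⟩ := sum_integral_prodAt hU hV hW (Finset.range (j - 4))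
      (Finset.Icc (j - 1) (j + 1)) (Finset.Icc (k - 1) (k + 1)) t ψ
    refine ⟨h1, ?_⟩
    rw [← h2]
    have hgood : ∑' p : (I : Set (ℕ × ℕ × ℕ)), pairAt 0 (fun i => D.band i u)
        (fun i => D.band i v') (fun i => D.band i w') p t < ⊤ := by
      rw [Finset.tsum_subtype' I (fun p => pairAt 0 (fun i => D.band i u)
        (fun i => D.band i v') (fun i => D.band i w') p t)]
      exact ENNReal.sum_lt_top.2 fun p _ => pairAt_zero_lt_top hU hV hW p t
    rw [← (hf.hasSum t hgood ψ).tsum_eq]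
    exact Finset.tsum_subtype' I fun p => ∫ x, prodAt (fun i => D.band i u)
        (fun i => D.band i v') (fun i => D.band i w') p t x * ψ x
  · refine hnorm.trans_lt ?_
    exact ENNReal.mul_lt_top (ENNReal.mul_lt_top (ENNReal.mul_lt_top hC.lt_top hu.2) hv.2) hw.2

end Choices

end TrilinearEstimate

theorem mainTheorem4 (D : TrilinearEstimate.Choices) (s α β γ : ℝ) (hs : -3 / 2 ≤ s)
    (hsum : s + 1 < α + β + γ) :
    (s - 2 ≤ α → s - 2 ≤ β → s - 2 ≤ γ →
      s - 1 / 2 < α + β → s - 1 / 2 < β + γ → s - 1 / 2 < γ + α →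
      ∃ C : ℝ≥0, ∀ u v w : ℝ → 𝓢'(ℝ, ℂ),
        D.MemL2X α u → D.MemL2X β v → D.MemL2X γ w →
        ∃ f : ℝ → 𝓢'(ℝ, ℂ), D.IsProduct u v w f ∧ D.MemL2Y s f ∧
          D.normL2Y s f ≤ C * D.normL2X α u * D.normL2X β v * D.normL2X γ w) ∧
    (s - 2 ≤ γ → s - 1 / 2 < β + γ →
      ∃ C : ℝ≥0, ∀ j k : ℕ, j ≤ k → ∀ u v w : ℝ → 𝓢'(ℝ, ℂ),
        D.MemL2X α u → D.MemL2X β (fun t => D.S j (v t)) → D.MemL2X γ (fun t => D.S k (w t)) →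
        ∃ f : ℝ → 𝓢'(ℝ, ℂ),
          (∀ t ∈ Set.Icc (0 : ℝ) 1, TrilinearEstimate.IsGivenBy (f t) (fun x =>
            D.SLowFun (j - 4) (u t) x * D.SFun j (v t) x * D.SFun k (w t) x)) ∧
          D.MemL2Y s f ∧
          D.normL2Y s f ≤ C * D.normL2X α u * D.normL2X β (fun t => D.S j (v t)) *
            D.normL2X γ (fun t => D.S k (w t))) :=
  ⟨fun hα hβ hγ hαβ hβγ hγα => D.exists_product hs hsum hα hβ hγ hαβ hβγ hγα,
    fun hγ hβγ => D.exists_localized_product hs hsum hγ hβγ⟩
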